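/- **Conventions.** All algebras are associative, unital, over $\mathbb C$, and algebra maps are unital. For $x\otimes y\otimes z$ the upper index $ijk$ in $(x\otimes y\otimes z)^{ijk}$ means that $x,y,z$ are put in positions $i,j,k$; $\mathbf T^{13}$, $\mathbf T^{12}$, $\mathbf T^{23}$ are the usual leg embeddings. Write $\varphi_{(1)}\otimes\varphi_{(2)}$ for the coproduct of $\hat{\mathcal G}=\mathcal G^*$ dual to the multiplication of $\mathcal G$. Let $(\mathcal G,\Delta,\epsilon,\phi,S,\alpha,\beta)$ be a finite dimensional quasi-Hopf algebra over $\mathbb C$ with invertible antipode. So $\Delta,\epsilon$ are algebra maps, $\phi\in\mathcal G^{\otimes 3}$ is invertible, $({\rm id}\otimes\Delta)(\Delta(a))\phi=\phi(\Delta\otimes{\rm id})(\Delta(a))$, $({\rm id}\otimes{\rm id}\otimes\Delta)(\phi)(\Delta\otimes{\rm id}\otimes{\rm id})(\phi)=(1\otimes\phi)({\rm id}\otimes\Delta\otimes{\rm id})(\phi)(\phi\otimes1)$, $\epsilon$ is a two-sided counit for $\Delta$ and $({\rm id}\otimes\epsilon\otimes{\rm id})(\phi)=1\otimes1$ (*quasi-bialgebra*);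 $S$ is a bijective linear antimorphism with $S(a_{(1)})\alpha a_{(2)}=\epsilon(a)\alpha$, $a_{(1)}\beta S(a_{(2)})=\epsilon(a)\beta$, $X\beta S(Y)\alpha Z=1=S(P)\alpha Q\beta S(R)$ where $\phi=X\otimes Y\otimes Z$, $\phi^{-1}=P\otimes Q\otimes R$. A *quasi-commuting pair* $(\lambda,\rho,\phi_\lambda,\phi_\rho,\phi_{\lambda\rho})$ of coactions of a quasi-bialgebra $(\mathcal G,\Delta,\epsilon,\phi)$ on an algebra $\mathcal M$ consists of algebra maps $\lambda:\mathcal M\to\mathcal G\otimes\mathcal M$, $\rho:\mathcal M\to\mathcal M\otimes\mathcal G$ and invertible elements $\phi_\lambda\in\mathcal G\otimes\mathcal G\otimes\mathcal M$, $\phi_\rho\in\mathcal M\otimes\mathcal G\otimes\mathcal G$, $\phi_{\lambda\rho}\in\mathcal G\otimes\mathcal M\otimes\mathcal G$ such that, for all $m\in\mathcal M$, $$({\rm id}\otimes\lambda)(\lambda(m))\phi_\lambda=\phi_\lambda(\Delta\otimes{\rm id})(\lambda(m)),\qquad(1\otimes\phi_\lambda)({\rm id}\otimes\Delta\otimes{\rm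 id})(\phi_\lambda)(\phi\otimes1)=({\rm id}\otimes{\rm id}\otimes\lambda)(\phi_\lambda)(\Delta\otimes{\rm id}\otimes{\rm id})(\phi_\lambda),$$ $$\phi_\rho(\rho\otimes{\rm id})(\rho(m))=({\rm id}\otimes\Delta)(\rho(m))\phi_\rho,\qquad(1\otimes\phi)({\rm id}\otimes\Delta\otimes{\rm id})(\phi_\rho)(\phi_\rho\otimes1)=({\rm id}\otimes{\rm id}\otimes\Delta)(\phi_\rho)(\rho\otimes{\rm id}\otimes{\rm id})(\phi_\rho),$$ $$\phi_{\lambda\rho}(\lambda\otimes{\rm id})(\rho(m))=({\rm id}\otimes\rho)(\lambda(m))\phi_{\lambda\rho},$$ $$(1\otimes\phi_{\lambda\rho})({\rm id}\otimes\lambda\otimes{\rm id})(\phi_{\lambda\rho})(\phi_\lambda\otimes1)=({\rm id}\otimes{\rm id}\otimes\rho)(\phi_\lambda)(\Delta\otimes{\rm id}\otimes{\rm id})(\phi_{\lambda\rho}),$$ $$(1\otimes\phi_\rho)({\rm id}\otimes\rho\otimes{\rm id})(\phi_{\lambda\rho})(\phi_{\lambda\rho}\otimes1)=({\rm id}\otimes{\rm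 id}\otimes\Delta)(\phi_{\lambda\rho})(\lambda\otimes{\rm id}\otimes{\rm id})(\phi_\rho),$$ and $(\epsilon\otimes{\rm id})\circ\lambda={\rm id}=({\rm id}\otimes\epsilon)\circ\rho$, $({\rm id}\otimes\epsilon\otimes{\rm id})(\phi_\lambda)=(\epsilon\otimes{\rm id}\otimes{\rm id})(\phi_\lambda)=1$, $({\rm id}\otimes\epsilon\otimes{\rm id})(\phi_\rho)=({\rm id}\otimes{\rm id}\otimes\epsilon)(\phi_\rho)=1$. The *diagonal crossed product* $\mathcal M_1=\hat{\mathcal G}\,{}_\lambda\!\bowtie_\rho\mathcal M$ of such a pair is the universal algebra with an algebra map $i_{\mathcal M_1}:\mathcal M\to\mathcal M_1$ and a linear map $\Gamma:\hat{\mathcal G}\to\mathcal M_1$ such that $\mathbf\Gamma=\sum_\mu e_\mu\otimes\Gamma(e^\mu)\in\mathcal G\otimes\mathcal M_1$ (dual bases) satisfies, with $i_{\mathcal M_1}$ suppressed, $$(\epsilon\otimes{\rm id})(\mathbf\Gamma)=1,\qquad\mathbf\Gamma\,\lambda(m)=\rho^{op}(m)\,\mathbf\Gamma,\qquad\phi_\rho^{312}\,\mathbf\Gamma^{13}\,(\phi_{\lambda\rho}^{132})^{-1}\,\mathbf\Gamma^{23}\,\phi_\lambda=(\Delta\otimes{\rm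 id})(\mathbf\Gamma).$$ It is identified with an algebra structure on $\hat{\mathcal G}\otimes\mathcal M$ by means of the map $$\mu_L:\hat{\mathcal G}\otimes\mathcal M\to\mathcal M_1,\quad\varphi\otimes m\mapsto({\rm id}\otimes\varphi_{(1)})(q_\rho)\,\Gamma(\varphi_{(2)})\,m,\qquad q_\rho=\phi_\rho^1\otimes S^{-1}(\alpha\phi_\rho^3)\phi_\rho^2 .$$ The *quantum double* $\mathcal D(\mathcal G)$ is the diagonal crossed product for $\mathcal M=\mathcal G$, $\lambda=\rho=\Delta$, $\phi_\lambda=\phi_\rho=\phi_{\lambda\rho}=\phi$; write $i_D:\mathcal G\to\mathcal D(\mathcal G)$ for its canonical map and $\mathbf D\in\mathcal G\otimes\mathcal D(\mathcal G)$ for its universal element $\mathbf\Gamma$. **Theorem.** For every quasi-commuting pair of $\mathcal G$-coactions on an algebra $\mathcal M$ (in particular for $\mathcal D(\mathcal G)$) the map $i_{\mathcal M_1}$ is injective and $\mu_L$ is bijective. Moreover: (i) There are a unique algebra map $\epsilon_D:\mathcal D(\mathcal G)\to\mathbb C$ with $\epsilon_D(i_D(a))=\epsilon(a)$ for all $a\in\mathcal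 G$ and $({\rm id}\otimes\epsilon_D)(\mathbf D)=1_{\mathcal G}$, and a unique algebra map $\Delta_D:\mathcal D(\mathcal G)\to\mathcal D(\mathcal G)\otimes\mathcal D(\mathcal G)$ with $\Delta_D(i_D(a))=(i_D\otimes i_D)(\Delta(a))$ for all $a\in\mathcal G$ and $$({\rm id}\otimes\Delta_D)(\mathbf D)=(\phi^{-1})^{231}\,\mathbf D^{13}\,\phi^{213}\,\mathbf D^{12}\,\phi^{-1}\in\mathcal G\otimes\mathcal D(\mathcal G)\otimes\mathcal D(\mathcal G)$$ ($i_D$ suppressed in the last two legs of $\phi^{\pm1}$). With $\phi_D=(i_D\otimes i_D\otimes i_D)(\phi)$, $(\mathcal D(\mathcal G),\Delta_D,\epsilon_D,\phi_D)$ is a quasi-bialgebra, and in $\mathcal D(\mathcal G)^{\otimes3}$, with $\mathbf D$ on the right hand side read as $(i_D\otimes{\rm id})(\mathbf D)$, $$(i_D\otimes\Delta_D)(\mathbf D)=(\phi_D^{-1})^{231}\,\mathbf D^{13}\,\phi_D^{213}\,\mathbf D^{12}\,\phi_D^{-1}.$$ (ii) For every quasi-commuting pair $(\lambda,\rho,\phi_\lambda,\phi_\rho,\phi_{\lambda\rho})$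 of $\mathcal G$-coactions on an algebra $\mathcal M$ there are unique algebra maps $\lambda_D:\mathcal M_1\to\mathcal D(\mathcal G)\otimes\mathcal M_1$ and $\rho_D:\mathcal M_1\to\mathcal M_1\otimes\mathcal D(\mathcal G)$ which extend $\lambda$ and $\rho$, i.e. $\lambda_D\circ i_{\mathcal M_1}=(i_D\otimes i_{\mathcal M_1})\circ\lambda$ and $\rho_D\circ i_{\mathcal M_1}=(i_{\mathcal M_1}\otimes i_D)\circ\rho$, and satisfy (embeddings suppressed) $$({\rm id}\otimes\lambda_D)(\mathbf\Gamma)=(\phi_{\lambda\rho}^{-1})^{231}\,\mathbf\Gamma^{13}\,\phi_\lambda^{213}\,\mathbf D^{12}\,\phi_\lambda^{-1}\in\mathcal G\otimes\mathcal D(\mathcal G)\otimes\mathcal M_1,$$ $$({\rm id}\otimes\rho_D)(\mathbf\Gamma)=(\phi_\rho^{-1})^{231}\,\mathbf D^{13}\,\phi_\rho^{213}\,\mathbf\Gamma^{12}\,\phi_{\lambda\rho}^{-1}\in\mathcal G\otimes\mathcal M_1\otimes\mathcal D(\mathcal G).$$ With $\phi_{\lambda_D}=(i_D\otimes i_D\otimes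 i_{\mathcal M_1})(\phi_\lambda)$, $\phi_{\rho_D}=(i_{\mathcal M_1}\otimes i_D\otimes i_D)(\phi_\rho)$, $\phi_{\lambda_D\rho_D}=(i_D\otimes i_{\mathcal M_1}\otimes i_D)(\phi_{\lambda\rho})$, the tuple $(\lambda_D,\rho_D,\phi_{\lambda_D},\phi_{\rho_D},\phi_{\lambda_D\rho_D})$ is a quasi-commuting pair of coactions of $(\mathcal D(\mathcal G),\Delta_D,\epsilon_D,\phi_D)$ on $\mathcal M_1$. -/

import Mathlib

open scoped TensorProduct

noncomputable section

namespace QuasiHopf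

/-! ## Tensor legs

All threefold tensor products are bracketed as `A ⊗ (B ⊗ C)`. For an element `x ⊗ y ⊗ z` the
superscript notation `(x ⊗ y ⊗ z)^{ijk}` means that the first factor is put in position `i`, the
second one in position `j` and the third one in position `k`. -/

section Legs

universe u₁ u₂ u₃ u₄

variable {A : Type u₁} {B : Type u₂} {C : Type u₃} {E : Type u₄}
  [Ring A] [Algebra ℂ A] [Ring B] [Algebra ℂ B] [Ring C] [Algebra ℂ C] [Ring E] [Algebra ℂ E]

/-- `id ⊗ f`. -/
def onRight (f : B →ₐ[ℂ] C) : A ⊗[ℂ] B →ₐ[ℂ] A ⊗[ℂ] C :=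
  Algebra.TensorProduct.map (AlgHom.id ℂ A) f

/-- `f ⊗ id` for a map `f : A → B ⊗ C`, rebracketed. -/
def onLeft (f : A →ₐ[ℂ] B ⊗[ℂ] C) : A ⊗[ℂ] E →ₐ[ℂ] B ⊗[ℂ] (C ⊗[ℂ] E) :=
  (Algebra.TensorProduct.assoc ℂ ℂ ℂ B C E).toAlgHom.comp
    (Algebra.TensorProduct.map f (AlgHom.id ℂ E))

/-- `e ⊗ id` for a character `e : A → ℂ`. -/
def killLeft (e : A →ₐ[ℂ] ℂ) : A ⊗[ℂ] B →ₐ[ℂ] B :=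
  (Algebra.TensorProduct.lid ℂ B).toAlgHom.comp
    (Algebra.TensorProduct.map e (AlgHom.id ℂ B))

/-- `id ⊗ e` for a character `e : B → ℂ`. -/
def killRight (e : B →ₐ[ℂ] ℂ) : A ⊗[ℂ] B →ₐ[ℂ] A :=
  (Algebra.TensorProduct.rid ℂ ℂ A).toAlgHom.comp
    (Algebra.TensorProduct.map (AlgHom.id ℂ A) e)

/-- `f ⊗ g ⊗ h`. -/
def map₃ {A' : Type*} {B' : Type*} {C' : Type*} [Ring A'] [Algebra ℂ A'] [Ring B'] [Algebra ℂ B']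
    [Ring C'] [Algebra ℂ C'] (f : A →ₐ[ℂ] A') (g : B →ₐ[ℂ] B') (h : C →ₐ[ℂ] C') :
    A ⊗[ℂ] (B ⊗[ℂ] C) →ₐ[ℂ] A' ⊗[ℂ] (B' ⊗[ℂ] C') :=
  Algebra.TensorProduct.map f (Algebra.TensorProduct.map g h)

/-- `x ⊗ y ↦ x ⊗ y ⊗ 1`. -/
def leg12 : A ⊗[ℂ] B →ₐ[ℂ] A ⊗[ℂ] (B ⊗[ℂ] C) :=
  onRight Algebra.TensorProduct.includeLeft

/-- `x ⊗ y ↦ x ⊗ 1 ⊗ y`. -/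
def leg13 : A ⊗[ℂ] C →ₐ[ℂ] A ⊗[ℂ] (B ⊗[ℂ] C) :=
  onRight Algebra.TensorProduct.includeRight

/-- `x ↦ 1 ⊗ x`; in particular `x ⊗ y ↦ 1 ⊗ x ⊗ y`. -/
def oneTmul : B →ₐ[ℂ] A ⊗[ℂ] B := Algebra.TensorProduct.includeRight

/-- `x ⊗ y ⊗ z ↦ x ⊗ y ⊗ z ⊗ 1`. -/
def tmulOne : A ⊗[ℂ] (B ⊗[ℂ] C) →ₐ[ℂ] A ⊗[ℂ] (B ⊗[ℂ] (C ⊗[ℂ] E)) :=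
  onRight leg12

/-- `x ⊗ y ⊗ z ↦ (x ⊗ y ⊗ z)^{213} = y ⊗ x ⊗ z`. -/
def perm213 : A ⊗[ℂ] (B ⊗[ℂ] C) →ₐ[ℂ] B ⊗[ℂ] (A ⊗[ℂ] C) :=
  (onLeft (Algebra.TensorProduct.comm ℂ A B).toAlgHom).comp
    (Algebra.TensorProduct.assoc ℂ ℂ ℂ A B C).symm.toAlgHom

/-- `x ⊗ y ⊗ z ↦ (x ⊗ y ⊗ z)^{132} = x ⊗ z ⊗ y`. -/
def perm132 : A ⊗[ℂ] (B ⊗[ℂ] C) →ₐ[ℂ] A ⊗[ℂ] (C ⊗[ℂ] B) :=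
  onRight (Algebra.TensorProduct.comm ℂ B C).toAlgHom

/-- `x ⊗ y ⊗ z ↦ (x ⊗ y ⊗ z)^{231} = z ⊗ x ⊗ y`. -/
def perm231 : A ⊗[ℂ] (B ⊗[ℂ] C) →ₐ[ℂ] C ⊗[ℂ] (A ⊗[ℂ] B) :=
  (Algebra.TensorProduct.comm ℂ (A ⊗[ℂ] B) C).toAlgHom.comp
    (Algebra.TensorProduct.assoc ℂ ℂ ℂ A B C).symm.toAlgHom

/-- `x ⊗ y ⊗ z ↦ (x ⊗ y ⊗ z)^{312} = y ⊗ z ⊗ x`. -/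
def perm312 : A ⊗[ℂ] (B ⊗[ℂ] C) →ₐ[ℂ] B ⊗[ℂ] (C ⊗[ℂ] A) :=
  (Algebra.TensorProduct.assoc ℂ ℂ ℂ B C A).toAlgHom.comp
    (Algebra.TensorProduct.comm ℂ A (B ⊗[ℂ] C)).toAlgHom

/-- `φ ⊗ id` for a linear functional `φ`. -/
def slice {X : Type*} [AddCommGroup X] [Module ℂ X] (φ : Module.Dual ℂ A) : A ⊗[ℂ] X →ₗ[ℂ] X :=
  (TensorProduct.lid ℂ X).toLinearMap ∘ₗ LinearMap.rTensor X φ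

end Legs

/-! ## Quasi-bialgebras and quasi-Hopf algebras -/

/-- A quasi-bialgebra structure `(Δ, ε, φ)` on a unital complex algebra. -/
structure QuasiBialgebra (G : Type*) [Ring G] [Algebra ℂ G] where
  /-- the coproduct `Δ` -/
  comul : G →ₐ[ℂ] G ⊗[ℂ] G
  /-- the counit `ε` -/
  counit : G →ₐ[ℂ] ℂ
  /-- the reassociator `φ` -/
  reassoc : (G ⊗[ℂ] (G ⊗[ℂ] G))ˣ
  /-- `(id ⊗ Δ)(Δ(a)) φ = φ (Δ ⊗ id)(Δ(a))` -/
  quasi_coassoc : ∀ a : G,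
    onRight comul (comul a) * reassoc.val = reassoc.val * onLeft comul (comul a)
  /-- `(id ⊗ id ⊗ Δ)(φ) (Δ ⊗ id ⊗ id)(φ) = (1 ⊗ φ) (id ⊗ Δ ⊗ id)(φ) (φ ⊗ 1)` -/
  pentagon :
    onRight (onRight comul) reassoc.val * onLeft comul reassoc.val =
      oneTmul reassoc.val * onRight (onLeft comul) reassoc.val * tmulOne reassoc.val
  /-- `(ε ⊗ id) ∘ Δ = id` -/
  counit_left : ∀ a : G, killLeft counit (comul a) = a
  /-- `(id ⊗ ε) ∘ Δ = id` -/
  counit_right : ∀ a : G, killRight counit (comul a) = a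
  /-- `(id ⊗ ε ⊗ id)(φ) = 1 ⊗ 1` -/
  counit_reassoc : onRight (killLeft counit) reassoc.val = 1

/-- A quasi-Hopf algebra structure: a quasi-bialgebra with an invertible antipode `S` and
elements `α`, `β`. -/
structure QuasiHopfAlgebra (G : Type*) [Ring G] [Algebra ℂ G] extends QuasiBialgebra G where
  /-- the antipode, a bijective antimorphism -/
  S : G ≃ₗ[ℂ] G
  α : G
  β : G
  S_mul : ∀ a b : G, S (a * b) = S b * S a
  /-- `S(a₍₁₎) α a₍₂₎ = ε(a) α` -/
  antipode_left : ∀ a : G,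
    LinearMap.mul' ℂ G (TensorProduct.map S.toLinearMap (LinearMap.mulLeft ℂ α) (comul a)) =
      counit a • α
  /-- `a₍₁₎ β S(a₍₂₎) = ε(a) β` -/
  antipode_right : ∀ a : G,
    LinearMap.mul' ℂ G (TensorProduct.map (LinearMap.mulRight ℂ β) S.toLinearMap (comul a)) =
      counit a • β
  /-- `X β S(Y) α Z = 1` where `φ = X ⊗ Y ⊗ Z` -/
  antipode_reassoc :
    LinearMap.mul' ℂ G (TensorProduct.map (LinearMap.mulRight ℂ β)
      (LinearMap.mul' ℂ G ∘ₗ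
        TensorProduct.map (LinearMap.mulRight ℂ α ∘ₗ S.toLinearMap) LinearMap.id)
      reassoc.val) = 1
  /-- `S(P) α Q β S(R) = 1` where `φ⁻¹ = P ⊗ Q ⊗ R` -/
  antipode_reassoc_inv :
    LinearMap.mul' ℂ G (TensorProduct.map (LinearMap.mulRight ℂ α ∘ₗ S.toLinearMap)
      (LinearMap.mul' ℂ G ∘ₗ TensorProduct.map (LinearMap.mulRight ℂ β) S.toLinearMap)
      reassoc⁻¹.val) = 1

/-! ## Coactions and quasi-commuting pairs -/

/-- A quasi-commuting pair `(λ, ρ, φ_λ, φ_ρ, φ_λρ)` of coactions of a quasi-bialgebra on a unital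
algebra `M`: a left coaction `(λ, φ_λ)`, a right coaction `(ρ, φ_ρ)` and an invertible
`φ_λρ ∈ G ⊗ M ⊗ G` relating them. -/
structure QuasiCommutingPair {G : Type*} [Ring G] [Algebra ℂ G] (Q : QuasiBialgebra G)
    (M : Type*) [Ring M] [Algebra ℂ M] where
  lam : M →ₐ[ℂ] G ⊗[ℂ] M
  rho : M →ₐ[ℂ] M ⊗[ℂ] G
  φl : (G ⊗[ℂ] (G ⊗[ℂ] M))ˣ
  φr : (M ⊗[ℂ] (G ⊗[ℂ] G))ˣ
  φlr : (G ⊗[ℂ] (M ⊗[ℂ] G))ˣ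
  /-- `(id ⊗ λ)(λ(m)) φ_λ = φ_λ (Δ ⊗ id)(λ(m))` -/
  lam_coassoc : ∀ m : M, onRight lam (lam m) * φl.val = φl.val * onLeft Q.comul (lam m)
  /-- `(1 ⊗ φ_λ) (id ⊗ Δ ⊗ id)(φ_λ) (φ ⊗ 1) = (id ⊗ id ⊗ λ)(φ_λ) (Δ ⊗ id ⊗ id)(φ_λ)` -/
  lam_pentagon :
    oneTmul φl.val * onRight (onLeft Q.comul) φl.val * tmulOne Q.reassoc.val =
      onRight (onRight lam) φl.val * onLeft Q.comul φl.val
  /-- `(ε ⊗ id) ∘ λ = id` -/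
  lam_counit : ∀ m : M, killLeft Q.counit (lam m) = m
  /-- `(id ⊗ ε ⊗ id)(φ_λ) = 1` -/
  φl_counit_mid : onRight (killLeft Q.counit) φl.val = 1
  /-- `(ε ⊗ id ⊗ id)(φ_λ) = 1` -/
  φl_counit_left : killLeft Q.counit φl.val = 1
  /-- `φ_ρ (ρ ⊗ id)(ρ(m)) = (id ⊗ Δ)(ρ(m)) φ_ρ` -/
  rho_coassoc : ∀ m : M, φr.val * onLeft rho (rho m) = onRight Q.comul (rho m) * φr.val
  /-- `(1 ⊗ φ) (id ⊗ Δ ⊗ id)(φ_ρ) (φ_ρ ⊗ 1) = (id ⊗ id ⊗ Δ)(φ_ρ) (ρ ⊗ id ⊗ id)(φ_ρ)` -/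
  rho_pentagon :
    oneTmul Q.reassoc.val * onRight (onLeft Q.comul) φr.val * tmulOne φr.val =
      onRight (onRight Q.comul) φr.val * onLeft rho φr.val
  /-- `(id ⊗ ε) ∘ ρ = id` -/
  rho_counit : ∀ m : M, killRight Q.counit (rho m) = m
  /-- `(id ⊗ ε ⊗ id)(φ_ρ) = 1` -/
  φr_counit_mid : onRight (killLeft Q.counit) φr.val = 1
  /-- `(id ⊗ id ⊗ ε)(φ_ρ) = 1` -/
  φr_counit_right : onRight (killRight Q.counit) φr.val = 1
  /-- `φ_λρ (λ ⊗ id)(ρ(m)) = (id ⊗ ρ)(λ(m)) φ_λρ` -/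
  quasi_comm : ∀ m : M, φlr.val * onLeft lam (rho m) = onRight rho (lam m) * φlr.val
  /-- `(1 ⊗ φ_λρ) (id ⊗ λ ⊗ id)(φ_λρ) (φ_λ ⊗ 1) = (id ⊗ id ⊗ ρ)(φ_λ) (Δ ⊗ id ⊗ id)(φ_λρ)` -/
  mixed_pentagon_lam :
    oneTmul φlr.val * onRight (onLeft lam) φlr.val * tmulOne φl.val =
      onRight (onRight rho) φl.val * onLeft Q.comul φlr.val
  /-- `(1 ⊗ φ_ρ) (id ⊗ ρ ⊗ id)(φ_λρ) (φ_λρ ⊗ 1) = (id ⊗ id ⊗ Δ)(φ_λρ) (λ ⊗ id ⊗ id)(φ_ρ)` -/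
  mixed_pentagon_rho :
    oneTmul φr.val * onRight (onLeft rho) φlr.val * tmulOne φlr.val =
      onRight (onRight Q.comul) φlr.val * onLeft lam φr.val

section SelfPair

universe u₁ u₂ u₃ u₄

variable {A : Type u₁} {B : Type u₂} {C : Type u₃} {E : Type u₄}
  [Ring A] [Algebra ℂ A] [Ring B] [Algebra ℂ B] [Ring C] [Algebra ℂ C] [Ring E] [Algebra ℂ E]

lemma onRight_tmul (f : B →ₐ[ℂ] C) (a : A) (b : B) :
    onRight f (a ⊗ₜ[ℂ] b) = a ⊗ₜ[ℂ] f b := by simp [onRight]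

lemma killLeft_tmul (e : A →ₐ[ℂ] ℂ) (a : A) (b : B) :
    killLeft e (a ⊗ₜ[ℂ] b) = e a • b := by simp [killLeft]

lemma killRight_tmul (e : B →ₐ[ℂ] ℂ) (a : A) (b : B) :
    killRight e (a ⊗ₜ[ℂ] b) = e b • a := by simp [killRight]

lemma onLeft_tmul (f : A →ₐ[ℂ] B ⊗[ℂ] C) (a : A) (x : E) :
    onLeft f (a ⊗ₜ[ℂ] x) = Algebra.TensorProduct.assoc ℂ ℂ ℂ B C E (f a ⊗ₜ[ℂ] x) := by
  simp [onLeft]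

/-- Two algebra maps out of a tensor product agree if they agree on pure tensors. -/
lemma congr_tmul {f g : A ⊗[ℂ] B →ₐ[ℂ] C} (h : ∀ a b, f (a ⊗ₜ[ℂ] b) = g (a ⊗ₜ[ℂ] b))
    (x : A ⊗[ℂ] B) : f x = g x := by
  induction x with
  | zero => simp
  | tmul a b => exact h a b
  | add x y hx hy => simp [hx, hy]

lemma killMid_assoc (e : B →ₐ[ℂ] ℂ) (t : A ⊗[ℂ] B) (x : C) :
    onRight (killLeft e) (Algebra.TensorProduct.assoc ℂ ℂ ℂ A B C (t ⊗ₜ[ℂ] x)) =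
      killRight e t ⊗ₜ[ℂ] x := by
  induction t with
  | zero => simp
  | tmul a b => simp [onRight_tmul, killLeft_tmul, killRight_tmul, TensorProduct.smul_tmul]
  | add t s ht hs => simp only [TensorProduct.add_tmul, map_add, ht, hs]

lemma killLeft_assoc (e : A →ₐ[ℂ] ℂ) (t : A ⊗[ℂ] B) (x : C) :
    killLeft e (Algebra.TensorProduct.assoc ℂ ℂ ℂ A B C (t ⊗ₜ[ℂ] x)) =
      killLeft e t ⊗ₜ[ℂ] x := by
  induction t with
  | zero => simp
  | tmul a b => simp [killLeft_tmul, TensorProduct.smul_tmul']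
  | add t s ht hs => simp only [TensorProduct.add_tmul, map_add, ht, hs]

lemma killLeft_onRight (e : A →ₐ[ℂ] ℂ) (f : B →ₐ[ℂ] C) (x : A ⊗[ℂ] B) :
    killLeft e (onRight f x) = f (killLeft e x) := by
  induction x with
  | zero => simp
  | tmul a b => simp [onRight_tmul, killLeft_tmul]
  | add t s ht hs => simp only [map_add, ht, hs]

lemma killMid_onRight (e : B →ₐ[ℂ] ℂ) (f : C →ₐ[ℂ] E) (x : A ⊗[ℂ] (B ⊗[ℂ] C)) :
    onRight (killLeft e) (onRight (onRight f) x) = onRight f (onRight (killLeft e) x) := by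
  induction x with
  | zero => simp
  | tmul a b => simp only [onRight_tmul, killLeft_onRight]
  | add t s ht hs => simp only [map_add, ht, hs]

lemma killMid_tmulOne (e : B →ₐ[ℂ] ℂ) (x : A ⊗[ℂ] (B ⊗[ℂ] C)) :
    onRight (killLeft e) (tmulOne (E := E) x) = leg12 (onRight (killLeft e) x) := by
  induction x with
  | zero => simp
  | tmul a b => simp [tmulOne, leg12, onRight_tmul, killLeft_onRight]
  | add t s ht hs => simp only [map_add, ht, hs]

variable {G : Type*} [Ring G] [Algebra ℂ G]

/-- `(ε ⊗ id ⊗ id)(φ) = 1` follows from the axioms of a quasi-bialgebra. -/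
lemma reassoc_counit_left (Q : QuasiBialgebra G) : killLeft Q.counit Q.reassoc.val = 1 := by
  have h := congrArg (onRight (A := G) (killLeft (B := G ⊗[ℂ] G) Q.counit)) Q.pentagon
  simp only [map_mul] at h
  have h1 : onRight (A := G) (killLeft (B := G ⊗[ℂ] G) Q.counit)
      (onRight (onRight Q.comul) Q.reassoc.val) = 1 := by
    rw [killMid_onRight, Q.counit_reassoc, map_one]
  have h2 : onRight (A := G) (killLeft (B := G ⊗[ℂ] G) Q.counit)
      (onLeft Q.comul Q.reassoc.val) = Q.reassoc.val := by
    refine congr_tmul (f := (onRight (killLeft Q.counit)).comp (onLeft Q.comul))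
      (g := AlgHom.id ℂ _) (fun a x => ?_) _
    simp [onLeft_tmul, killMid_assoc, Q.counit_right]
  have h3 : onRight (A := G) (killLeft (B := G ⊗[ℂ] G) Q.counit)
      (oneTmul Q.reassoc.val) = oneTmul (killLeft Q.counit Q.reassoc.val) := by
    simp [oneTmul, onRight_tmul]
  have h4 : onRight (A := G) (killLeft (B := G ⊗[ℂ] G) Q.counit)
      (onRight (onLeft Q.comul) Q.reassoc.val) = Q.reassoc.val := by
    refine congr_tmul (f := (onRight (killLeft Q.counit)).comp (onRight (onLeft Q.comul)))
      (g := AlgHom.id ℂ _) (fun a x => ?_) _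
    simp only [AlgHom.comp_apply, onRight_tmul, AlgHom.id_apply]
    congr 1
    refine congr_tmul (f := (killLeft Q.counit).comp (onLeft Q.comul))
      (g := AlgHom.id ℂ _) (fun a x => ?_) _
    simp [onLeft_tmul, killLeft_assoc, Q.counit_left]
  have h5 : onRight (A := G) (killLeft (B := G ⊗[ℂ] G) Q.counit)
      (tmulOne Q.reassoc.val) = 1 := by
    rw [killMid_tmulOne, Q.counit_reassoc, map_one]
  rw [h1, h2, h3, h4, h5, one_mul, mul_one] at h
  have h6 : oneTmul (A := G) (killLeft Q.counit Q.reassoc.val) = 1 :=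
    Q.reassoc.isUnit.mul_eq_right.mp h.symm
  have h7 := congrArg (killLeft Q.counit) h6
  simpa [oneTmul, killLeft_tmul] using h7

/-- `(id ⊗ id ⊗ ε)(φ) = 1` follows from the axioms of a quasi-bialgebra. -/
lemma reassoc_counit_right (Q : QuasiBialgebra G) :
    onRight (killRight Q.counit) Q.reassoc.val = 1 := by
  have h := congrArg
    (onRight (A := G) (onRight (A := G) (killLeft (B := G) Q.counit))) Q.pentagon
  simp only [map_mul] at h
  have h1 : onRight (A := G) (onRight (A := G) (killLeft (B := G) Q.counit))
      (onRight (onRight Q.comul) Q.reassoc.val) = Q.reassoc.val := by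
    refine congr_tmul
      (f := (onRight (onRight (killLeft Q.counit))).comp (onRight (onRight Q.comul)))
      (g := AlgHom.id ℂ _) (fun a x => ?_) _
    simp only [AlgHom.comp_apply, onRight_tmul, AlgHom.id_apply]
    congr 1
    refine congr_tmul (f := (onRight (killLeft Q.counit)).comp (onRight Q.comul))
      (g := AlgHom.id ℂ _) (fun a x => ?_) _
    simp [onRight_tmul, Q.counit_left]
  have h2 : onRight (A := G) (onRight (A := G) (killLeft (B := G) Q.counit))
      (onLeft Q.comul Q.reassoc.val) = 1 := by
    have := congrArg (onLeft (E := G) Q.comul) Q.counit_reassoc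
    rw [map_one] at this
    rw [← this]
    refine congr_tmul (f := (onRight (onRight (killLeft Q.counit))).comp (onLeft Q.comul))
      (g := (onLeft Q.comul).comp (onRight (killLeft Q.counit))) (fun a x => ?_) _
    simp only [AlgHom.comp_apply, onRight_tmul, onLeft_tmul]
    generalize Q.comul a = t
    induction t with
    | zero => simp
    | tmul a b => simp [onRight_tmul]
    | add t s ht hs => simp only [TensorProduct.add_tmul, map_add, ht, hs]
  have h3 : onRight (A := G) (onRight (A := G) (killLeft (B := G) Q.counit))
      (oneTmul Q.reassoc.val) = 1 := by
    have := Q.counit_reassoc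
    simp only [oneTmul, Algebra.TensorProduct.includeRight_apply, onRight_tmul, this]
    rfl
  have h4 : onRight (A := G) (onRight (A := G) (killLeft (B := G) Q.counit))
      (onRight (onLeft Q.comul) Q.reassoc.val) = Q.reassoc.val := by
    refine congr_tmul
      (f := (onRight (onRight (killLeft Q.counit))).comp (onRight (onLeft Q.comul)))
      (g := AlgHom.id ℂ _) (fun a x => ?_) _
    simp only [AlgHom.comp_apply, onRight_tmul, AlgHom.id_apply]
    congr 1
    refine congr_tmul (f := (onRight (killLeft Q.counit)).comp (onLeft Q.comul))
      (g := AlgHom.id ℂ _) (fun a x => ?_) _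
    simp [onLeft_tmul, killMid_assoc, Q.counit_right]
  have h5 : onRight (A := G) (onRight (A := G) (killLeft (B := G) Q.counit))
      (tmulOne Q.reassoc.val) = leg12 (onRight (killRight Q.counit) Q.reassoc.val) := by
    refine congr_tmul (f := (onRight (onRight (killLeft Q.counit))).comp tmulOne)
      (g := leg12.comp (onRight (killRight Q.counit))) (fun a x => ?_) _
    simp only [AlgHom.comp_apply, onRight_tmul, tmulOne, leg12]
    congr 1
    refine congr_tmul (f := (onRight (killLeft Q.counit)).comp leg12)
      (g := Algebra.TensorProduct.includeLeft.comp (killRight Q.counit)) (fun a x => ?_) _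
    simp [leg12, onRight_tmul, killLeft_tmul, killRight_tmul]
  rw [h1, h2, h3, h4, h5, one_mul, mul_one] at h
  have h6 : leg12 (C := G) (onRight (killRight Q.counit) Q.reassoc.val) = 1 :=
    Q.reassoc.isUnit.mul_eq_left.mp h.symm
  have h7 := congrArg (onRight (A := G) (killRight (A := G) Q.counit)) h6
  have h8 : ∀ y : G ⊗[ℂ] G,
      onRight (A := G) (killRight (A := G) Q.counit) (leg12 y) = y := by
    intro y
    refine congr_tmul (f := (onRight (killRight Q.counit)).comp leg12)
      (g := AlgHom.id ℂ _) (fun a x => ?_) _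
    simp [leg12, onRight_tmul, killRight_tmul]
  rwa [h8, map_one] at h7

/-- The quasi-commuting pair `λ = ρ = Δ`, `φ_λ = φ_ρ = φ_λρ = φ` on `M = G`. -/
def QuasiBialgebra.selfPair (Q : QuasiBialgebra G) : QuasiCommutingPair Q G where
  lam := Q.comul
  rho := Q.comul
  φl := Q.reassoc
  φr := Q.reassoc
  φlr := Q.reassoc
  lam_coassoc := Q.quasi_coassoc
  lam_pentagon := Q.pentagon.symm
  lam_counit := Q.counit_left
  φl_counit_mid := Q.counit_reassoc
  φl_counit_left := reassoc_counit_left Q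
  rho_coassoc a := (Q.quasi_coassoc a).symm
  rho_pentagon := Q.pentagon.symm
  rho_counit := Q.counit_right
  φr_counit_mid := Q.counit_reassoc
  φr_counit_right := reassoc_counit_right Q
  quasi_comm a := (Q.quasi_coassoc a).symm
  mixed_pentagon_lam := Q.pentagon.symm
  mixed_pentagon_rho := Q.pentagon.symm

end SelfPair

/-! ## The diagonal crossed product -/

section DiagonalCrossedProduct

universe u v

variable {G : Type u} [Ring G] [Algebra ℂ G] [FiniteDimensional ℂ G] {Q : QuasiBialgebra G}
  {M : Type v} [Ring M] [Algebra ℂ M]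

/-- The element `∑ e_μ ⊗ f(e^μ) ∈ G ⊗ X` of a linear map `f : Ĝ → X`, where `e_μ`, `e^μ` are dual
bases of `G` and its dual `Ĝ`. -/
def genElt {X : Type*} [AddCommGroup X] [Module ℂ X] (f : Module.Dual ℂ G →ₗ[ℂ] X) : G ⊗[ℂ] X :=
  LinearMap.lTensor G f (coevaluation ℂ G 1)

/-- The tensor algebra on `M ⊕ Ĝ`, i.e. the free algebra containing `M` and `Ĝ` as
linear subspaces. -/
abbrev PreAlg (G : Type u) [Ring G] [Algebra ℂ G] (M : Type v) [Ring M] [Algebra ℂ M] :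
    Type (max u v) :=
  TensorAlgebra ℂ (M × Module.Dual ℂ G)

/-- The generators `m ∈ M` of the free algebra. -/
def preIncl (G : Type u) [Ring G] [Algebra ℂ G] (M : Type v) [Ring M] [Algebra ℂ M] :
    M →ₗ[ℂ] PreAlg G M :=
  TensorAlgebra.ι ℂ ∘ₗ LinearMap.inl ℂ M (Module.Dual ℂ G)

/-- The generators `Γ(φ)`, `φ ∈ Ĝ`, of the free algebra. -/
def preΓ (G : Type u) [Ring G] [Algebra ℂ G] (M : Type v) [Ring M] [Algebra ℂ M] :
    Module.Dual ℂ G →ₗ[ℂ] PreAlg G M :=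
  TensorAlgebra.ι ℂ ∘ₗ LinearMap.inr ℂ M (Module.Dual ℂ G)

/-- `id ⊗ f` for a linear map `f : M → X`. -/
def push₁ {X : Type*} [AddCommGroup X] [Module ℂ X] (f : M →ₗ[ℂ] X) :
    G ⊗[ℂ] M →ₗ[ℂ] G ⊗[ℂ] X :=
  LinearMap.lTensor G f

/-- `id ⊗ id ⊗ f` for a linear map `f : M → X`. -/
def push₂ {X : Type*} [AddCommGroup X] [Module ℂ X] (f : M →ₗ[ℂ] X) :
    G ⊗[ℂ] (G ⊗[ℂ] M) →ₗ[ℂ] G ⊗[ℂ] (G ⊗[ℂ] X) :=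
  LinearMap.lTensor G (LinearMap.lTensor G f)

/-- The defining relations of the diagonal crossed product. They say that `M` is mapped by a
unital algebra homomorphism and that `T = ∑ e_μ ⊗ Γ(e^μ)` is a normal coherent
`λρ`-intertwiner:
`(ε ⊗ id)(T) = 1`, `T λ(m) = ρ^op(m) T` and
`φ_ρ^{312} T^{13} (φ_λρ^{132})⁻¹ T^{23} φ_λ = (Δ ⊗ id)(T)`.
The last two identities live in `G ⊗ _` and `G ⊗ G ⊗ _` and are imposed componentwise, by
evaluating the copies of `G` against arbitrary functionals. -/
inductive Rel (P : QuasiCommutingPair Q M) : PreAlg G M → PreAlg G M → Prop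
  | one : Rel P (preIncl G M 1) 1
  | mul (m n : M) : Rel P (preIncl G M (m * n)) (preIncl G M m * preIncl G M n)
  | normal : Rel P (preΓ G M Q.counit.toLinearMap) 1
  | intertwine (m : M) (φ : Module.Dual ℂ G) :
      Rel P
        (slice φ (genElt (preΓ G M) * push₁ (preIncl G M) (P.lam m)))
        (slice φ (push₁ (preIncl G M) (Algebra.TensorProduct.comm ℂ M G (P.rho m)) *
          genElt (preΓ G M)))
  | coherent (φ ψ : Module.Dual ℂ G) :
      Rel P
        (slice ψ (slice φ
          (push₂ (preIncl G M) (perm312 P.φr.val) * leg13 (genElt (preΓ G M)) *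
            push₂ (preIncl G M) (perm132 P.φlr⁻¹.val) * oneTmul (genElt (preΓ G M)) *
            push₂ (preIncl G M) P.φl.val)))
        (slice ψ (slice φ (onLeft Q.comul (genElt (preΓ G M)))))

/-- The diagonal crossed product `M₁ = Ĝ ⋈ M` of a quasi-commuting pair: the universal unital
algebra generated by `M` and `Γ(Ĝ)` such that `M → M₁` is a unital algebra map and the universal
intertwiner `∑ e_μ ⊗ Γ(e^μ)` is normal, coherent and intertwines `λ` with `ρ^op`. -/
def DiagonalCrossedProduct (P : QuasiCommutingPair Q M) : Type (max u v) := RingQuot (Rel P)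

instance (P : QuasiCommutingPair Q M) : Ring (DiagonalCrossedProduct P) :=
  inferInstanceAs (Ring (RingQuot (Rel P)))

instance (P : QuasiCommutingPair Q M) : Algebra ℂ (DiagonalCrossedProduct P) :=
  inferInstanceAs (Algebra ℂ (RingQuot (Rel P)))

namespace QuasiCommutingPair

variable (P : QuasiCommutingPair Q M)

/-- The quotient map from the free algebra. -/
def proj : PreAlg G M →ₐ[ℂ] DiagonalCrossedProduct P := RingQuot.mkAlgHom ℂ (Rel P)

/-- The canonical map `i_{M₁} : M → M₁`. -/
def incl : M →ₐ[ℂ] DiagonalCrossedProduct P :=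
  AlgHom.ofLinearMap (P.proj.toLinearMap ∘ₗ preIncl G M)
    (by
      have h : P.proj (preIncl G M 1) = P.proj 1 := RingQuot.mkAlgHom_rel ℂ (Rel.one (P := P))
      simpa using h)
    (by
      intro m n
      have h : P.proj (preIncl G M (m * n)) = P.proj (preIncl G M m * preIncl G M n) :=
        RingQuot.mkAlgHom_rel ℂ (Rel.mul (P := P) m n)
      simpa using h)

/-- The canonical linear map `Γ : Ĝ → M₁`. -/
def Γ : Module.Dual ℂ G →ₗ[ℂ] DiagonalCrossedProduct P := P.proj.toLinearMap ∘ₗ preΓ G M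

/-- The universal `λρ`-intertwiner `∑ e_μ ⊗ Γ(e^μ) ∈ G ⊗ M₁`. -/
def univ : G ⊗[ℂ] DiagonalCrossedProduct P := genElt P.Γ

end QuasiCommutingPair

end DiagonalCrossedProduct

section Model

universe u v

variable {G : Type u} [Ring G] [Algebra ℂ G] [FiniteDimensional ℂ G]
  {M : Type v} [Ring M] [Algebra ℂ M] (H : QuasiHopfAlgebra G)

/-- `q_ρ^op = S⁻¹(α Z) Y ⊗ X ∈ G ⊗ M`, where `φ_ρ = X ⊗ Y ⊗ Z ∈ M ⊗ G ⊗ G`. -/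
def qRhoOp (P : QuasiCommutingPair H.toQuasiBialgebra M) : G ⊗[ℂ] M :=
  TensorProduct.comm ℂ M G
    (LinearMap.lTensor M
      (LinearMap.mul' ℂ G ∘ₗ
        TensorProduct.map (H.S.symm.toLinearMap ∘ₗ LinearMap.mulLeft ℂ H.α) LinearMap.id ∘ₗ
        (TensorProduct.comm ℂ G G).toLinearMap)
      P.φr.val)

/-- The map `μ_L : Ĝ ⊗ M → M₁`,
`φ ⊗ m ↦ (id ⊗ φ₍₁₎)(q_ρ) Γ(φ₍₂₎) m = (φ ⊗ id)(q_ρ^op · ∑ e_μ ⊗ Γ(e^μ)) m`. -/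
def muL (P : QuasiCommutingPair H.toQuasiBialgebra M) :
    Module.Dual ℂ G ⊗[ℂ] M →ₗ[ℂ] DiagonalCrossedProduct P :=
  TensorProduct.lift <| LinearMap.mk₂ ℂ
    (fun (φ : Module.Dual ℂ G) (m : M) =>
      slice φ (onRight P.incl (qRhoOp H P) * P.univ) * P.incl m)
    (fun φ ψ m => by simp [slice, LinearMap.rTensor_add, add_mul])
    (fun c φ m => by simp [slice, LinearMap.rTensor_smul])
    (fun φ m n => by simp [mul_add])
    (fun c φ m => by simp)

end Model

/-! ## The quantum double and the structure maps -/

section Double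

universe u v

variable {G : Type u} [Ring G] [Algebra ℂ G] [FiniteDimensional ℂ G]
  {M : Type v} [Ring M] [Algebra ℂ M]

/-- The quantum double `D(G)`: the diagonal crossed product of `λ = ρ = Δ`,
`φ_λ = φ_ρ = φ_λρ = φ`. -/
abbrev QuantumDouble (H : QuasiHopfAlgebra G) : Type u :=
  DiagonalCrossedProduct H.toQuasiBialgebra.selfPair

variable (H : QuasiHopfAlgebra G)

/-- The canonical map `i_D : G → D(G)`. -/
def iD : G →ₐ[ℂ] QuantumDouble H := H.toQuasiBialgebra.selfPair.incl

/-- The universal flip operator `𝐃 ∈ G ⊗ D(G)`. -/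
def flipD : G ⊗[ℂ] QuantumDouble H := H.toQuasiBialgebra.selfPair.univ

/-- `φ_D = (i_D ⊗ i_D ⊗ i_D)(φ)`. -/
def φD : (QuantumDouble H ⊗[ℂ] (QuantumDouble H ⊗[ℂ] QuantumDouble H))ˣ :=
  Units.map (map₃ (iD H) (iD H) (iD H)) H.reassoc

/-- `ε_D` extends `ε` and `(id ⊗ ε_D)(𝐃) = 1`. -/
def IsCounitD (eps : QuantumDouble H →ₐ[ℂ] ℂ) : Prop :=
  (∀ a : G, eps (iD H a) = H.counit a) ∧ killRight eps (flipD H) = 1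

/-- `Δ_D` extends `Δ` and, in `G ⊗ D(G) ⊗ D(G)`,
`(id ⊗ Δ_D)(𝐃) = φ^{-1,231} 𝐃^{13} φ^{213} 𝐃^{12} φ⁻¹`, where the legs of `φ^{±1}` in `D(G)` are
embedded by `i_D`. -/
def IsComulD (Δ : QuantumDouble H →ₐ[ℂ] QuantumDouble H ⊗[ℂ] QuantumDouble H) : Prop :=
  (∀ a : G, Δ (iD H a) = Algebra.TensorProduct.map (iD H) (iD H) (H.comul a)) ∧
  onRight Δ (flipD H) =
    map₃ (AlgHom.id ℂ G) (iD H) (iD H) (perm231 H.reassoc⁻¹.val) * leg13 (flipD H) *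
      map₃ (AlgHom.id ℂ G) (iD H) (iD H) (perm213 H.reassoc.val) * leg12 (flipD H) *
      map₃ (AlgHom.id ℂ G) (iD H) (iD H) H.reassoc⁻¹.val

variable (P : QuasiCommutingPair H.toQuasiBialgebra M)

/-- The image `(i_D ⊗ id)(𝐃) ∈ D(G) ⊗ D(G)` of the universal flip operator. -/
def flipDD : QuantumDouble H ⊗[ℂ] QuantumDouble H :=
  Algebra.TensorProduct.map (iD H) (AlgHom.id ℂ _) (flipD H)

/-- `λ_D : M₁ → D(G) ⊗ M₁` extends `λ` and, in `G ⊗ D(G) ⊗ M₁`,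
`(id ⊗ λ_D)(𝚪) = φ_λρ^{-1,231} 𝚪^{13} φ_λ^{213} 𝐃^{12} φ_λ⁻¹`. -/
def IsLamD (l : DiagonalCrossedProduct P →ₐ[ℂ] QuantumDouble H ⊗[ℂ] DiagonalCrossedProduct P) :
    Prop :=
  (∀ m : M, l (P.incl m) = Algebra.TensorProduct.map (iD H) P.incl (P.lam m)) ∧
  onRight l P.univ =
    map₃ (AlgHom.id ℂ G) (iD H) P.incl (perm231 P.φlr⁻¹.val) * leg13 P.univ *
      map₃ (AlgHom.id ℂ G) (iD H) P.incl (perm213 P.φl.val) * leg12 (flipD H) *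
      map₃ (AlgHom.id ℂ G) (iD H) P.incl P.φl⁻¹.val

/-- `ρ_D : M₁ → M₁ ⊗ D(G)` extends `ρ` and, in `G ⊗ M₁ ⊗ D(G)`,
`(id ⊗ ρ_D)(𝚪) = φ_ρ^{-1,231} 𝐃^{13} φ_ρ^{213} 𝚪^{12} φ_λρ⁻¹`. -/
def IsRhoD (r : DiagonalCrossedProduct P →ₐ[ℂ] DiagonalCrossedProduct P ⊗[ℂ] QuantumDouble H) :
    Prop :=
  (∀ m : M, r (P.incl m) = Algebra.TensorProduct.map P.incl (iD H) (P.rho m)) ∧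
  onRight r P.univ =
    map₃ (AlgHom.id ℂ G) P.incl (iD H) (perm231 P.φr⁻¹.val) * leg13 (flipD H) *
      map₃ (AlgHom.id ℂ G) P.incl (iD H) (perm213 P.φr.val) * leg12 P.univ *
      map₃ (AlgHom.id ℂ G) P.incl (iD H) P.φlr⁻¹.val

end Double

end QuasiHopf

end

/-! The guiding picture is categorical. A quasi-commuting pair makes the modules over `M` a bimodule
category over the modules of `G`. A normal coherent intertwiner in an algebra `A` over `M` is a
half-braiding, and the coherence relation is its hexagon. Thus `M₁` classifies half-braided objects,
and `D(G)` does so for the regular bimodule category. The prescribed values of `λ_D`, `ρ_D` and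
`Δ_D` on the universal intertwiners are the half-braidings of tensor products of half-braided
objects.

Existence of the structure maps therefore reduces to one fact: the composite of two coherent
intertwiners is coherent (`lamT_coherent`, `rhoT_coherent`). This is the word identity
`composite_coherence`, obtained from six pentagons, one for each shuffle of two pairs of strands,
and from naturality of the reassociators. The universal property turns the composites into algebra
maps, and `dcp_hom_ext` gives uniqueness. Quasi-coassociativity says that triple composites are
associative up to a reassociator; by `dcp_conj_ext` it needs checking only on generators, where it
is `composite_assoc`: four pentagons, one for each position of a strand among three others. The
remaining pentagons hold at once, because every leg of `φ_D` and its relatives comes from `G` or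
`M`, where the new maps extend the old ones.

The bijectivity of `μ_L` is the other half. The elements `q_ρ` and `p_ρ` are mutually inverse in the
sense that `c ↦ q_ρ c` is a bijection from intertwiners `c` onto solutions `L` of a twisted bimodule
equation, with inverse built from `p_ρ`. Surjectivity: the coherence relation rewrites `Γ · (q_ρ Γ)`
through `(Δ ⊗ id)(Γ)` and multiplications by `G` and `M`, so the range of `μ_L` is a left ideal
containing `1`. Injectivity: a representation of `M₁` on `Ĝ ⊗ M` is constructed in which some vector
is sent by `μ_L(t)` to `t`. Its intertwiner `T` acts as left multiplication by `Γ` has to act. The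
maps `m ↦ φ ⊗ m` give `L`, and `L` gives `c`, which plays the role of `Γ` restricted to `M`. The
coherence relation, with `c` in place of the right-hand `Γ`, then prescribes `T L`. Since the
vectors `φ ⊗ m` span, `T` is determined, and each relation for `T` can be tested after
multiplication by `L`. Injectivity of `i_{M₁}` follows by applying `μ_L` to `ε ⊗ m`.

All computations take place in an arbitrary algebra receiving commuting maps, called legs, from the
tensor factors (`tp`). Permutations, coproducts and counits of tensor factors become substitutions
of legs. Legs in algebras of operators also encode multiplication twisted by the antipode. -/

open scoped TensorProduct

noncomputable section

namespace QuasiHopf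

/-! ## Generalized legs -/

section GeneralizedLegs

variable {R R' A B C E A' B' : Type*} [Ring R] [Algebra ℂ R] [Ring R'] [Algebra ℂ R']
  [Ring A] [Algebra ℂ A] [Ring B] [Algebra ℂ B] [Ring C] [Algebra ℂ C] [Ring E] [Algebra ℂ E]
  [Ring A'] [Algebra ℂ A'] [Ring B'] [Algebra ℂ B']

/-- Two algebra maps into the same algebra have commuting images. -/
class Comm (f : A →ₐ[ℂ] R) (g : B →ₐ[ℂ] R) : Prop where
  commute : ∀ a b, Commute (f a) (g b)

instance (priority := 50) Comm.symm (f : A →ₐ[ℂ] R) (g : B →ₐ[ℂ] R) [Comm f g] : Comm g f :=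
  ⟨fun a b => (Comm.commute b a).symm⟩

/-- The map `x ⊗ y ↦ f(x) g(y)` for algebra maps with commuting images. -/
def tp (f : A →ₐ[ℂ] R) (g : B →ₐ[ℂ] R) [Comm f g] : A ⊗[ℂ] B →ₐ[ℂ] R :=
  Algebra.TensorProduct.lift f g Comm.commute

@[simp] lemma tp_tmul (f : A →ₐ[ℂ] R) (g : B →ₐ[ℂ] R) [Comm f g] (a : A) (b : B) :
    tp f g (a ⊗ₜ[ℂ] b) = f a * g b := by simp [tp]

/-- An element commuting with the images of `f` and `g` commutes with the image of `tp f g`. -/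
lemma commute_tp {f : A →ₐ[ℂ] R} {g : B →ₐ[ℂ] R} [Comm f g] {x : R}
    (hf : ∀ a, Commute x (f a)) (hg : ∀ b, Commute x (g b)) (t : A ⊗[ℂ] B) :
    Commute x (tp f g t) := by
  induction t with
  | zero => simp
  | tmul a b => simpa using (hf a).mul_right (hg b)
  | add t s ht hs => simpa using ht.add_right hs

/-- Together with the following instances, this lets commutation of nested legs be inferred from
commutation of the basic ones. -/
instance Comm.tp_right (f : A →ₐ[ℂ] R) (g : B →ₐ[ℂ] R) (k : C →ₐ[ℂ] R) [Comm g k] [Comm f g]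
    [Comm f k] : Comm f (tp g k) :=
  ⟨fun _ => commute_tp (fun _ => Comm.commute _ _) (fun _ => Comm.commute _ _)⟩

instance Comm.tp_left (f : A →ₐ[ℂ] R) (g : B →ₐ[ℂ] R) (k : C →ₐ[ℂ] R) [Comm f g] [Comm f k]
    [Comm g k] : Comm (tp f g) k :=
  ⟨fun t b => (commute_tp (fun a => (Comm.commute a b).symm)
    (fun a => (Comm.commute a b).symm) t).symm⟩

instance Comm.comp_right (f : A →ₐ[ℂ] R) (g : B →ₐ[ℂ] R) (u : C →ₐ[ℂ] B) [Comm f g] :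
    Comm f (g.comp u) := ⟨fun a b => Comm.commute a (u b)⟩

instance Comm.comp_left (f : A →ₐ[ℂ] R) (g : B →ₐ[ℂ] R) (u : C →ₐ[ℂ] A) [Comm f g] :
    Comm (f.comp u) g := ⟨fun a b => Comm.commute (u a) b⟩

instance Comm.push (f : A →ₐ[ℂ] R) (g : B →ₐ[ℂ] R) (k : R →ₐ[ℂ] R') [Comm f g] :
    Comm (k.comp f) (k.comp g) := ⟨fun a b => (Comm.commute a b).map k⟩

instance Comm.incl : Comm (Algebra.TensorProduct.includeLeft : A →ₐ[ℂ] A ⊗[ℂ] B)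
    (Algebra.TensorProduct.includeRight : B →ₐ[ℂ] A ⊗[ℂ] B) :=
  ⟨fun a b => by simp [Commute, SemiconjBy]⟩

instance Comm.incl' : Comm (Algebra.TensorProduct.includeRight : B →ₐ[ℂ] A ⊗[ℂ] B)
    (Algebra.TensorProduct.includeLeft : A →ₐ[ℂ] A ⊗[ℂ] B) := Comm.symm _ _

/-- The leg of a character: it commutes with everything. -/
def triv (e : A →ₐ[ℂ] ℂ) : A →ₐ[ℂ] R := (Algebra.ofId ℂ R).comp e

instance Comm.triv_left (e : A →ₐ[ℂ] ℂ) (f : B →ₐ[ℂ] R) : Comm (triv e) f :=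
  ⟨fun a _ => Algebra.commutes (e a) _⟩

instance Comm.triv_right (e : A →ₐ[ℂ] ℂ) (f : B →ₐ[ℂ] R) : Comm f (triv e) := Comm.symm _ _

/-- Agreement of algebra maps out of a tensor product. -/
lemma tp_ext {f g : A ⊗[ℂ] B →ₐ[ℂ] C} (h : ∀ a b, f (a ⊗ₜ[ℂ] b) = g (a ⊗ₜ[ℂ] b)) : f = g :=
  AlgHom.ext (congr_tmul h)

lemma tp_include : tp (Algebra.TensorProduct.includeLeft : A →ₐ[ℂ] A ⊗[ℂ] B)
    Algebra.TensorProduct.includeRight = AlgHom.id ℂ _ := tp_ext fun a b => by simp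

lemma tp_std (x : A ⊗[ℂ] B) : tp (Algebra.TensorProduct.includeLeft : A →ₐ[ℂ] A ⊗[ℂ] B)
    Algebra.TensorProduct.includeRight x = x := by rw [tp_include]; rfl

/-- The first leg of a threefold tensor product. -/
abbrev leg₁ : A →ₐ[ℂ] A ⊗[ℂ] (B ⊗[ℂ] C) := Algebra.TensorProduct.includeLeft

/-- The second leg of a threefold tensor product. -/
abbrev leg₂ : B →ₐ[ℂ] A ⊗[ℂ] (B ⊗[ℂ] C) :=
  Algebra.TensorProduct.includeRight.comp Algebra.TensorProduct.includeLeft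

/-- The third leg of a threefold tensor product. -/
abbrev leg₃ : C →ₐ[ℂ] A ⊗[ℂ] (B ⊗[ℂ] C) :=
  Algebra.TensorProduct.includeRight.comp Algebra.TensorProduct.includeRight

lemma comp_tp (k : R →ₐ[ℂ] R') (f : A →ₐ[ℂ] R) (g : B →ₐ[ℂ] R) [Comm f g] :
    k.comp (tp f g) = tp (k.comp f) (k.comp g) := tp_ext fun a b => by simp

lemma map_tp (k : R →ₐ[ℂ] R') (f : A →ₐ[ℂ] R) (g : B →ₐ[ℂ] R) [Comm f g] (x : A ⊗[ℂ] B) :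
    k (tp f g x) = tp (k.comp f) (k.comp g) x := DFunLike.congr_fun (comp_tp k f g) x

/-- The way back: an identity proved for arbitrary commuting legs gives the identity of tensors when
the standard legs are inserted. -/
lemma tp_std₃ (x : A ⊗[ℂ] (B ⊗[ℂ] C)) :
    tp leg₁ (tp leg₂ leg₃) x = x := by
  have : tp leg₂ leg₃ = (Algebra.TensorProduct.includeRight : B ⊗[ℂ] C →ₐ[ℂ] A ⊗[ℂ] (B ⊗[ℂ] C)) := by
    rw [← comp_tp, tp_include]; rfl
  simp only [this, tp_std]

lemma tp_std₄ (x : A ⊗[ℂ] (B ⊗[ℂ] (C ⊗[ℂ] E))) :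
    tp leg₁ (tp leg₂ (tp (leg₃.comp Algebra.TensorProduct.includeLeft)
      (leg₃.comp Algebra.TensorProduct.includeRight))) x = x := by
  have : tp (leg₃.comp Algebra.TensorProduct.includeLeft)
      (leg₃.comp Algebra.TensorProduct.includeRight) =
      (leg₃ : C ⊗[ℂ] E →ₐ[ℂ] A ⊗[ℂ] (B ⊗[ℂ] (C ⊗[ℂ] E))) := by
    rw [← comp_tp, tp_include]; rfl
  simp only [this, tp_std₃]

lemma tp_map (f : A →ₐ[ℂ] R) (g : B →ₐ[ℂ] R) [Comm f g] (u : A' →ₐ[ℂ] A) (v : B' →ₐ[ℂ] B) :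
    (tp f g).comp (Algebra.TensorProduct.map u v) = tp (f.comp u) (g.comp v) :=
  tp_ext fun a b => by simp

/-- First of a table of translations. An operation on tensors, such as applying a coproduct or
inserting a unit, becomes a change of the legs while the tensor stays the same. -/
lemma tp_comp_onRight (f : A →ₐ[ℂ] R) (g : C →ₐ[ℂ] R) [Comm f g] (u : B →ₐ[ℂ] C) :
    (tp f g).comp (onRight u) = tp f (g.comp u) :=
  tp_ext fun a b => by simp [onRight_tmul]

lemma tp_onRight (f : A →ₐ[ℂ] R) (g : C →ₐ[ℂ] R) [Comm f g] (u : B →ₐ[ℂ] C) (x : A ⊗[ℂ] B) :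
    tp f g (onRight u x) = tp f (g.comp u) x := DFunLike.congr_fun (tp_comp_onRight f g u) x

lemma tp_assoc (f : B →ₐ[ℂ] R) (g : C →ₐ[ℂ] R) (k : E →ₐ[ℂ] R) [Comm g k] [Comm f g] [Comm f k]
    (t : B ⊗[ℂ] C) (e : E) :
    tp f (tp g k) (Algebra.TensorProduct.assoc ℂ ℂ ℂ B C E (t ⊗ₜ[ℂ] e)) = tp f g t * k e := by
  induction t with
  | zero => simp
  | tmul a b => simp [mul_assoc]
  | add t s ht hs => simp only [TensorProduct.add_tmul, map_add, ht, hs, add_mul]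

lemma tp_comp_onLeft (f : B →ₐ[ℂ] R) (g : C →ₐ[ℂ] R) (k : E →ₐ[ℂ] R) [Comm g k] [Comm f g]
    [Comm f k] (u : A →ₐ[ℂ] B ⊗[ℂ] C) :
    (tp f (tp g k)).comp (onLeft u) = tp ((tp f g).comp u) k :=
  tp_ext fun a b => by simp [onLeft_tmul, tp_assoc]

lemma tp_onLeft (f : B →ₐ[ℂ] R) (g : C →ₐ[ℂ] R) (k : E →ₐ[ℂ] R) [Comm g k] [Comm f g]
    [Comm f k] (u : A →ₐ[ℂ] B ⊗[ℂ] C) (x : A ⊗[ℂ] E) :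
    tp f (tp g k) (onLeft u x) = tp ((tp f g).comp u) k x :=
  DFunLike.congr_fun (tp_comp_onLeft f g k u) x

lemma tp_oneTmul (f : A →ₐ[ℂ] R) (g : B →ₐ[ℂ] R) [Comm f g] (x : B) :
    tp f g (oneTmul x) = g x := by simp [oneTmul]

lemma tp_comp_includeLeft (f : A →ₐ[ℂ] R) (g : B →ₐ[ℂ] R) [Comm f g] :
    (tp f g).comp Algebra.TensorProduct.includeLeft = f := AlgHom.ext fun b => by simp

lemma tp_comp_includeRight (f : A →ₐ[ℂ] R) (g : B →ₐ[ℂ] R) [Comm f g] :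
    (tp f g).comp Algebra.TensorProduct.includeRight = g := AlgHom.ext fun b => by simp

lemma tp_comp_leg12 (f : A →ₐ[ℂ] R) (g : B →ₐ[ℂ] R) (k : C →ₐ[ℂ] R) [Comm g k] [Comm f g]
    [Comm f k] : (tp f (tp g k)).comp leg12 = tp f g :=
  tp_ext fun a b => by simp [leg12, onRight_tmul]

lemma tp_leg12 (f : A →ₐ[ℂ] R) (g : B →ₐ[ℂ] R) (k : C →ₐ[ℂ] R) [Comm g k] [Comm f g]
    [Comm f k] (x : A ⊗[ℂ] B) : tp f (tp g k) (leg12 x) = tp f g x :=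
  DFunLike.congr_fun (tp_comp_leg12 f g k) x

lemma tp_leg13 (f : A →ₐ[ℂ] R) (g : B →ₐ[ℂ] R) (k : C →ₐ[ℂ] R) [Comm g k] [Comm f g]
    [Comm f k] (x : A ⊗[ℂ] C) : tp f (tp g k) (leg13 x) = tp f k x := by
  refine congr_tmul (f := (tp f (tp g k)).comp leg13) (fun a b => ?_) x
  simp [leg13, onRight_tmul]

lemma tp_tmulOne (f : A →ₐ[ℂ] R) (g : B →ₐ[ℂ] R) (k : C →ₐ[ℂ] R) (l : E →ₐ[ℂ] R)
    [Comm k l] [Comm g k] [Comm g l] [Comm f g] [Comm f k] [Comm f l] (x : A ⊗[ℂ] (B ⊗[ℂ] C)) :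
    tp f (tp g (tp k l)) (tmulOne x) = tp f (tp g k) x := by
  refine congr_tmul (f := (tp f (tp g (tp k l))).comp tmulOne) (fun a b => ?_) x
  simp [tmulOne, onRight_tmul, tp_leg12]

lemma tp_comm (f : A →ₐ[ℂ] R) (g : B →ₐ[ℂ] R) [Comm f g] (x : A ⊗[ℂ] B) :
    tp g f (Algebra.TensorProduct.comm ℂ A B x) = tp f g x := by
  refine congr_tmul (f := (tp g f).comp (Algebra.TensorProduct.comm ℂ A B).toAlgHom)
    (fun a b => ?_) x
  simpa using (Comm.commute a b).eq.symm

/-- Commuting legs may be listed in any order, so superscripts such as 213 or 231 disappear after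
translation. -/
lemma tp_perm213 (f : A →ₐ[ℂ] R) (g : B →ₐ[ℂ] R) (k : C →ₐ[ℂ] R) [Comm f k] [Comm g f] [Comm g k]
    [Comm f g] (x : A ⊗[ℂ] (B ⊗[ℂ] C)) :
    tp g (tp f k) (perm213 x) = tp f (tp g k) x := by
  induction x with
  | zero => simp
  | add t s ht hs => simp only [map_add, ht, hs]
  | tmul a x =>
    induction x with
    | zero => simp
    | add t s ht hs => simp only [TensorProduct.tmul_add, map_add, ht, hs]
    | tmul b c => simp [perm213, onLeft_tmul, ← mul_assoc, (Comm.commute (f := f) (g := g) a b).eq]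

lemma tp_perm132 (f : A →ₐ[ℂ] R) (g : B →ₐ[ℂ] R) (k : C →ₐ[ℂ] R) [Comm g k] [Comm k g] [Comm f g]
    [Comm f k] (x : A ⊗[ℂ] (B ⊗[ℂ] C)) :
    tp f (tp k g) (perm132 x) = tp f (tp g k) x := by
  refine congr_tmul (f := (tp f (tp k g)).comp perm132) (fun a b => ?_) x
  have := tp_comm g k b
  simp [perm132, onRight_tmul, this]

lemma tp_perm231 (f : A →ₐ[ℂ] R) (g : B →ₐ[ℂ] R) (k : C →ₐ[ℂ] R) [Comm f g] [Comm k f] [Comm k g]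
    [Comm g k] [Comm f k] (x : A ⊗[ℂ] (B ⊗[ℂ] C)) :
    tp k (tp f g) (perm231 x) = tp f (tp g k) x := by
  induction x with
  | zero => simp
  | add t s ht hs => simp only [map_add, ht, hs]
  | tmul a x =>
    induction x with
    | zero => simp
    | add t s ht hs => simp only [TensorProduct.tmul_add, map_add, ht, hs]
    | tmul b c =>
      have := (Comm.commute (f := tp f g) (g := k) (a ⊗ₜ b) c).eq
      rw [tp_tmul, mul_assoc] at this
      simp [perm231, this]

lemma tp_perm312 (f : A →ₐ[ℂ] R) (g : B →ₐ[ℂ] R) (k : C →ₐ[ℂ] R) [Comm k f] [Comm g k] [Comm g f]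
    [Comm f g] [Comm f k] (x : A ⊗[ℂ] (B ⊗[ℂ] C)) :
    tp g (tp k f) (perm312 x) = tp f (tp g k) x := by
  induction x with
  | zero => simp
  | add t s ht hs => simp only [map_add, ht, hs]
  | tmul a x =>
    induction x with
    | zero => simp
    | add t s ht hs => simp only [TensorProduct.tmul_add, map_add, ht, hs]
    | tmul b c =>
      have := (Comm.commute (f := f) (g := tp g k) a (b ⊗ₜ c)).eq
      rw [tp_tmul] at this
      simp [perm312, ← this, ← mul_assoc]

lemma tp_comp_map₃ {C' : Type*} [Ring C'] [Algebra ℂ C'] (f : A →ₐ[ℂ] R) (g : B →ₐ[ℂ] R)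
    (k : C →ₐ[ℂ] R) [Comm g k] [Comm f g] [Comm f k] (u : A' →ₐ[ℂ] A) (v : B' →ₐ[ℂ] B)
    (w : C' →ₐ[ℂ] C) :
    (tp f (tp g k)).comp (map₃ u v w) = tp (f.comp u) (tp (g.comp v) (k.comp w)) := by
  refine tp_ext fun a x => ?_
  have := DFunLike.congr_fun (tp_map g k v w) x
  simp only [AlgHom.comp_apply] at this
  simp [map₃, this]

lemma tp_map₃ {C' : Type*} [Ring C'] [Algebra ℂ C'] (f : A →ₐ[ℂ] R) (g : B →ₐ[ℂ] R)
    (k : C →ₐ[ℂ] R) [Comm g k] [Comm f g] [Comm f k] (u : A' →ₐ[ℂ] A) (v : B' →ₐ[ℂ] B)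
    (w : C' →ₐ[ℂ] C) (x : A' ⊗[ℂ] (B' ⊗[ℂ] C')) :
    tp f (tp g k) (map₃ u v w x) = tp (f.comp u) (tp (g.comp v) (k.comp w)) x :=
  DFunLike.congr_fun (tp_comp_map₃ f g k u v w) x

/-- Applying a counit amounts to substituting a scalar leg. All normalization statements are thereby
instances of general leg identities. -/
lemma tp_triv_left (e : A →ₐ[ℂ] ℂ) (g : B →ₐ[ℂ] R) (x : A ⊗[ℂ] B) :
    tp (triv e) g x = g (killLeft e x) := by
  refine congr_tmul (g := g.comp (killLeft e)) (fun a b => ?_) x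
  simp [triv, killLeft_tmul, Algebra.ofId_apply, Algebra.smul_def]

lemma tp_triv_right (e : B →ₐ[ℂ] ℂ) (f : A →ₐ[ℂ] R) (x : A ⊗[ℂ] B) :
    tp f (triv e) x = f (killRight e x) := by
  refine congr_tmul (g := f.comp (killRight e)) (fun a b => ?_) x
  simp [triv, killRight_tmul, Algebra.ofId_apply, Algebra.smul_def, Algebra.commutes]

lemma comp_triv (e : A →ₐ[ℂ] ℂ) (k : R →ₐ[ℂ] R') : k.comp (triv e) = triv e :=
  AlgHom.ext fun a => by simp [triv, Algebra.ofId_apply]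

lemma triv_comp (e : A →ₐ[ℂ] ℂ) (u : B →ₐ[ℂ] A) :
    (triv e : A →ₐ[ℂ] R).comp u = triv (e.comp u) := rfl

/-- An element intertwining `g` with `g'` and commuting with `f` intertwines
`f ⊗ g` with `f ⊗ g'`. -/
lemma slide_right {f : A →ₐ[ℂ] R} {g g' : B →ₐ[ℂ] R} [Comm f g] [Comm f g'] {x : R}
    (hf : ∀ a, Commute x (f a)) (hg : ∀ b, x * g b = g' b * x) (t : A ⊗[ℂ] B) :
    x * tp f g t = tp f g' t * x := by
  induction t with
  | zero => simp
  | tmul a b => rw [tp_tmul, tp_tmul, ← mul_assoc, (hf a).eq, mul_assoc, hg, mul_assoc]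
  | add t s ht hs => simp only [map_add, mul_add, add_mul, ht, hs]

lemma slide_left {f f' : A →ₐ[ℂ] R} {g : B →ₐ[ℂ] R} [Comm f g] [Comm f' g] {x : R}
    (hf : ∀ a, x * f a = f' a * x) (hg : ∀ b, Commute x (g b)) (t : A ⊗[ℂ] B) :
    x * tp f g t = tp f' g t * x := by
  induction t with
  | zero => simp
  | tmul a b => rw [tp_tmul, tp_tmul, ← mul_assoc, hf, mul_assoc, (hg b).eq, mul_assoc]
  | add t s ht hs => simp only [map_add, mul_add, add_mul, ht, hs]

lemma slide_mid {D : Type*} [Ring D] [Algebra ℂ D] {f : A →ₐ[ℂ] R} {g g' : B →ₐ[ℂ] R}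
    {k : D →ₐ[ℂ] R} [Comm g k] [Comm g' k] [Comm f g] [Comm f g'] [Comm f k] {x : R}
    (hf : ∀ a, Commute x (f a)) (hg : ∀ b, x * g b = g' b * x)
    (hk : ∀ b, Commute x (k b)) (t : A ⊗[ℂ] (B ⊗[ℂ] D)) :
    x * tp f (tp g k) t = tp f (tp g' k) t * x :=
  slide_right hf (slide_left hg hk) t

end GeneralizedLegs

/-! ### Coactions and the axioms of a quasi-commuting pair in terms of legs. -/

section Actions

variable {R G M : Type*} [Ring R] [Algebra ℂ R] [Ring G] [Algebra ℂ G] [Ring M] [Algebra ℂ M]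
  {Q : QuasiBialgebra G} (P : QuasiCommutingPair Q M)

/-- The leg `Δ` composed with the legs `j`, `j'`. -/
abbrev mu (Q : QuasiBialgebra G) (j j' : G →ₐ[ℂ] R) [Comm j j'] : G →ₐ[ℂ] R :=
  (tp j j').comp Q.comul

/-- The leg `λ` composed with the legs `j`, `k`. -/
abbrev la (j : G →ₐ[ℂ] R) (k : M →ₐ[ℂ] R) [Comm j k] : M →ₐ[ℂ] R := (tp j k).comp P.lam

/-- The leg `ρ` composed with the legs `k`, `j`. -/
abbrev ra (k : M →ₐ[ℂ] R) (j : G →ₐ[ℂ] R) [Comm k j] : M →ₐ[ℂ] R := (tp k j).comp P.rho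

/-- A unit of a triple tensor product with its legs placed in an algebra. -/
def t3 {A B C : Type*} [Ring A] [Algebra ℂ A] [Ring B] [Algebra ℂ B] [Ring C] [Algebra ℂ C]
    (f : A →ₐ[ℂ] R) (g : B →ₐ[ℂ] R) (k : C →ₐ[ℂ] R) [Comm g k] [Comm f g] [Comm f k]
    (x : (A ⊗[ℂ] (B ⊗[ℂ] C))ˣ) : Rˣ := Units.map (tp f (tp g k)) x

end Actions

section LegAxioms

variable {R G M : Type*} [Ring R] [Algebra ℂ R] [Ring G] [Algebra ℂ G] [Ring M] [Algebra ℂ M]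
  {Q : QuasiBialgebra G} (P : QuasiCommutingPair Q M)
  (j₁ j₂ j₃ : G →ₐ[ℂ] R) (k : M →ₐ[ℂ] R)

lemma t3_val {A B C : Type*} [Ring A] [Algebra ℂ A] [Ring B] [Algebra ℂ B] [Ring C] [Algebra ℂ C]
    (f : A →ₐ[ℂ] R) (g : B →ₐ[ℂ] R) (k : C →ₐ[ℂ] R) [Comm g k] [Comm f g] [Comm f k]
    (x : (A ⊗[ℂ] (B ⊗[ℂ] C))ˣ) : (t3 f g k x : R) = tp f (tp g k) x.val := rfl

lemma t3_inv_val {A B C : Type*} [Ring A] [Algebra ℂ A] [Ring B] [Algebra ℂ B] [Ring C]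
    [Algebra ℂ C] (f : A →ₐ[ℂ] R) (g : B →ₐ[ℂ] R) (k : C →ₐ[ℂ] R) [Comm g k] [Comm f g] [Comm f k]
    (x : (A ⊗[ℂ] (B ⊗[ℂ] C))ˣ) : ((t3 f g k x)⁻¹ : Rˣ) = tp f (tp g k) (x⁻¹).val := rfl

lemma lam_coassoc_legs [Comm j₁ j₂] [Comm j₁ k] [Comm j₂ k] (m : M) :
    la P j₁ (la P j₂ k) m * t3 j₁ j₂ k P.φl = t3 j₁ j₂ k P.φl * la P (mu Q j₁ j₂) k m := by
  have := congrArg (tp j₁ (tp j₂ k)) (P.lam_coassoc m)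
  simpa [tp_onRight, tp_onLeft, t3_val] using this

lemma rho_coassoc_legs [Comm j₁ j₂] [Comm k j₁] [Comm k j₂] (m : M) :
    (t3 k j₁ j₂ P.φr : R) * ra P (ra P k j₁) j₂ m =
      ra P k (mu Q j₁ j₂) m * (t3 k j₁ j₂ P.φr : R) := by
  have := congrArg (tp k (tp j₁ j₂)) (P.rho_coassoc m)
  simpa [tp_onRight, tp_onLeft, t3_val] using this

lemma quasi_comm_legs [Comm j₁ j₂] [Comm k j₂] [Comm j₁ k] (m : M) :
    (t3 j₁ k j₂ P.φlr : R) * ra P (la P j₁ k) j₂ m =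
      la P j₁ (ra P k j₂) m * (t3 j₁ k j₂ P.φlr : R) := by
  have := congrArg (tp j₁ (tp k j₂)) (P.quasi_comm m)
  simpa [tp_onRight, tp_onLeft, t3_val] using this

/-- The pentagons are stated in the group of units, so that any factor can be moved to the other
side. -/
lemma pentagon_legs (j₄ : G →ₐ[ℂ] R) [Comm j₁ j₂] [Comm j₁ j₃] [Comm j₁ j₄] [Comm j₂ j₃]
    [Comm j₂ j₄] [Comm j₃ j₄] :
    t3 j₂ j₃ j₄ Q.reassoc * t3 j₁ (mu Q j₂ j₃) j₄ Q.reassoc * t3 j₁ j₂ j₃ Q.reassoc =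
      t3 j₁ j₂ (mu Q j₃ j₄) Q.reassoc * t3 (mu Q j₁ j₂) j₃ j₄ Q.reassoc := by
  have := congrArg (tp j₁ (tp j₂ (tp j₃ j₄))) Q.pentagon
  refine Units.ext ?_
  simpa [tp_onRight, tp_onLeft, t3_val, tp_oneTmul, tp_tmulOne, tp_comp_onLeft,
    tp_comp_onRight] using this.symm

lemma lam_pentagon_legs [Comm j₁ j₂] [Comm j₁ j₃] [Comm j₁ k] [Comm j₂ j₃]
    [Comm j₂ k] [Comm j₃ k] :
    t3 j₂ j₃ k P.φl * t3 j₁ (mu Q j₂ j₃) k P.φl * t3 j₁ j₂ j₃ Q.reassoc =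
      t3 j₁ j₂ (la P j₃ k) P.φl * t3 (mu Q j₁ j₂) j₃ k P.φl := by
  have := congrArg (tp j₁ (tp j₂ (tp j₃ k))) P.lam_pentagon
  refine Units.ext ?_
  simpa [tp_onRight, tp_onLeft, t3_val, tp_oneTmul, tp_tmulOne, tp_comp_onLeft,
    tp_comp_onRight] using this

lemma rho_pentagon_legs [Comm j₁ j₂] [Comm j₁ j₃] [Comm k j₁] [Comm j₂ j₃]
    [Comm k j₂] [Comm k j₃] :
    t3 j₁ j₂ j₃ Q.reassoc * t3 k (mu Q j₁ j₂) j₃ P.φr * t3 k j₁ j₂ P.φr =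
      t3 k j₁ (mu Q j₂ j₃) P.φr * t3 (ra P k j₁) j₂ j₃ P.φr := by
  have := congrArg (tp k (tp j₁ (tp j₂ j₃))) P.rho_pentagon
  refine Units.ext ?_
  simpa [tp_onRight, tp_onLeft, t3_val, tp_oneTmul, tp_tmulOne, tp_comp_onLeft,
    tp_comp_onRight] using this

lemma mixed_pentagon_lam_legs [Comm j₁ j₂] [Comm j₁ j₃] [Comm j₁ k] [Comm j₂ j₃]
    [Comm j₂ k] [Comm k j₃] :
    t3 j₂ k j₃ P.φlr * t3 j₁ (la P j₂ k) j₃ P.φlr * t3 j₁ j₂ k P.φl =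
      t3 j₁ j₂ (ra P k j₃) P.φl * t3 (mu Q j₁ j₂) k j₃ P.φlr := by
  have := congrArg (tp j₁ (tp j₂ (tp k j₃))) P.mixed_pentagon_lam
  refine Units.ext ?_
  simpa [tp_onRight, tp_onLeft, t3_val, tp_oneTmul, tp_tmulOne, tp_comp_onLeft,
    tp_comp_onRight] using this

lemma mixed_pentagon_rho_legs [Comm j₁ j₂] [Comm j₁ j₃] [Comm j₁ k] [Comm j₂ j₃]
    [Comm k j₂] [Comm k j₃] :
    t3 k j₂ j₃ P.φr * t3 j₁ (ra P k j₂) j₃ P.φlr * t3 j₁ k j₂ P.φlr =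
      t3 j₁ k (mu Q j₂ j₃) P.φlr * t3 (la P j₁ k) j₂ j₃ P.φr := by
  have := congrArg (tp j₁ (tp k (tp j₂ j₃))) P.mixed_pentagon_rho
  refine Units.ext ?_
  simpa [tp_onRight, tp_onLeft, t3_val, tp_oneTmul, tp_tmulOne, tp_comp_onLeft,
    tp_comp_onRight] using this

section Counits

variable (j : G →ₐ[ℂ] R)

lemma mu_triv_left : mu Q (triv Q.counit) j = j :=
  AlgHom.ext fun a => by simp [tp_triv_left, Q.counit_left]

lemma mu_triv_right : mu Q j (triv Q.counit) = j :=
  AlgHom.ext fun a => by simp [tp_triv_right, Q.counit_right]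

lemma la_triv : la P (triv Q.counit) k = k :=
  AlgHom.ext fun a => by simp [tp_triv_left, P.lam_counit]

lemma ra_triv : ra P k (triv Q.counit) = k :=
  AlgHom.ext fun a => by simp [tp_triv_right, P.rho_counit]

lemma φl_triv_left [Comm j k] : t3 (triv Q.counit) j k P.φl = 1 :=
  Units.ext <| by rw [t3_val, tp_triv_left, P.φl_counit_left, map_one, Units.val_one]

lemma φl_triv_mid [Comm j k] : t3 j (triv Q.counit) k P.φl = 1 := Units.ext <| by
  have : (tp (triv Q.counit) k : G ⊗[ℂ] M →ₐ[ℂ] R) = k.comp (killLeft Q.counit) :=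
    AlgHom.ext fun x => tp_triv_left _ _ _
  have h : tp j (tp (triv Q.counit) k) P.φl.val = tp j k (onRight (killLeft Q.counit) P.φl.val) := by
    simp [tp_onRight, this]
  rw [t3_val, h, P.φl_counit_mid, map_one, Units.val_one]

lemma φr_triv_mid [Comm k j] : t3 k (triv Q.counit) j P.φr = 1 := Units.ext <| by
  have : (tp (triv Q.counit) j : G ⊗[ℂ] G →ₐ[ℂ] R) = j.comp (killLeft Q.counit) :=
    AlgHom.ext fun x => tp_triv_left _ _ _
  have h : tp k (tp (triv Q.counit) j) P.φr.val = tp k j (onRight (killLeft Q.counit) P.φr.val) := by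
    simp [tp_onRight, this]
  rw [t3_val, h, P.φr_counit_mid, map_one, Units.val_one]

lemma φr_triv_right [Comm k j] : t3 k j (triv Q.counit) P.φr = 1 := Units.ext <| by
  have : (tp j (triv Q.counit) : G ⊗[ℂ] G →ₐ[ℂ] R) = j.comp (killRight Q.counit) :=
    AlgHom.ext fun x => tp_triv_right _ _ _
  have h : tp k (tp j (triv Q.counit)) P.φr.val =
      tp k j (onRight (killRight Q.counit) P.φr.val) := by
    simp [tp_onRight, this]
  rw [t3_val, h, P.φr_counit_right, map_one, Units.val_one]

/-- Normalization of `φ_λρ` is not an axiom. Putting counits on the first two legs of a mixed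
pentagon makes this unit idempotent, hence equal to `1`. -/
lemma φlr_triv_left [Comm k j] : t3 (triv Q.counit) k j P.φlr = 1 := by
  have h := mixed_pentagon_lam_legs P (triv Q.counit) (triv Q.counit) j k
  simpa [la_triv, mu_triv_left, φl_triv_left] using h

lemma φlr_triv_right [Comm j k] : t3 j k (triv Q.counit) P.φlr = 1 := by
  have h := mixed_pentagon_rho_legs P j (triv Q.counit) (triv Q.counit) k
  simpa [ra_triv, mu_triv_left, φr_triv_right] using h

end Counits

end LegAxioms

/-! ### Elements of `G ⊗ X` as linear maps from the dual of `G`. -/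

section Slices

variable {G X Y : Type*} [Ring G] [Algebra ℂ G] [FiniteDimensional ℂ G]
  [AddCommGroup X] [Module ℂ X] [AddCommGroup Y] [Module ℂ Y]

omit [FiniteDimensional ℂ G] in
@[simp] lemma slice_tmul (φ : Module.Dual ℂ G) (g : G) (x : X) :
    slice φ (g ⊗ₜ[ℂ] x) = φ g • x := by simp [slice]

omit [FiniteDimensional ℂ G] in
@[simp] lemma slice_zero_left (t : G ⊗[ℂ] X) : slice (0 : Module.Dual ℂ G) t = 0 := by
  simp [slice]

lemma genElt_eq (f : Module.Dual ℂ G →ₗ[ℂ] X) :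
    genElt f = ∑ i, Module.Basis.ofVectorSpace ℂ G i ⊗ₜ[ℂ]
      f ((Module.Basis.ofVectorSpace ℂ G).coord i) := by
  simp [genElt, coevaluation_apply_one]

lemma slice_genElt (f : Module.Dual ℂ G →ₗ[ℂ] X) (φ : Module.Dual ℂ G) :
    slice φ (genElt f) = f φ := by
  rw [genElt_eq, map_sum]
  simp only [slice_tmul, ← map_smul, ← map_sum]
  congr 1
  refine (Module.Basis.ofVectorSpace ℂ G).ext fun i => ?_
  simp [-Module.Basis.coe_ofVectorSpace]

/-- The linear map `φ ↦ (φ ⊗ id)(t)`. -/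
def sliceMap (t : G ⊗[ℂ] X) : Module.Dual ℂ G →ₗ[ℂ] X where
  toFun φ := slice φ t
  map_add' φ ψ := by simp [slice, LinearMap.rTensor_add]
  map_smul' c φ := by simp [slice, LinearMap.rTensor_smul]

omit [FiniteDimensional ℂ G] in
@[simp] lemma sliceMap_apply (t : G ⊗[ℂ] X) (φ : Module.Dual ℂ G) :
    sliceMap t φ = slice φ t := rfl

lemma genElt_sliceMap (t : G ⊗[ℂ] X) : genElt (sliceMap t) = t := by
  rw [genElt_eq]
  induction t with
  | zero => simp
  | tmul g x =>
    simp only [sliceMap_apply, slice_tmul, ← TensorProduct.smul_tmul, ← TensorProduct.sum_tmul]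
    congr 1
    simpa using (Module.Basis.ofVectorSpace ℂ G).sum_repr g
  | add t s ht hs =>
    simp only [sliceMap_apply, map_add, TensorProduct.tmul_add, Finset.sum_add_distrib] at *
    rw [ht, hs]

/-- As `G` is finite dimensional, a tensor is rebuilt from its slices. This converts the
componentwise defining relations into identities of tensors. -/
lemma slice_ext {t s : G ⊗[ℂ] X} (h : ∀ φ, slice φ t = slice φ s) : t = s := by
  rw [← genElt_sliceMap t, ← genElt_sliceMap s]
  exact congrArg genElt (LinearMap.ext h)

omit [FiniteDimensional ℂ G] in
lemma map_slice (f : X →ₗ[ℂ] Y) (φ : Module.Dual ℂ G) (t : G ⊗[ℂ] X) :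
    f (slice φ t) = slice φ (LinearMap.lTensor G f t) := by
  induction t with
  | zero => simp
  | tmul g x => simp
  | add t s ht hs => simp only [map_add, ht, hs]

lemma lTensor_genElt (f : X →ₗ[ℂ] Y) (g : Module.Dual ℂ G →ₗ[ℂ] X) :
    LinearMap.lTensor G f (genElt g) = genElt (f ∘ₗ g) := by
  simp [genElt_eq]

end Slices

/-! ### Coherent intertwiners with values in an algebra. -/

section Coherent

universe u v w

variable {G : Type u} [Ring G] [Algebra ℂ G] {Q : QuasiBialgebra G}
  {M : Type v} [Ring M] [Algebra ℂ M] (P : QuasiCommutingPair Q M)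
  {A : Type w} [Ring A] [Algebra ℂ A]

/-- Normal coherent `λρ`-intertwiners. -/
structure IsCoherent (i : M →ₐ[ℂ] A) (T : G ⊗[ℂ] A) : Prop where
  normal : killLeft Q.counit T = 1
  intertwine : ∀ m, T * onRight i (P.lam m) =
    onRight i (Algebra.TensorProduct.comm ℂ M G (P.rho m)) * T
  coherent : map₃ (AlgHom.id ℂ G) (AlgHom.id ℂ G) i (perm312 P.φr.val) * leg13 T *
      map₃ (AlgHom.id ℂ G) (AlgHom.id ℂ G) i (perm132 P.φlr⁻¹.val) * oneTmul T *
      map₃ (AlgHom.id ℂ G) (AlgHom.id ℂ G) i P.φl.val = onLeft Q.comul T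

variable {P} {R : Type*} [Ring R] [Algebra ℂ R] {i : M →ₐ[ℂ] A} {T : G ⊗[ℂ] A}
  (hT : IsCoherent P i T) (j j' : G →ₐ[ℂ] R) (h : A →ₐ[ℂ] R)

include hT

lemma IsCoherent.normal_legs : tp (triv Q.counit) h T = 1 := by
  rw [tp_triv_left, hT.normal, map_one]

lemma IsCoherent.intertwine_legs [Comm j h] (m : M) :
    tp j h T * la P j (h.comp i) m = ra P (h.comp i) j m * tp j h T := by
  have := congrArg (tp j h) (hT.intertwine m)
  simpa [tp_onRight, tp_comm] using this

lemma IsCoherent.coherent_legs [Comm j j'] [Comm j h] [Comm j' h] :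
    tp (mu Q j j') h T = t3 (h.comp i) j j' P.φr * tp j h T *
      ((t3 j (h.comp i) j' P.φlr)⁻¹ : Rˣ) * tp j' h T * t3 j j' (h.comp i) P.φl := by
  have := congrArg (tp j (tp j' h)) hT.coherent
  simpa [tp_onRight, tp_onLeft, tp_map₃, tp_oneTmul, tp_leg13, t3_val, t3_inv_val,
    tp_perm312, tp_perm132] using this.symm

omit hT

/-- Criterion in terms of the standard legs. -/
lemma IsCoherent.of_legs (normal : killLeft Q.counit T = 1)
    (intertwine : ∀ (j : G →ₐ[ℂ] G ⊗[ℂ] A) (h : A →ₐ[ℂ] G ⊗[ℂ] A) [Comm j h] (m : M),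
      tp j h T * la P j (h.comp i) m = ra P (h.comp i) j m * tp j h T)
    (coherent : ∀ (j j' : G →ₐ[ℂ] G ⊗[ℂ] (G ⊗[ℂ] A)) (h : A →ₐ[ℂ] G ⊗[ℂ] (G ⊗[ℂ] A))
      [Comm j j'] [Comm j h] [Comm j' h],
      tp (mu Q j j') h T = t3 (h.comp i) j j' P.φr * tp j h T *
        ((t3 j (h.comp i) j' P.φlr)⁻¹ : (G ⊗[ℂ] (G ⊗[ℂ] A))ˣ) * tp j' h T *
        t3 j j' (h.comp i) P.φl) : IsCoherent P i T where
  normal := normal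
  intertwine m := by
    rw [← tp_std (T * _), ← tp_std (_ * T)]
    simpa [tp_onRight, tp_comm] using intertwine Algebra.TensorProduct.includeLeft
      Algebra.TensorProduct.includeRight m
  coherent := by
    rw [← tp_std₃ (onLeft Q.comul T), ← tp_std₃ (_ * _)]
    simpa [tp_onRight, tp_onLeft, tp_map₃, tp_oneTmul, tp_leg13, t3_val, t3_inv_val,
      tp_perm312, tp_perm132] using (coherent leg₁ leg₂ leg₃).symm

end Coherent

/-! ### The universal property of the diagonal crossed product. -/

section UniversalProperty

universe u v w

variable {G : Type u} [Ring G] [Algebra ℂ G] [FiniteDimensional ℂ G] {Q : QuasiBialgebra G}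
  {M : Type v} [Ring M] [Algebra ℂ M] (P : QuasiCommutingPair Q M)
  {A : Type w} [Ring A] [Algebra ℂ A]

lemma onRight_eq_lTensor {A B C : Type*} [Ring A] [Algebra ℂ A] [Ring B] [Algebra ℂ B] [Ring C]
    [Algebra ℂ C] (f : B →ₐ[ℂ] C) (x : A ⊗[ℂ] B) :
    onRight f x = LinearMap.lTensor A f.toLinearMap x := rfl

omit [FiniteDimensional ℂ G] in
lemma onRight_push₁ {X : Type*} [Ring X] [Algebra ℂ X] (f : X →ₐ[ℂ] A) (g : M →ₗ[ℂ] X)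
    (i : M →ₐ[ℂ] A) (h : ∀ m, f (g m) = i m) (t : G ⊗[ℂ] M) :
    onRight f (push₁ g t) = onRight i t := by
  induction t with
  | zero => simp
  | tmul a b => simp [push₁, onRight_tmul, h]
  | add t s ht hs => simp only [map_add, ht, hs]

omit [FiniteDimensional ℂ G] in
lemma onRight_push₂ {X : Type*} [Ring X] [Algebra ℂ X] (f : X →ₐ[ℂ] A) (g : M →ₗ[ℂ] X)
    (i : M →ₐ[ℂ] A) (h : ∀ m, f (g m) = i m) (t : G ⊗[ℂ] (G ⊗[ℂ] M)) :
    onRight (onRight f) (push₂ g t) = map₃ (AlgHom.id ℂ G) (AlgHom.id ℂ G) i t := by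
  induction t with
  | zero => simp
  | tmul a b =>
    have := onRight_push₁ f g i h b
    simp only [push₁, onRight] at this
    simp [push₂, onRight, map₃, this]
  | add t s ht hs => simp only [map_add, ht, hs]

omit [FiniteDimensional ℂ G] in
lemma map_slice_alg {X : Type*} [Ring X] [Algebra ℂ X] (f : X →ₐ[ℂ] A) (φ : Module.Dual ℂ G)
    (t : G ⊗[ℂ] X) : f (slice φ t) = slice φ (onRight f t) := map_slice f.toLinearMap φ t

lemma onRight_genElt {X : Type*} [Ring X] [Algebra ℂ X] (f : X →ₐ[ℂ] A)
    (g : Module.Dual ℂ G →ₗ[ℂ] X) : onRight f (genElt g) = genElt (f.toLinearMap ∘ₗ g) :=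
  lTensor_genElt f.toLinearMap g

lemma onRight_leg13 {A B C D : Type*} [Ring A] [Algebra ℂ A] [Ring B] [Algebra ℂ B] [Ring C]
    [Algebra ℂ C] [Ring D] [Algebra ℂ D] (f : C →ₐ[ℂ] D) (t : A ⊗[ℂ] C) :
    onRight (onRight f) (leg13 (B := B) t) = leg13 (onRight f t) := by
  induction t with
  | zero => simp
  | tmul a b => simp [leg13, onRight_tmul]
  | add t s ht hs => simp only [map_add, ht, hs]

lemma onRight_oneTmul {A B D : Type*} [Ring A] [Algebra ℂ A] [Ring B] [Algebra ℂ B]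
    [Ring D] [Algebra ℂ D] (f : B →ₐ[ℂ] D) (t : B) :
    onRight f (oneTmul (A := A) t) = oneTmul (f t) := by
  simp [oneTmul, onRight_tmul]

lemma onRight_onLeft {A B C D E : Type*} [Ring A] [Algebra ℂ A] [Ring B] [Algebra ℂ B] [Ring C]
    [Algebra ℂ C] [Ring D] [Algebra ℂ D] [Ring E] [Algebra ℂ E] (f : D →ₐ[ℂ] E)
    (u : A →ₐ[ℂ] B ⊗[ℂ] C) (t : A ⊗[ℂ] D) :
    onRight (onRight f) (onLeft u t) = onLeft u (onRight f t) := by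
  induction t with
  | zero => simp
  | tmul a b =>
    simp only [onRight_tmul, onLeft_tmul]
    generalize u a = s
    induction s with
    | zero => simp
    | tmul a b => simp [onRight_tmul]
    | add t s ht hs => simp only [TensorProduct.add_tmul, map_add, ht, hs]
  | add t s ht hs => simp only [map_add, ht, hs]

lemma proj_preIncl (m : M) : P.proj (preIncl G M m) = P.incl m := rfl

lemma onRight_proj_genElt : onRight P.proj (genElt (preΓ G M)) = P.univ :=
  onRight_genElt P.proj (preΓ G M)

lemma slice_univ (φ : Module.Dual ℂ G) : slice φ P.univ = P.Γ φ := slice_genElt _ _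

omit [FiniteDimensional ℂ G] in
lemma slice_eq_killLeft (e : G →ₐ[ℂ] ℂ) (t : G ⊗[ℂ] A) :
    slice e.toLinearMap t = killLeft e t := by
  induction t with
  | zero => simp
  | tmul a b => simp [killLeft_tmul]
  | add t s ht hs => simp only [map_add, ht, hs]

/-- The defining relations are the slices of the three conditions; slice extensionality reassembles
them. -/
lemma univ_coherent : IsCoherent P P.incl P.univ where
  normal := by
    rw [← slice_eq_killLeft, slice_univ]
    have := RingQuot.mkAlgHom_rel ℂ (Rel.normal (P := P))
    exact this.trans (map_one P.proj)
  intertwine m := slice_ext fun φ => by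
    have h : P.proj _ = P.proj _ := RingQuot.mkAlgHom_rel ℂ (Rel.intertwine (P := P) m φ)
    rw [map_slice_alg, map_slice_alg, map_mul (onRight P.proj), map_mul (onRight P.proj),
      onRight_proj_genElt,
      onRight_push₁ _ _ _ (proj_preIncl P), onRight_push₁ _ _ _ (proj_preIncl P)] at h
    exact h
  coherent := slice_ext fun φ => slice_ext fun ψ => by
    have h : P.proj _ = P.proj _ := RingQuot.mkAlgHom_rel ℂ (Rel.coherent (P := P) φ ψ)
    rw [map_slice_alg, map_slice_alg, map_slice_alg, map_slice_alg] at h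
    simpa only [map_mul, onRight_leg13, onRight_oneTmul, onRight_onLeft, onRight_proj_genElt,
      onRight_push₂ _ _ _ (proj_preIncl P)] using h

variable {P} in
/-- The algebra map out of the diagonal crossed product given by a coherent intertwiner. -/
def IsCoherent.lift {i : M →ₐ[ℂ] A} {T : G ⊗[ℂ] A} (hT : IsCoherent P i T) :
    DiagonalCrossedProduct P →ₐ[ℂ] A :=
  RingQuot.liftAlgHom ℂ ⟨TensorAlgebra.lift ℂ (LinearMap.coprod i.toLinearMap (sliceMap T)), by
    set f := TensorAlgebra.lift ℂ (LinearMap.coprod i.toLinearMap (sliceMap T))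
    have h1 : ∀ m, f (preIncl G M m) = i m := fun m => by simp [f, preIncl]
    have h2 : onRight f (genElt (preΓ G M)) = T := by
      rw [onRight_genElt]
      conv_rhs => rw [← genElt_sliceMap T]
      congr 1
      ext φ
      simp [f, preΓ]
    intro x y hxy
    induction hxy with
    | one => simp [h1]
    | mul m n => simp [h1]
    | normal =>
      rw [map_one, ← hT.normal, ← h2, ← slice_eq_killLeft, ← map_slice_alg, slice_genElt]
    | intertwine m φ =>
      rw [map_slice_alg, map_slice_alg, map_mul (onRight f), map_mul (onRight f), h2,
        onRight_push₁ _ _ _ h1,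
        onRight_push₁ _ _ _ h1, hT.intertwine]
    | coherent φ ψ =>
      rw [map_slice_alg, map_slice_alg, map_slice_alg, map_slice_alg]
      simp only [map_mul, onRight_leg13, onRight_oneTmul, onRight_onLeft, h2,
        onRight_push₂ _ _ _ h1, hT.coherent]⟩

section
variable {P} {i : M →ₐ[ℂ] A} {T : G ⊗[ℂ] A} (hT : IsCoherent P i T)

lemma IsCoherent.lift_proj (x : PreAlg G M) : hT.lift (P.proj x) =
    TensorAlgebra.lift ℂ (LinearMap.coprod i.toLinearMap (sliceMap T)) x := by
  simp only [IsCoherent.lift, QuasiCommutingPair.proj]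
  exact RingQuot.liftAlgHom_mkAlgHom_apply ℂ _ _ _

lemma IsCoherent.lift_incl (m : M) : hT.lift (P.incl m) = i m := by
  rw [← proj_preIncl, hT.lift_proj]
  simp [preIncl]

lemma IsCoherent.lift_comp_incl : hT.lift.comp P.incl = i := AlgHom.ext hT.lift_incl

lemma IsCoherent.lift_univ : onRight hT.lift P.univ = T := by
  rw [QuasiCommutingPair.univ, onRight_genElt]
  conv_rhs => rw [← genElt_sliceMap T]
  congr 1
  ext φ
  have := hT.lift_proj (preΓ G M φ)
  simpa [preΓ, QuasiCommutingPair.Γ] using this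

end

variable {P} in
/-- Algebra maps out of the diagonal crossed product are determined by their values on `M` and on
the universal intertwiner. -/
lemma dcp_hom_ext {f g : DiagonalCrossedProduct P →ₐ[ℂ] A} (h₁ : ∀ m, f (P.incl m) = g (P.incl m))
    (h₂ : onRight f P.univ = onRight g P.univ) : f = g := by
  apply RingQuot.ringQuot_ext'
  refine TensorAlgebra.hom_ext (LinearMap.ext fun x => ?_)
  have h3 : ∀ φ, f (P.Γ φ) = g (P.Γ φ) := fun φ => by
    rw [← slice_univ, map_slice_alg, h₂, ← map_slice_alg]
  have key : P.proj (TensorAlgebra.ι ℂ x) = P.incl x.1 + P.Γ x.2 := by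
    rw [← proj_preIncl]
    simp only [QuasiCommutingPair.Γ, preΓ, preIncl, LinearMap.comp_apply, AlgHom.toLinearMap_apply]
    rw [← map_add, ← map_add]
    simp
  have : f (P.proj (TensorAlgebra.ι ℂ x)) = g (P.proj (TensorAlgebra.ι ℂ x)) := by
    rw [key, map_add, map_add, h₁, h3]
  exact this

end UniversalProperty

/-! ### Word identities for composites of intertwiners. -/

section Monoid

variable {R : Type*} [Ring R]

/-- The coherence of a composite of two half-braidings, from six pentagons and the naturality of
the reassociators. -/
lemma composite_coherence {a₁ a₂ a₃ a₄ a₅ a₆ a₇ a₈ a₉ m₁ m₁' m₂ m₂' m m' r₁ r₁' r₂ r₂' r r'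
    l₁ l₁' l₂ l₂' l l' b₂ b₃ b₄ : Rˣ} {c₁ c₁' c₂ c₂' : R}
    (p₅ : a₄ * a₅ * a₆ = m₁ * m₂) (p₆ : a₃ * r₁ * m = m₁' * r₂) (p₇ : m' * l₂ * a₇ = l₁ * m₂')
    (p₈ : a₂ * r₁' * r = a₁ * b₂) (p₉ : r' * b₃ * l = l₁' * r₂') (p₁₀ : l' * l₂' * a₈ = b₄ * a₉)
    (n₁ : c₂' * m₁ = m₁' * c₂') (n₂ : c₁ * m₂' = m₂ * c₁) (n₃ : c₂' * c₁ = c₁ * c₂')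
    (n₄ : c₂' * l₁ = l₁' * c₂') (n₅ : c₁' * l₂' = l₂ * c₁') (n₆ : c₂ * r₁ = r₁' * c₂)
    (n₇ : c₁ * r₂' = r₂ * c₁) :
    (a₁⁻¹ : Rˣ) * (a₂ * c₂ * (a₃⁻¹ : Rˣ) * c₂' * a₄) * a₅ * (a₆ * c₁ * (a₇⁻¹ : Rˣ) * c₁' * a₈) *
        (a₉⁻¹ : Rˣ) =
      b₂ * ((r⁻¹ : Rˣ) * c₂ * m * c₁ * (l⁻¹ : Rˣ)) * (b₃⁻¹ : Rˣ) *
        ((r'⁻¹ : Rˣ) * c₂' * m' * c₁' * (l'⁻¹ : Rˣ)) * b₄ := by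
  -- Each `q` is a pentagon solved for the factors that meet in the word, and each `o` a naturality
  -- relation. The extra factor `t` lets them act inside a right-associated product.
  have q₅ : ∀ t : R, a₄ * (a₅ * (a₆ * t)) = m₁ * (m₂ * t) := fun t => by
    simp only [← mul_assoc, ← Units.val_mul, p₅]
  have q₆ : ∀ t : R, (a₃⁻¹ : Rˣ) * (m₁' * t) = r₁ * (m * ((r₂⁻¹ : Rˣ) * t)) := fun t => by
    have : a₃⁻¹ * m₁' = r₁ * m * r₂⁻¹ := by
      rw [eq_mul_inv_iff_mul_eq, mul_assoc, ← p₆]; group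
    simp only [← mul_assoc, ← Units.val_mul, this]
  have q₇ : ∀ t : R, m₂' * ((a₇⁻¹ : Rˣ) * t) = (l₁⁻¹ : Rˣ) * (m' * (l₂ * t)) := fun t => by
    have : m₂' * a₇⁻¹ = l₁⁻¹ * m' * l₂ := by
      rw [mul_inv_eq_iff_eq_mul, mul_assoc, mul_assoc, eq_inv_mul_iff_mul_eq, ← p₇, mul_assoc]
    simp only [← mul_assoc, ← Units.val_mul, this]
  have q₈ : ∀ t : R, (a₁⁻¹ : Rˣ) * (a₂ * (r₁' * t)) = b₂ * ((r⁻¹ : Rˣ) * t) := fun t => by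
    have : a₁⁻¹ * a₂ * r₁' = b₂ * r⁻¹ := by
      rw [eq_mul_inv_iff_mul_eq, mul_assoc, mul_assoc, ← mul_assoc a₂, p₈]; group
    simp only [← mul_assoc, ← Units.val_mul, this]
  have q₉ : ∀ t : R, (r₂'⁻¹ : Rˣ) * ((l₁'⁻¹ : Rˣ) * t) =
      (l⁻¹ : Rˣ) * ((b₃⁻¹ : Rˣ) * ((r'⁻¹ : Rˣ) * t)) := fun t => by
    have : r₂'⁻¹ * l₁'⁻¹ = l⁻¹ * b₃⁻¹ * r'⁻¹ := by
      rw [← mul_inv_rev, ← p₉]; group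
    simp only [← mul_assoc, ← Units.val_mul, this]
  have q₁₀ : (l₂' * (a₈ * (a₉⁻¹ : Rˣ)) : R) = (l'⁻¹ : Rˣ) * b₄ := by
    have : l₂' * a₈ * a₉⁻¹ = l'⁻¹ * b₄ := by
      rw [mul_inv_eq_iff_eq_mul, mul_assoc, ← p₁₀]; group
    simp only [← mul_assoc, ← Units.val_mul, this]
  have o₁ : ∀ t, c₂' * (m₁ * t) = m₁' * (c₂' * t) := fun t => by simp only [← mul_assoc, n₁]
  have o₂ : ∀ t, m₂ * (c₁ * t) = c₁ * (m₂' * t) := fun t => by simp only [← mul_assoc, n₂]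
  have o₃ : ∀ t, c₂' * (c₁ * t) = c₁ * (c₂' * t) := fun t => by simp only [← mul_assoc, n₃]
  have o₄ : ∀ t, c₂' * ((l₁⁻¹ : Rˣ) * t) = (l₁'⁻¹ : Rˣ) * (c₂' * t) := fun t => by
    rw [Units.eq_inv_mul_iff_mul_eq, ← mul_assoc, ← n₄, mul_assoc, Units.mul_inv_cancel_left]
  have o₅ : ∀ t, l₂ * (c₁' * t) = c₁' * (l₂' * t) := fun t => by simp only [← mul_assoc, n₅]
  have o₆ : ∀ t, c₂ * (r₁ * t) = r₁' * (c₂ * t) := fun t => by simp only [← mul_assoc, n₆]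
  have o₇ : ∀ t, (r₂⁻¹ : Rˣ) * (c₁ * t) = c₁ * ((r₂'⁻¹ : Rˣ) * t) := fun t => by
    rw [Units.inv_mul_eq_iff_eq_mul, ← mul_assoc, ← n₇, mul_assoc, Units.mul_inv_cancel_left]
  simp only [mul_assoc]
  -- The pentagon in the middle opens the word, `o₃` exchanges the two intertwiners on disjoint
  -- strands, and the other pentagons are used while moving outwards to both ends.
  rw [q₅, o₁, o₂, o₃, q₆, q₇, o₄, o₅, o₆, o₇, q₈, q₉, q₁₀]

/-- The representing element is moved through the five factors of the composite one at a time,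
changing its bracketing or the position of a strand at each. -/
lemma composite_intertwine {u₁ u₂ u₃ : Rˣ} {c d f₀ f₁ f₂ f₃ f₄ f₅ : R} (h₃ : f₀ * u₃ = u₃ * f₁)
    (hd : d * f₁ = f₂ * d) (h₂ : u₂ * f₂ = f₃ * u₂) (hc : c * f₃ = f₄ * c)
    (h₁ : u₁ * f₅ = f₄ * u₁) :
    (u₁⁻¹ : Rˣ) * c * u₂ * d * (u₃⁻¹ : Rˣ) * f₀ = f₅ * ((u₁⁻¹ : Rˣ) * c * u₂ * d * (u₃⁻¹ : Rˣ)) := by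
  have g₃ : (u₃⁻¹ : Rˣ) * f₀ = f₁ * (u₃⁻¹ : Rˣ) := by
    rw [Units.inv_mul_eq_iff_eq_mul, ← mul_assoc, ← h₃, Units.mul_inv_cancel_right]
  have gd : ∀ t, d * (f₁ * t) = f₂ * (d * t) := fun t => by simp only [← mul_assoc, hd]
  have g₂ : ∀ t, u₂ * (f₂ * t) = f₃ * (u₂ * t) := fun t => by simp only [← mul_assoc, h₂]
  have gc : ∀ t, c * (f₃ * t) = f₄ * (c * t) := fun t => by simp only [← mul_assoc, hc]
  have g₁ : ∀ t, (u₁⁻¹ : Rˣ) * (f₄ * t) = f₅ * ((u₁⁻¹ : Rˣ) * t) := fun t => by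
    rw [Units.inv_mul_eq_iff_eq_mul, ← mul_assoc, ← mul_assoc, h₁, mul_assoc f₄, Units.mul_inv,
      mul_one]
  simp only [mul_assoc]
  rw [g₃, gd, g₂, gc, g₁]

/-- The associativity of the composition of half-braidings. -/
lemma composite_assoc {a a₁ a₂ a₃ a₄ rxyv rxyv' rxy ryv mxyv mxyv' mxy myv lxyv lxyv' lxy lyv : Rˣ}
    {c₁ c₂ c₃ : R}
    {b : Rˣ} (p₁ : a * lxyv * lxy = lxyv' * a₁) (p₂ : lyv * a₂ * mxy = mxyv' * a₃)
    (p₃ : myv * a₄ * rxy = b * mxyv) {a₅ : Rˣ} (p₄ : ryv * rxyv' * a = a₅ * rxyv)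
    (n₁ : c₁ * a₁ = a₃ * c₁) (n₂ : c₂ * a₂ = a₄ * c₂) (n₃ : c₃ * b = a₅ * c₃) :
    (rxyv'⁻¹ : Rˣ) * ((ryv⁻¹ : Rˣ) * c₃ * myv * c₂ * (lyv⁻¹ : Rˣ)) * mxyv' * c₁ *
        (lxyv'⁻¹ : Rˣ) * a =
      a * ((rxyv⁻¹ : Rˣ) * c₃ * mxyv * ((rxy⁻¹ : Rˣ) * c₂ * mxy * c₁ * (lxy⁻¹ : Rˣ)) *
        (lxyv⁻¹ : Rˣ)) := by
  have q₁ : ((lxyv'⁻¹ : Rˣ) * a : R) = a₁ * ((lxy⁻¹ : Rˣ) * (lxyv⁻¹ : Rˣ)) := by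
    have : lxyv'⁻¹ * a = a₁ * (lxy⁻¹ * lxyv⁻¹) := by
      rw [← mul_inv_rev, eq_mul_inv_iff_mul_eq, mul_assoc, ← mul_assoc a, p₁]; group
    simp only [← Units.val_mul, this]
  have q₂ : ∀ t : R, (lyv⁻¹ : Rˣ) * (mxyv' * (a₃ * t)) = a₂ * (mxy * t) := fun t => by
    have : lyv⁻¹ * mxyv' * a₃ = a₂ * mxy := by
      rw [mul_assoc, ← p₂]; group
    simp only [← mul_assoc, ← Units.val_mul, this]
  have q₃ : ∀ t : R, myv * (a₄ * t) = b * (mxyv * ((rxy⁻¹ : Rˣ) * t)) := fun t => by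
    have : myv * a₄ = b * mxyv * rxy⁻¹ := by
      rw [← p₃]; group
    simp only [← mul_assoc, ← Units.val_mul, this]
  have q₄ : ∀ t : R, (rxyv'⁻¹ : Rˣ) * ((ryv⁻¹ : Rˣ) * (a₅ * t)) = a * ((rxyv⁻¹ : Rˣ) * t) :=
    fun t => by
    have : rxyv'⁻¹ * ryv⁻¹ * a₅ = a * rxyv⁻¹ := by
      rw [eq_mul_inv_iff_mul_eq, mul_assoc, mul_assoc, ← p₄]; group
    simp only [← mul_assoc, ← Units.val_mul, this]
  have o₁ : ∀ t, c₁ * (a₁ * t) = a₃ * (c₁ * t) := fun t => by simp only [← mul_assoc, n₁]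
  have o₂ : ∀ t, c₂ * (a₂ * t) = a₄ * (c₂ * t) := fun t => by simp only [← mul_assoc, n₂]
  have o₃ : ∀ t, c₃ * (b * t) = a₅ * (c₃ * t) := fun t => by simp only [← mul_assoc, n₃]
  simp only [mul_assoc]
  rw [q₁, o₁, q₂, o₂, q₃, o₃, q₄]

end Monoid

/-! ### Naturality of reassociators with respect to intertwiners. -/

section Naturality

variable {R A B C D E : Type*} [Ring R] [Algebra ℂ R]
  [Ring A] [Algebra ℂ A] [Ring B] [Algebra ℂ B] [Ring C] [Algebra ℂ C] [Ring D] [Algebra ℂ D]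
  [Ring E] [Algebra ℂ E] (c : D →ₐ[ℂ] R) (d : E →ₐ[ℂ] R) [Comm c d] (T : D ⊗[ℂ] E)
  (f : A →ₐ[ℂ] R) (g : B →ₐ[ℂ] R) (k : C →ₐ[ℂ] R) [Comm f g] [Comm f k] [Comm g k]
  (x : (A ⊗[ℂ] (B ⊗[ℂ] C))ˣ)

/-- An intertwiner exchanging `f` and `f'` passes a reassociator when it is disjoint from the other
two legs; `slide₂` and `slide₃` treat the other positions. -/
lemma slide₁ (f' : A →ₐ[ℂ] R) [Comm f' g] [Comm f' k] [Comm c g] [Comm d g] [Comm c k] [Comm d k]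
    (h : ∀ a, tp c d T * f a = f' a * tp c d T) :
    tp c d T * t3 f g k x = t3 f' g k x * tp c d T :=
  slide_left h (fun _ => Comm.commute (f := tp c d) (g := tp g k) _ _) _

lemma slide₂ (g' : B →ₐ[ℂ] R) [Comm f g'] [Comm g' k] [Comm c f] [Comm d f] [Comm c k] [Comm d k]
    (h : ∀ a, tp c d T * g a = g' a * tp c d T) :
    tp c d T * t3 f g k x = t3 f g' k x * tp c d T :=
  slide_mid (fun _ => Comm.commute (f := tp c d) (g := f) _ _) h
    (fun _ => Comm.commute (f := tp c d) (g := k) _ _) _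

lemma slide₃ (k' : C →ₐ[ℂ] R) [Comm f k'] [Comm g k'] [Comm c f] [Comm d f] [Comm c g] [Comm d g]
    (h : ∀ a, tp c d T * k a = k' a * tp c d T) :
    tp c d T * t3 f g k x = t3 f g k' x * tp c d T :=
  slide_right (fun _ => Comm.commute (f := tp c d) (g := f) _ _)
    (slide_right (fun _ => Comm.commute (f := tp c d) (g := g) _ _) h) _

end Naturality

/-! ### Composites of coherent intertwiners are coherent. -/

section Composite

universe u v w w'

variable {G : Type u} [Ring G] [Algebra ℂ G] {Q : QuasiBialgebra G}
  {M : Type v} [Ring M] [Algebra ℂ M] {P : QuasiCommutingPair Q M}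
  {A : Type w} [Ring A] [Algebra ℂ A] {B : Type w'} [Ring B] [Algebra ℂ B]
  {R : Type*} [Ring R] [Algebra ℂ R]

/-- Every leg of a tensor product algebra splits into two commuting legs, so the value algebra of a
composite needs no separate treatment. -/
lemma tp_eta (h : A ⊗[ℂ] B →ₐ[ℂ] R) : h = tp (h.comp Algebra.TensorProduct.includeLeft)
    (h.comp Algebra.TensorProduct.includeRight) := by
  rw [← comp_tp, tp_include]; rfl

lemma exists_eq_tp (h : A ⊗[ℂ] B →ₐ[ℂ] R) : ∃ (x : A →ₐ[ℂ] R) (y : B →ₐ[ℂ] R) (_ : Comm x y),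
    h = tp x y := ⟨_, _, _, tp_eta h⟩

lemma Comm.of_tp_left {C : Type*} [Ring C] [Algebra ℂ C] (f : A →ₐ[ℂ] R) (g : B →ₐ[ℂ] R)
    (k : C →ₐ[ℂ] R) [Comm f g] [Comm k (tp f g)] : Comm k f :=
  ⟨fun c a => by simpa using Comm.commute (f := k) (g := tp f g) c (a ⊗ₜ 1)⟩

lemma Comm.of_tp_right {C : Type*} [Ring C] [Algebra ℂ C] (f : A →ₐ[ℂ] R) (g : B →ₐ[ℂ] R)
    (k : C →ₐ[ℂ] R) [Comm f g] [Comm k (tp f g)] : Comm k g :=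
  ⟨fun c a => by simpa using Comm.commute (f := k) (g := tp f g) c (1 ⊗ₜ a)⟩

/-- The composite of an intertwiner over `G` and one over `M` along `λ`. -/
def lamT (P : QuasiCommutingPair Q M) (i : G →ₐ[ℂ] A) (T : G ⊗[ℂ] A) (k : M →ₐ[ℂ] B)
    (S : G ⊗[ℂ] B) : G ⊗[ℂ] (A ⊗[ℂ] B) :=
  map₃ (AlgHom.id ℂ G) i k (perm231 P.φlr⁻¹.val) * leg13 S *
      map₃ (AlgHom.id ℂ G) i k (perm213 P.φl.val) * leg12 T *
      map₃ (AlgHom.id ℂ G) i k P.φl⁻¹.val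

/-- The composite of an intertwiner over `M` and one over `G` along `ρ`. -/
def rhoT (P : QuasiCommutingPair Q M) (i : G →ₐ[ℂ] A) (T : G ⊗[ℂ] A) (k : M →ₐ[ℂ] B)
    (S : G ⊗[ℂ] B) : G ⊗[ℂ] (B ⊗[ℂ] A) :=
  map₃ (AlgHom.id ℂ G) k i (perm231 P.φr⁻¹.val) * leg13 T *
      map₃ (AlgHom.id ℂ G) k i (perm213 P.φr.val) * leg12 S *
      map₃ (AlgHom.id ℂ G) k i P.φlr⁻¹.val

variable (i : G →ₐ[ℂ] A) (T : G ⊗[ℂ] A) (k : M →ₐ[ℂ] B) (S : G ⊗[ℂ] B)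

/-- Read from right to left, the strand `j` crosses `x` and then `v`, with the reassociators that
the bracketing requires. -/
lemma lamT_legs (j : G →ₐ[ℂ] R) (x : A →ₐ[ℂ] R) (v : B →ₐ[ℂ] R) [Comm x v] [Comm j x] [Comm j v] :
    tp j (tp x v) (lamT P i T k S) =
      ((t3 (x.comp i) (v.comp k) j P.φlr)⁻¹ : Rˣ) * tp j v S * t3 (x.comp i) j (v.comp k) P.φl *
        tp j x T * ((t3 j (x.comp i) (v.comp k) P.φl)⁻¹ : Rˣ) := by
  simp [lamT, tp_map₃, tp_leg13, tp_leg12, t3_val, t3_inv_val, tp_perm231, tp_perm213]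

lemma rhoT_legs (j : G →ₐ[ℂ] R) (x : B →ₐ[ℂ] R) (v : A →ₐ[ℂ] R) [Comm x v] [Comm j x] [Comm j v] :
    tp j (tp x v) (rhoT P i T k S) =
      ((t3 (x.comp k) (v.comp i) j P.φr)⁻¹ : Rˣ) * tp j v T * t3 (x.comp k) j (v.comp i) P.φr *
        tp j x S * ((t3 j (x.comp k) (v.comp i) P.φlr)⁻¹ : Rˣ) := by
  simp [rhoT, tp_map₃, tp_leg13, tp_leg12, t3_val, t3_inv_val, tp_perm231, tp_perm213]

variable {i T k S} (hT : IsCoherent Q.selfPair i T) (hS : IsCoherent P k S)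

lemma IsCoherent.mu_legs {i : G →ₐ[ℂ] A} {T : G ⊗[ℂ] A} (hT : IsCoherent Q.selfPair i T)
    (j : G →ₐ[ℂ] R) (x : A →ₐ[ℂ] R) [Comm j x] (a : G) :
    tp j x T * mu Q j (x.comp i) a = mu Q (x.comp i) j a * tp j x T :=
  hT.intertwine_legs j x a

lemma killLeft_eq_tp {A B : Type*} [Ring A] [Algebra ℂ A] [Ring B] [Algebra ℂ B]
    (e : A →ₐ[ℂ] ℂ) (x : A ⊗[ℂ] B) : killLeft e x = tp (triv e) (AlgHom.id ℂ B) x :=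
  (tp_triv_left e (AlgHom.id ℂ B) x).symm

lemma IsCoherent.self_coherent_legs {i : G →ₐ[ℂ] A} {T : G ⊗[ℂ] A}
    (hT : IsCoherent Q.selfPair i T) (j j' : G →ₐ[ℂ] R) (h : A →ₐ[ℂ] R) [Comm j j'] [Comm j h]
    [Comm j' h] :
    tp (mu Q j j') h T = t3 (h.comp i) j j' Q.reassoc * tp j h T *
      ((t3 j (h.comp i) j' Q.reassoc)⁻¹ : Rˣ) * tp j' h T * t3 j j' (h.comp i) Q.reassoc :=
  hT.coherent_legs j j' h

include hT hS

/-- This is the hexagon for a tensor product of two half-braided objects. It is what makes the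
prescribed formula for `λ_D` define an algebra map. -/
lemma lamT_coherent : IsCoherent P ((Algebra.TensorProduct.map i k).comp P.lam) (lamT P i T k S) := by
  refine IsCoherent.of_legs ?_ ?_ ?_
  · rw [killLeft_eq_tp, tp_eta (AlgHom.id ℂ (A ⊗[ℂ] B)), lamT_legs, hT.normal_legs,
      hS.normal_legs, φl_triv_left, φl_triv_mid, φlr_triv_right]
    simp
  · intro j h _ m
    obtain ⟨x, v, _, rfl⟩ := exists_eq_tp h
    have := Comm.of_tp_left x v j
    have := Comm.of_tp_right x v j
    simp only [← AlgHom.comp_assoc, tp_map]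
    rw [lamT_legs]
    exact composite_intertwine (lam_coassoc_legs P j (x.comp i) (v.comp k) m)
      (slide_left (hT.mu_legs j x) (fun _ => Comm.commute (f := tp j x) (g := v.comp k) _ _) _)
      (lam_coassoc_legs P (x.comp i) j (v.comp k) m).symm
      (slide_right (fun _ => Comm.commute (f := tp j v) (g := x.comp i) _ _)
        (hS.intertwine_legs j v) _)
      (quasi_comm_legs P (x.comp i) j (v.comp k) m)
  · intro j j' h _ _ _
    obtain ⟨x, v, _, rfl⟩ := exists_eq_tp h
    have := Comm.of_tp_left x v j
    have := Comm.of_tp_right x v j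
    have := Comm.of_tp_left x v j'
    have := Comm.of_tp_right x v j'
    simp only [← AlgHom.comp_assoc, tp_map]
    rw [lamT_legs, lamT_legs, lamT_legs, hT.self_coherent_legs, hS.coherent_legs]
    set x' := x.comp i
    set v' := v.comp k
    -- The six pentagons belong to the six shuffles of the strands `j, j'` with `x', v'`; which
    -- axiom applies depends on the position of the `M`-strand `v'`.
    refine composite_coherence (lam_pentagon_legs P x' j j' v')
      (mixed_pentagon_lam_legs P x' j j' v') (lam_pentagon_legs P j x' j' v')
      (mixed_pentagon_rho_legs P x' j j' v') (mixed_pentagon_lam_legs P j x' j' v')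
      (lam_pentagon_legs P j j' x' v')
      (slide₃ j' v S x' j _ _ _ (hS.intertwine_legs j' v))
      (slide₁ j x T _ j' v' _ _ (hT.mu_legs j x))
      ?_
      (slide₃ j' v S j x' _ _ _ (hS.intertwine_legs j' v))
      (slide₂ j' x T j _ v' _ _ (hT.mu_legs j' x))
      (slide₂ j v S x' _ j' _ _ (hS.intertwine_legs j v))
      (slide₁ j x T _ v' j' _ _ (hT.mu_legs j x))
    -- These intertwiners have no strand in common, so they commute.
    exact (Comm.commute (f := tp j' v) (g := tp j x) S T).eq

lemma rhoT_coherent : IsCoherent P ((Algebra.TensorProduct.map k i).comp P.rho) (rhoT P i T k S) := by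
  refine IsCoherent.of_legs ?_ ?_ ?_
  · rw [killLeft_eq_tp, tp_eta (AlgHom.id ℂ (B ⊗[ℂ] A)), rhoT_legs, hT.normal_legs,
      hS.normal_legs, φr_triv_right, φr_triv_mid, φlr_triv_left]
    simp
  · intro j h _ m
    obtain ⟨x, v, _, rfl⟩ := exists_eq_tp h
    have := Comm.of_tp_left x v j
    have := Comm.of_tp_right x v j
    simp only [← AlgHom.comp_assoc, tp_map]
    rw [rhoT_legs]
    exact composite_intertwine (quasi_comm_legs P j (v.comp i) (x.comp k) m).symm
      (slide_left (hS.intertwine_legs j x) (fun _ => Comm.commute (f := tp j x) (g := v.comp i) _ _)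
        _)
      (rho_coassoc_legs P j (v.comp i) (x.comp k) m)
      (slide_right (fun _ => Comm.commute (f := tp j v) (g := x.comp k) _ _)
        (hT.mu_legs j v) _)
      (rho_coassoc_legs P (v.comp i) j (x.comp k) m)
  · intro j j' h _ _ _
    obtain ⟨x, v, _, rfl⟩ := exists_eq_tp h
    have := Comm.of_tp_left x v j
    have := Comm.of_tp_right x v j
    have := Comm.of_tp_left x v j'
    have := Comm.of_tp_right x v j'
    simp only [← AlgHom.comp_assoc, tp_map]
    rw [rhoT_legs, rhoT_legs, rhoT_legs, hT.self_coherent_legs, hS.coherent_legs]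
    set x' := x.comp k
    set v' := v.comp i
    refine composite_coherence (rho_pentagon_legs P j j' v' x')
      (rho_pentagon_legs P j v' j' x') (mixed_pentagon_rho_legs P j j' v' x')
      (rho_pentagon_legs P v' j j' x') (mixed_pentagon_rho_legs P j v' j' x')
      (mixed_pentagon_lam_legs P j j' v' x')
      (slide₃ j' v T x' j _ _ _ (hT.mu_legs j' v))
      (slide₁ j x S _ j' v' _ _ (hS.intertwine_legs j x))
      ?_
      (slide₃ j' v T j x' _ _ _ (hT.mu_legs j' v))
      (slide₂ j' x S j _ v' _ _ (hS.intertwine_legs j' x))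
      (slide₂ j v T x' _ j' _ _ (hT.mu_legs j v))
      (slide₁ j x S _ v' j' _ _ (hS.intertwine_legs j x))
    exact (Comm.commute (f := tp j' v) (g := tp j x) T S).eq

end Composite

/-! ### The quasi-bialgebra `D(G)` and its coactions on `M₁`. -/

section StructureMaps

universe u v

variable {G : Type u} [Ring G] [Algebra ℂ G] [FiniteDimensional ℂ G] (Q : QuasiBialgebra G)
  {M : Type v} [Ring M] [Algebra ℂ M] (P : QuasiCommutingPair Q M)
  {R : Type*} [Ring R] [Algebra ℂ R]

omit [FiniteDimensional ℂ G] in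
-- The trivial intertwiner is coherent because each reassociator with a counit leg is trivial.
lemma counit_coherent : IsCoherent Q.selfPair Q.counit (1 : G ⊗[ℂ] ℂ) := by
  have key : ∀ {S : Type u} [Ring S] [Algebra ℂ S] (h : ℂ →ₐ[ℂ] S),
      h.comp Q.counit = triv Q.counit := fun h => by
    rw [triv, Subsingleton.elim h (Algebra.ofId ℂ _)]
  refine IsCoherent.of_legs (map_one _) (fun j h _ m => ?_) (fun j j' h _ _ _ => ?_)
  · have h1 := mu_triv_left (Q := Q) j
    have h2 := mu_triv_right (Q := Q) j
    simp only [map_one, one_mul, mul_one, key]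
    exact DFunLike.congr_fun (h2.trans h1.symm) m
  · have h1 : t3 (triv Q.counit) j j' Q.reassoc = 1 := φl_triv_left Q.selfPair j' j
    have h2 : t3 j (triv Q.counit) j' Q.reassoc = 1 := φl_triv_mid Q.selfPair j' j
    have h3 : t3 j j' (triv Q.counit) Q.reassoc = 1 := φr_triv_right Q.selfPair j j'
    simp only [key]
    simp [QuasiBialgebra.selfPair, h1, h2, h3]

/-- The counit of the quantum double. -/
def counitD : DiagonalCrossedProduct Q.selfPair →ₐ[ℂ] ℂ := (counit_coherent Q).lift

/-- The coaction `λ_D`. -/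
def lamD : DiagonalCrossedProduct P →ₐ[ℂ]
    DiagonalCrossedProduct Q.selfPair ⊗[ℂ] DiagonalCrossedProduct P :=
  (lamT_coherent (univ_coherent Q.selfPair) (univ_coherent P)).lift

/-- The coaction `ρ_D`. -/
def rhoD : DiagonalCrossedProduct P →ₐ[ℂ]
    DiagonalCrossedProduct P ⊗[ℂ] DiagonalCrossedProduct Q.selfPair :=
  (rhoT_coherent (univ_coherent Q.selfPair) (univ_coherent P)).lift

omit [FiniteDimensional ℂ G] in
lemma selfPair_φl : Q.selfPair.φl = Q.reassoc := rfl

omit [FiniteDimensional ℂ G] in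
lemma la_self (j k : G →ₐ[ℂ] R) [Comm j k] : la Q.selfPair j k = mu Q j k := rfl

variable {Q} in
-- Conjugating by `a` turns an intertwining relation into an equality of algebra maps, which is
-- tested on generators. Coassociativity up to a reassociator is proved by this principle.
lemma dcp_conj_ext {f g : DiagonalCrossedProduct P →ₐ[ℂ] R} (a : Rˣ)
    (h₁ : ∀ m, f (P.incl m) * a = a * g (P.incl m))
    (h₂ : tp (Algebra.TensorProduct.includeLeft : G →ₐ[ℂ] G ⊗[ℂ] R)
        (Algebra.TensorProduct.includeRight.comp f) P.univ *
          (Algebra.TensorProduct.includeRight : R →ₐ[ℂ] G ⊗[ℂ] R) a =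
      (Algebra.TensorProduct.includeRight : R →ₐ[ℂ] G ⊗[ℂ] R) a *
        tp Algebra.TensorProduct.includeLeft (Algebra.TensorProduct.includeRight.comp g) P.univ)
    (y : DiagonalCrossedProduct P) : f y * a = a * g y := by
  -- The inner automorphism `x ↦ a x a⁻¹`; the claim becomes `f = c ∘ g`.
  let c : R →ₐ[ℂ] R := AlgHom.ofLinearMap
    (LinearMap.mulLeft ℂ (a : R) ∘ₗ LinearMap.mulRight ℂ ((a⁻¹ : Rˣ) : R)) (by simp)
    (fun x y => by simp [mul_assoc])
  have hc : ∀ x, c x = a * x * (a⁻¹ : Rˣ) := fun x => by simp [c, mul_assoc]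
  have hc' : ∀ t : G ⊗[ℂ] R, onRight c t = (1 ⊗ₜ (a : R)) * t * (1 ⊗ₜ ((a⁻¹ : Rˣ) : R)) := by
    intro t
    induction t with
    | zero => simp
    | tmul x y => simp [onRight_tmul, hc]
    | add t s ht hs => simp only [map_add, ht, hs, mul_add, add_mul]
  have : f = c.comp g := by
    refine dcp_hom_ext (fun m => ?_) ?_
    · rw [AlgHom.comp_apply, hc, ← h₁, Units.mul_inv_cancel_right]
    · simp only [← tp_onRight, tp_std] at h₂
      have h3 : onRight (c.comp g) P.univ = onRight c (onRight (A := G) g P.univ) := by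
        rw [← tp_std (onRight (c.comp g) _), ← tp_std (onRight c _), tp_onRight, tp_onRight,
          tp_onRight]
        rfl
      rw [h3, hc']
      have h4 : ((1 : G) ⊗ₜ[ℂ] (a : R)) * (1 ⊗ₜ ((a⁻¹ : Rˣ) : R)) = 1 := by
        simp [Algebra.TensorProduct.one_def]
      simp only [Algebra.TensorProduct.includeRight_apply] at h₂
      rw [← h₂, mul_assoc, h4, mul_one]
  rw [this, AlgHom.comp_apply, hc, Units.inv_mul_cancel_right]

variable {Q}

section

variable (j : G →ₐ[ℂ] R) (x y : DiagonalCrossedProduct Q.selfPair →ₐ[ℂ] R)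
  (v : DiagonalCrossedProduct P →ₐ[ℂ] R)

lemma lamD_incl [Comm x v] : ((tp x v).comp (lamD Q P)).comp P.incl =
    la P (x.comp Q.selfPair.incl) (v.comp P.incl) := by
  rw [AlgHom.comp_assoc, lamD, IsCoherent.lift_comp_incl, ← AlgHom.comp_assoc, tp_map]

lemma rhoD_incl [Comm v x] : ((tp v x).comp (rhoD Q P)).comp P.incl =
    ra P (v.comp P.incl) (x.comp Q.selfPair.incl) := by
  rw [AlgHom.comp_assoc, rhoD, IsCoherent.lift_comp_incl, ← AlgHom.comp_assoc, tp_map]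

lemma comulD_incl [Comm x y] : ((tp x y).comp (lamD Q Q.selfPair)).comp Q.selfPair.incl =
    mu Q (x.comp Q.selfPair.incl) (y.comp Q.selfPair.incl) := lamD_incl Q.selfPair x y

lemma lamD_univ [Comm x v] [Comm j x] [Comm j v] : tp j ((tp x v).comp (lamD Q P)) P.univ =
    ((t3 (x.comp Q.selfPair.incl) (v.comp P.incl) j P.φlr)⁻¹ : Rˣ) * tp j v P.univ *
      t3 (x.comp Q.selfPair.incl) j (v.comp P.incl) P.φl * tp j x Q.selfPair.univ *
        ((t3 j (x.comp Q.selfPair.incl) (v.comp P.incl) P.φl)⁻¹ : Rˣ) := by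
  rw [← tp_onRight, lamD, IsCoherent.lift_univ, lamT_legs]

lemma rhoD_univ [Comm v x] [Comm j x] [Comm j v] : tp j ((tp v x).comp (rhoD Q P)) P.univ =
    ((t3 (v.comp P.incl) (x.comp Q.selfPair.incl) j P.φr)⁻¹ : Rˣ) * tp j x Q.selfPair.univ *
      t3 (v.comp P.incl) j (x.comp Q.selfPair.incl) P.φr * tp j v P.univ *
        ((t3 j (v.comp P.incl) (x.comp Q.selfPair.incl) P.φlr)⁻¹ : Rˣ) := by
  rw [← tp_onRight, rhoD, IsCoherent.lift_univ, rhoT_legs]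

lemma comulD_univ [Comm x y] [Comm j x] [Comm j y] :
    tp j ((tp x y).comp (lamD Q Q.selfPair)) Q.selfPair.univ =
    ((t3 (x.comp Q.selfPair.incl) (y.comp Q.selfPair.incl) j Q.reassoc)⁻¹ : Rˣ) *
      tp j y Q.selfPair.univ *
      t3 (x.comp Q.selfPair.incl) j (y.comp Q.selfPair.incl) Q.reassoc * tp j x Q.selfPair.univ *
        ((t3 j (x.comp Q.selfPair.incl) (y.comp Q.selfPair.incl) Q.reassoc)⁻¹ : Rˣ) :=
  lamD_univ Q.selfPair j x y

lemma map_t3 {R' A B C : Type*} [Ring R'] [Algebra ℂ R'] [Ring A] [Algebra ℂ A] [Ring B]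
    [Algebra ℂ B] [Ring C] [Algebra ℂ C] (f : A →ₐ[ℂ] R) (g : B →ₐ[ℂ] R) (k : C →ₐ[ℂ] R)
    [Comm g k] [Comm f g] [Comm f k] (z : (A ⊗[ℂ] (B ⊗[ℂ] C))ˣ) (c : R →ₐ[ℂ] R') :
    c (t3 f g k z) = t3 (c.comp f) (c.comp g) (c.comp k) z := by
  simp only [t3_val, map_tp, comp_tp]

/-- `λ_D` is coassociative up to `φ_λ`. -/
lemma lamD_coassoc_univ [Comm x y] [Comm x v] [Comm y v] [Comm j x] [Comm j y] [Comm j v] :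
    tp j ((tp x ((tp y v).comp (lamD Q P))).comp (lamD Q P)) P.univ *
        t3 (x.comp Q.selfPair.incl) (y.comp Q.selfPair.incl) (v.comp P.incl) P.φl =
      t3 (x.comp Q.selfPair.incl) (y.comp Q.selfPair.incl) (v.comp P.incl) P.φl *
        tp j ((tp ((tp x y).comp (lamD Q Q.selfPair)) v).comp (lamD Q P)) P.univ := by
  rw [lamD_univ, lamD_univ, lamD_univ, comulD_univ]
  simp only [lamD_incl]
  set x' := x.comp Q.selfPair.incl
  set y' := y.comp Q.selfPair.incl
  set v' := v.comp P.incl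
  -- The strand `j` crosses three others; one pentagon is needed for each of its four positions
  -- among them.
  exact composite_assoc (lam_pentagon_legs P j x' y' v') (lam_pentagon_legs P x' j y' v')
    (lam_pentagon_legs P x' y' j v') (mixed_pentagon_lam_legs P x' y' j v')
    (slide₁ j x _ _ y' v' _ _ ((univ_coherent Q.selfPair).mu_legs j x))
    (slide₂ j y _ x' _ v' _ _ ((univ_coherent Q.selfPair).mu_legs j y))
    (slide₃ j v _ x' y' _ _ _ ((univ_coherent P).intertwine_legs j v))

/-- `ρ_D` is coassociative up to `φ_ρ`. -/
lemma rhoD_coassoc_univ [Comm x y] [Comm v x] [Comm v y] [Comm j x] [Comm j y] [Comm j v] :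
    tp j ((tp v ((tp x y).comp (lamD Q Q.selfPair))).comp (rhoD Q P)) P.univ *
        t3 (v.comp P.incl) (x.comp Q.selfPair.incl) (y.comp Q.selfPair.incl) P.φr =
      t3 (v.comp P.incl) (x.comp Q.selfPair.incl) (y.comp Q.selfPair.incl) P.φr *
        tp j ((tp ((tp v x).comp (rhoD Q P)) y).comp (rhoD Q P)) P.univ := by
  rw [rhoD_univ, rhoD_univ, rhoD_univ, comulD_univ]
  simp only [rhoD_incl, comulD_incl]
  set x' := x.comp Q.selfPair.incl
  set y' := y.comp Q.selfPair.incl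
  set v' := v.comp P.incl
  exact composite_assoc (mixed_pentagon_rho_legs P j x' y' v') (rho_pentagon_legs P j x' y' v')
    (rho_pentagon_legs P x' j y' v') (rho_pentagon_legs P x' y' j v')
    (slide₁ j v _ _ x' y' _ _ ((univ_coherent P).intertwine_legs j v))
    (slide₂ j x _ v' _ y' _ _ ((univ_coherent Q.selfPair).mu_legs j x))
    (slide₃ j y _ v' x' _ _ _ ((univ_coherent Q.selfPair).mu_legs j y))

/-- `λ_D` and `ρ_D` commute up to `φ_λρ`. -/
lemma lamD_rhoD_univ [Comm x y] [Comm x v] [Comm v y] [Comm j x] [Comm j y] [Comm j v] :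
    tp j ((tp x ((tp v y).comp (rhoD Q P))).comp (lamD Q P)) P.univ *
        t3 (x.comp Q.selfPair.incl) (v.comp P.incl) (y.comp Q.selfPair.incl) P.φlr =
      t3 (x.comp Q.selfPair.incl) (v.comp P.incl) (y.comp Q.selfPair.incl) P.φlr *
        tp j ((tp ((tp x v).comp (lamD Q P)) y).comp (rhoD Q P)) P.univ := by
  rw [lamD_univ, rhoD_univ, rhoD_univ, lamD_univ]
  simp only [rhoD_incl, lamD_incl]
  set x' := x.comp Q.selfPair.incl
  set y' := y.comp Q.selfPair.incl
  set v' := v.comp P.incl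
  exact composite_assoc (mixed_pentagon_lam_legs P j x' y' v') (mixed_pentagon_lam_legs P x' j y' v')
    (mixed_pentagon_rho_legs P x' j y' v') (mixed_pentagon_rho_legs P x' y' j v')
    (slide₁ j x _ _ v' y' _ _ ((univ_coherent Q.selfPair).mu_legs j x))
    (slide₂ j v _ x' _ y' _ _ ((univ_coherent P).intertwine_legs j v))
    (slide₃ j y _ x' v' _ _ _ ((univ_coherent Q.selfPair).mu_legs j y))

/-- On `M` this is coassociativity of `λ`; on the universal intertwiner it is associativity of
composites. The commuting legs `x`, `y`, `v` are arbitrary. -/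
lemma lamD_coassoc [Comm x y] [Comm x v] [Comm y v] (a : DiagonalCrossedProduct P) :
    tp x ((tp y v).comp (lamD Q P)) (lamD Q P a) *
        t3 (x.comp Q.selfPair.incl) (y.comp Q.selfPair.incl) (v.comp P.incl) P.φl =
      t3 (x.comp Q.selfPair.incl) (y.comp Q.selfPair.incl) (v.comp P.incl) P.φl *
        tp ((tp x y).comp (lamD Q Q.selfPair)) v (lamD Q P a) := by
  refine dcp_conj_ext P (f := (tp x ((tp y v).comp (lamD Q P))).comp (lamD Q P))
    (g := (tp ((tp x y).comp (lamD Q Q.selfPair)) v).comp (lamD Q P)) _ (fun m => ?_) ?_ a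
  · have := lam_coassoc_legs P (x.comp Q.selfPair.incl) (y.comp Q.selfPair.incl)
      (v.comp P.incl) m
    simpa only [← AlgHom.comp_apply, lamD_incl, la_self] using this
  · simpa only [map_t3, comp_tp, ← AlgHom.comp_assoc] using
      lamD_coassoc_univ P Algebra.TensorProduct.includeLeft
        (Algebra.TensorProduct.includeRight.comp x) (Algebra.TensorProduct.includeRight.comp y)
        (Algebra.TensorProduct.includeRight.comp v)

lemma rhoD_coassoc [Comm x y] [Comm v x] [Comm v y] (a : DiagonalCrossedProduct P) :
    tp v ((tp x y).comp (lamD Q Q.selfPair)) (rhoD Q P a) *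
        t3 (v.comp P.incl) (x.comp Q.selfPair.incl) (y.comp Q.selfPair.incl) P.φr =
      t3 (v.comp P.incl) (x.comp Q.selfPair.incl) (y.comp Q.selfPair.incl) P.φr *
        tp ((tp v x).comp (rhoD Q P)) y (rhoD Q P a) := by
  refine dcp_conj_ext P (f := (tp v ((tp x y).comp (lamD Q Q.selfPair))).comp (rhoD Q P))
    (g := (tp ((tp v x).comp (rhoD Q P)) y).comp (rhoD Q P)) _ (fun m => ?_) ?_ a
  · have := rho_coassoc_legs P (x.comp Q.selfPair.incl) (y.comp Q.selfPair.incl)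
      (v.comp P.incl) m
    simpa only [← AlgHom.comp_apply, rhoD_incl, comulD_incl] using this.symm
  · simpa only [map_t3, comp_tp, ← AlgHom.comp_assoc] using
      rhoD_coassoc_univ P Algebra.TensorProduct.includeLeft
        (Algebra.TensorProduct.includeRight.comp x) (Algebra.TensorProduct.includeRight.comp y)
        (Algebra.TensorProduct.includeRight.comp v)

lemma lamD_rhoD [Comm x y] [Comm x v] [Comm v y] (a : DiagonalCrossedProduct P) :
    tp x ((tp v y).comp (rhoD Q P)) (lamD Q P a) *
        t3 (x.comp Q.selfPair.incl) (v.comp P.incl) (y.comp Q.selfPair.incl) P.φlr =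
      t3 (x.comp Q.selfPair.incl) (v.comp P.incl) (y.comp Q.selfPair.incl) P.φlr *
        tp ((tp x v).comp (lamD Q P)) y (rhoD Q P a) := by
  refine dcp_conj_ext P (f := (tp x ((tp v y).comp (rhoD Q P))).comp (lamD Q P))
    (g := (tp ((tp x v).comp (lamD Q P)) y).comp (rhoD Q P)) _ (fun m => ?_) ?_ a
  · have := quasi_comm_legs P (x.comp Q.selfPair.incl) (y.comp Q.selfPair.incl)
      (v.comp P.incl) m
    simpa only [← AlgHom.comp_apply, rhoD_incl, lamD_incl] using this.symm
  · simpa only [map_t3, comp_tp, ← AlgHom.comp_assoc] using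
      lamD_rhoD_univ P Algebra.TensorProduct.includeLeft
        (Algebra.TensorProduct.includeRight.comp x) (Algebra.TensorProduct.includeRight.comp y)
        (Algebra.TensorProduct.includeRight.comp v)

variable {P} in
lemma dcp_hom_ext_legs {f g : DiagonalCrossedProduct P →ₐ[ℂ] R} (h₁ : f.comp P.incl = g.comp P.incl)
    (h₂ : tp (Algebra.TensorProduct.includeLeft : G →ₐ[ℂ] G ⊗[ℂ] R)
        (Algebra.TensorProduct.includeRight.comp f) P.univ =
        tp Algebra.TensorProduct.includeLeft (Algebra.TensorProduct.includeRight.comp g) P.univ) :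
    f = g :=
  dcp_hom_ext (DFunLike.congr_fun h₁) (by simpa only [← tp_onRight, tp_std] using h₂)

lemma counitD_incl : (counitD Q).comp Q.selfPair.incl = Q.counit :=
  (counit_coherent Q).lift_comp_incl

lemma tp_counitD_univ : tp j (triv (counitD Q)) Q.selfPair.univ = 1 := by
  have : tp j (triv (counitD Q)) Q.selfPair.univ =
      tp j (triv (AlgHom.id ℂ ℂ)) (onRight (counitD Q) Q.selfPair.univ) := by
    simp only [tp_onRight, triv_comp, AlgHom.id_comp]
  rw [this, counitD, IsCoherent.lift_univ, map_one]

/-- Replacing one factor by the trivial intertwiner makes all three reassociators in the composite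
trivial. -/
lemma lamD_counit : (tp (triv (counitD Q)) v).comp (lamD Q P) = v := by
  refine dcp_hom_ext_legs ?_ ?_
  · simp only [lamD_incl, triv_comp, counitD_incl, la_triv]
  · simp only [← AlgHom.comp_assoc, comp_tp, comp_triv, lamD_univ, triv_comp, counitD_incl,
      φlr_triv_left, φl_triv_left, φl_triv_mid, tp_counitD_univ]
    simp

lemma rhoD_counit : (tp v (triv (counitD Q))).comp (rhoD Q P) = v := by
  refine dcp_hom_ext_legs ?_ ?_
  · simp only [rhoD_incl, triv_comp, counitD_incl, ra_triv]
  · simp only [← AlgHom.comp_assoc, comp_tp, comp_triv, rhoD_univ, triv_comp, counitD_incl,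
      φlr_triv_right, φr_triv_mid, φr_triv_right, tp_counitD_univ]
    simp

end

/-- The reassociator of the quantum double. -/
def reassocD (Q : QuasiBialgebra G) := Units.map
  (map₃ Q.selfPair.incl Q.selfPair.incl Q.selfPair.incl).toMonoidHom Q.reassoc

lemma killLeft_eq {A B : Type*} [Ring A] [Algebra ℂ A] [Ring B] [Algebra ℂ B]
    (e : A →ₐ[ℂ] ℂ) : (killLeft e : A ⊗[ℂ] B →ₐ[ℂ] B) = tp (triv e) (AlgHom.id ℂ B) :=
  AlgHom.ext (killLeft_eq_tp e)

lemma killRight_eq {A B : Type*} [Ring A] [Algebra ℂ A] [Ring B] [Algebra ℂ B]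
    (e : B →ₐ[ℂ] ℂ) : (killRight e : A ⊗[ℂ] B →ₐ[ℂ] A) = tp (AlgHom.id ℂ A) (triv e) :=
  AlgHom.ext fun x => (tp_triv_right e (AlgHom.id ℂ A) x).symm

lemma onRight_eq_tp {A B C : Type*} [Ring A] [Algebra ℂ A] [Ring B] [Algebra ℂ B] [Ring C]
    [Algebra ℂ C] (f : B →ₐ[ℂ] C) : (onRight f : A ⊗[ℂ] B →ₐ[ℂ] A ⊗[ℂ] C) =
      tp Algebra.TensorProduct.includeLeft (Algebra.TensorProduct.includeRight.comp f) := by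
  rw [← tp_comp_onRight, tp_include]; rfl

/-- The quasi-bialgebra structure of the quantum double. -/
def doubleQuasiBialgebra (Q : QuasiBialgebra G) :
    QuasiBialgebra (DiagonalCrossedProduct Q.selfPair) where
  comul := lamD Q Q.selfPair
  counit := counitD Q
  reassoc := reassocD Q
  quasi_coassoc a := by
    refine (tp_std₃ _).symm.trans (Eq.trans ?_ (tp_std₃ _))
    simpa [tp_onRight, tp_onLeft, reassocD, tp_map₃, t3_val, selfPair_φl] using
      lamD_coassoc Q.selfPair leg₁ leg₂ leg₃ a
  pentagon := by
    -- The legs of `φ_D` factor through `i_D`, where `Δ_D` restricts to `Δ`; hence the pentagon of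
    -- `φ` itself suffices.
    refine (tp_std₄ _).symm.trans (Eq.trans ?_ (tp_std₄ _))
    simpa [tp_onRight, tp_onLeft, reassocD, tp_map₃, tp_comp_onRight, tp_comp_onLeft, lamD_incl, la_self,
      tp_oneTmul, tp_tmulOne, t3_val]
      using (congrArg Units.val (pentagon_legs (Q := Q) (leg₁.comp Q.selfPair.incl)
        (leg₂.comp Q.selfPair.incl)
        ((leg₃.comp Algebra.TensorProduct.includeLeft).comp Q.selfPair.incl)
        ((leg₃.comp Algebra.TensorProduct.includeRight).comp Q.selfPair.incl))).symm
  counit_left a := by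
    rw [killLeft_eq]
    exact DFunLike.congr_fun (lamD_counit Q.selfPair (AlgHom.id ℂ _)) a
  counit_right a := by
    -- For the pair of `G` with itself the constructions of `λ_D` and `ρ_D` coincide by definition,
    -- so the right counit law is that of `ρ_D`.
    rw [killRight_eq]
    exact DFunLike.congr_fun (rhoD_counit Q.selfPair (AlgHom.id ℂ _)) a
  counit_reassoc := by
    simp only [onRight_eq_tp, killLeft_eq, comp_tp]
    have h : t3 (Algebra.TensorProduct.includeLeft.comp Q.selfPair.incl) (triv Q.counit)
      (Algebra.TensorProduct.includeRight.comp Q.selfPair.incl) Q.reassoc = 1 :=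
      φl_triv_mid Q.selfPair _ _
    simpa [reassocD, tp_map₃, comp_triv, triv_comp, counitD_incl, t3_val] using congrArg Units.val h

lemma double_comul : (doubleQuasiBialgebra Q).comul = lamD Q Q.selfPair := rfl

lemma double_counit : (doubleQuasiBialgebra Q).counit = counitD Q := rfl

lemma double_reassoc : (doubleQuasiBialgebra Q).reassoc = reassocD Q := rfl

/-- The quasi-commuting pair of coactions of the quantum double on a diagonal crossed product. -/
def doublePair : QuasiCommutingPair (doubleQuasiBialgebra Q) (DiagonalCrossedProduct P) where
  lam := lamD Q P
  rho := rhoD Q P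
  φl := Units.map (map₃ Q.selfPair.incl Q.selfPair.incl P.incl).toMonoidHom P.φl
  φr := Units.map (map₃ P.incl Q.selfPair.incl Q.selfPair.incl).toMonoidHom P.φr
  φlr := Units.map (map₃ Q.selfPair.incl P.incl Q.selfPair.incl).toMonoidHom P.φlr
  lam_coassoc a := by
    refine (tp_std₃ _).symm.trans (Eq.trans ?_ (tp_std₃ _))
    simpa [tp_onRight, tp_onLeft, tp_map₃, t3_val, double_comul] using
      lamD_coassoc P leg₁ leg₂ leg₃ a
  lam_pentagon := by
    refine (tp_std₄ _).symm.trans (Eq.trans ?_ (tp_std₄ _))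
    simpa [tp_onRight, tp_onLeft, reassocD, tp_map₃, tp_comp_onRight, tp_comp_onLeft, lamD_incl,
      rhoD_incl, la_self, tp_oneTmul, tp_tmulOne, t3_val, double_comul, double_reassoc]
      using congrArg Units.val (lam_pentagon_legs P (leg₁.comp Q.selfPair.incl)
        (leg₂.comp Q.selfPair.incl)
        ((leg₃.comp Algebra.TensorProduct.includeLeft).comp Q.selfPair.incl)
        ((leg₃.comp Algebra.TensorProduct.includeRight).comp P.incl))
  lam_counit a := by
    rw [double_counit, killLeft_eq]
    exact DFunLike.congr_fun (lamD_counit P (AlgHom.id ℂ _)) a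
  φl_counit_mid := by
    simp only [double_counit, onRight_eq_tp, killLeft_eq, comp_tp]
    have h := φl_triv_mid P (Algebra.TensorProduct.includeRight.comp P.incl)
      (Algebra.TensorProduct.includeLeft.comp Q.selfPair.incl :
        G →ₐ[ℂ] DiagonalCrossedProduct Q.selfPair ⊗[ℂ] DiagonalCrossedProduct P)
    simpa [t3_val, tp_map₃, comp_triv, triv_comp, counitD_incl] using congrArg Units.val h
  φl_counit_left := by
    rw [double_counit, killLeft_eq, tp_eta (AlgHom.id ℂ (_ ⊗[ℂ] DiagonalCrossedProduct P))]
    have h := φl_triv_left P (Algebra.TensorProduct.includeRight.comp P.incl)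
      (Algebra.TensorProduct.includeLeft.comp Q.selfPair.incl :
        G →ₐ[ℂ] DiagonalCrossedProduct Q.selfPair ⊗[ℂ] DiagonalCrossedProduct P)
    simpa [t3_val, tp_map₃, comp_triv, triv_comp, counitD_incl] using congrArg Units.val h
  rho_coassoc a := by
    refine (tp_std₃ _).symm.trans (Eq.trans ?_ (tp_std₃ _))
    simpa [tp_onRight, tp_onLeft, tp_map₃, t3_val, double_comul] using
      (rhoD_coassoc P leg₂ leg₃ leg₁ a).symm
  rho_pentagon := by
    refine (tp_std₄ _).symm.trans (Eq.trans ?_ (tp_std₄ _))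
    simpa [tp_onRight, tp_onLeft, reassocD, tp_map₃, tp_comp_onRight, tp_comp_onLeft, lamD_incl,
      rhoD_incl, la_self, tp_oneTmul, tp_tmulOne, t3_val, double_comul, double_reassoc]
      using congrArg Units.val (rho_pentagon_legs P (leg₂.comp Q.selfPair.incl)
        ((leg₃.comp Algebra.TensorProduct.includeLeft).comp Q.selfPair.incl)
        ((leg₃.comp Algebra.TensorProduct.includeRight).comp Q.selfPair.incl)
        (leg₁.comp P.incl))
  rho_counit a := by
    rw [double_counit, killRight_eq]
    exact DFunLike.congr_fun (rhoD_counit P (AlgHom.id ℂ _)) a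
  φr_counit_mid := by
    simp only [double_counit, onRight_eq_tp, killLeft_eq, comp_tp]
    have h := φr_triv_mid P (Algebra.TensorProduct.includeLeft.comp P.incl)
      (Algebra.TensorProduct.includeRight.comp Q.selfPair.incl :
        G →ₐ[ℂ] DiagonalCrossedProduct P ⊗[ℂ] DiagonalCrossedProduct Q.selfPair)
    simpa [t3_val, tp_map₃, comp_triv, triv_comp, counitD_incl] using congrArg Units.val h
  φr_counit_right := by
    simp only [double_counit, onRight_eq_tp, killRight_eq, comp_tp]
    have h := φr_triv_right P (Algebra.TensorProduct.includeLeft.comp P.incl)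
      (Algebra.TensorProduct.includeRight.comp Q.selfPair.incl :
        G →ₐ[ℂ] DiagonalCrossedProduct P ⊗[ℂ] DiagonalCrossedProduct Q.selfPair)
    simpa [t3_val, tp_map₃, comp_triv, triv_comp, counitD_incl] using congrArg Units.val h
  quasi_comm a := by
    refine (tp_std₃ _).symm.trans (Eq.trans ?_ (tp_std₃ _))
    simpa [tp_onRight, tp_onLeft, tp_map₃, t3_val, double_comul] using
      (lamD_rhoD P leg₁ leg₃ leg₂ a).symm
  mixed_pentagon_lam := by
    refine (tp_std₄ _).symm.trans (Eq.trans ?_ (tp_std₄ _))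
    simpa [tp_onRight, tp_onLeft, reassocD, tp_map₃, tp_comp_onRight, tp_comp_onLeft, lamD_incl,
      rhoD_incl, la_self, tp_oneTmul, tp_tmulOne, t3_val, double_comul, double_reassoc]
      using congrArg Units.val (mixed_pentagon_lam_legs P (leg₁.comp Q.selfPair.incl)
        (leg₂.comp Q.selfPair.incl)
        ((leg₃.comp Algebra.TensorProduct.includeRight).comp Q.selfPair.incl)
        ((leg₃.comp Algebra.TensorProduct.includeLeft).comp P.incl))
  mixed_pentagon_rho := by
    refine (tp_std₄ _).symm.trans (Eq.trans ?_ (tp_std₄ _))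
    simpa [tp_onRight, tp_onLeft, reassocD, tp_map₃, tp_comp_onRight, tp_comp_onLeft, lamD_incl,
      rhoD_incl, la_self, tp_oneTmul, tp_tmulOne, t3_val, double_comul, double_reassoc]
      using congrArg Units.val (mixed_pentagon_rho_legs P (leg₁.comp Q.selfPair.incl)
        ((leg₃.comp Algebra.TensorProduct.includeLeft).comp Q.selfPair.incl)
        ((leg₃.comp Algebra.TensorProduct.includeRight).comp Q.selfPair.incl)
        (leg₂.comp P.incl))

end StructureMaps

/-! ### The antipode and its inverse. -/

section Antipode

variable {G : Type*} [Ring G] [Algebra ℂ G] (H : QuasiHopfAlgebra G)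

lemma QuasiHopfAlgebra.S_one : H.S 1 = 1 := by
  obtain ⟨x, hx⟩ := H.S.surjective 1
  have := H.S_mul x 1
  rw [mul_one, hx, mul_one] at this
  exact this.symm

lemma QuasiHopfAlgebra.symm_one : H.S.symm 1 = 1 := by
  rw [LinearEquiv.symm_apply_eq, H.S_one]

lemma QuasiHopfAlgebra.symm_mul (a b : G) : H.S.symm (a * b) = H.S.symm b * H.S.symm a := by
  rw [LinearEquiv.symm_apply_eq, H.S_mul]
  simp

end Antipode

/-! ### Legs acting by multiplications twisted with the antipode. -/

section Operators

variable {R A B C : Type*} [Ring R] [Algebra ℂ R] [Ring A] [Algebra ℂ A] [Ring B] [Algebra ℂ B]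
  [Ring C] [Algebra ℂ C] {G : Type*} [Ring G] [Algebra ℂ G] (H : QuasiHopfAlgebra G)

/-- The opposite of the algebra of linear operators on `R`. -/
abbrev OpEnd (R : Type*) [Ring R] [Algebra ℂ R] := (Module.End ℂ R)ᵐᵒᵖ

/-- Application of an operator. -/
def act (X : OpEnd R) : R →ₗ[ℂ] R := X.unop

-- In the opposite algebra the left factor of a product acts first. Right multiplication, and left
-- multiplication twisted by the antimorphism `S⁻¹`, are then algebra maps and can serve as legs.
@[simp] lemma act_mul (X Y : OpEnd R) (y : R) : act (X * Y) y = act Y (act X y) := rfl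

@[simp] lemma act_one (y : R) : act (1 : OpEnd R) y = y := rfl

@[simp] lemma act_add (X Y : OpEnd R) (y : R) : act (X + Y) y = act X y + act Y y := rfl

@[simp] lemma act_zero (y : R) : act (0 : OpEnd R) y = 0 := rfl

/-- Right multiplication by the image of `f`. -/
def rop (f : A →ₐ[ℂ] R) : A →ₐ[ℂ] OpEnd R :=
  AlgHom.ofLinearMap ((MulOpposite.opLinearEquiv ℂ).toLinearMap ∘ₗ
    (LinearMap.mul ℂ R).flip ∘ₗ f.toLinearMap)
    (MulOpposite.unop_injective <| LinearMap.ext fun y => by simp)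
    (fun a b => MulOpposite.unop_injective <| LinearMap.ext fun y => by simp [mul_assoc])

@[simp] lemma act_rop (f : A →ₐ[ℂ] R) (a : A) (y : R) : act (rop f a) y = y * f a := rfl

/-- Left multiplication by `j(S⁻¹(g))`. -/
def lop (j : G →ₐ[ℂ] R) : G →ₐ[ℂ] OpEnd R :=
  AlgHom.ofLinearMap ((MulOpposite.opLinearEquiv ℂ).toLinearMap ∘ₗ
    LinearMap.mul ℂ R ∘ₗ j.toLinearMap ∘ₗ H.S.symm.toLinearMap)
    (MulOpposite.unop_injective <| LinearMap.ext fun y => by simp [H.symm_one])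
    (fun a b => MulOpposite.unop_injective <| LinearMap.ext fun y => by
      simp [H.symm_mul, mul_assoc])

@[simp] lemma act_lop (j : G →ₐ[ℂ] R) (g : G) (y : R) :
    act (lop H j g) y = j (H.S.symm g) * y := rfl

lemma act_ext {X Y : OpEnd R} (h : ∀ y, act X y = act Y y) : X = Y :=
  MulOpposite.unop_injective <| LinearMap.ext h

instance Comm.rop (f : A →ₐ[ℂ] R) (g : B →ₐ[ℂ] R) [Comm f g] : Comm (rop f) (rop g) :=
  ⟨fun a b => act_ext fun y => by simp [mul_assoc, (Comm.commute (f := f) (g := g) a b).eq]⟩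

/-- Left and right multiplications commute by associativity alone, so these legs may have the same
underlying copy of `G`. -/
instance Comm.rop_lop (f : A →ₐ[ℂ] R) (j : G →ₐ[ℂ] R) : Comm (QuasiHopf.rop f) (lop H j) :=
  ⟨fun a b => act_ext fun y => by simp [mul_assoc]⟩

lemma rop_tp (f : A →ₐ[ℂ] R) (g : B →ₐ[ℂ] R) [Comm f g] : tp (rop f) (rop g) = rop (tp f g) :=
  tp_ext fun a b => act_ext fun y => by simp [mul_assoc]

/-- Left multiplication by the image of `f`. -/
def lmu (f : A →ₐ[ℂ] R) : A →ₐ[ℂ] Module.End ℂ R := (Algebra.lmul ℂ R).comp f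

@[simp] lemma lmu_apply (f : A →ₐ[ℂ] R) (a : A) (y : R) : lmu f a y = f a * y := rfl

/-- Right multiplication by `j(S(g))`. -/
def rmS (j : G →ₐ[ℂ] R) : G →ₐ[ℂ] Module.End ℂ R :=
  AlgHom.ofLinearMap ((LinearMap.mul ℂ R).flip ∘ₗ j.toLinearMap ∘ₗ H.S.toLinearMap)
    (LinearMap.ext fun y => by simp [H.S_one])
    (fun a b => LinearMap.ext fun y => by simp [H.S_mul, mul_assoc])

@[simp] lemma rmS_apply (j : G →ₐ[ℂ] R) (g : G) (y : R) : rmS H j g y = y * j (H.S g) := rfl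

instance Comm.lmu (f : A →ₐ[ℂ] R) (g : B →ₐ[ℂ] R) [Comm f g] : Comm (lmu f) (lmu g) :=
  ⟨fun a b => LinearMap.ext fun y => by
    simp [← mul_assoc, (Comm.commute (f := f) (g := g) a b).eq]⟩

instance Comm.lmu_rmS (f : A →ₐ[ℂ] R) (j : G →ₐ[ℂ] R) : Comm (QuasiHopf.lmu f) (rmS H j) :=
  ⟨fun a b => LinearMap.ext fun y => by simp [mul_assoc]⟩

lemma lmu_tp (f : A →ₐ[ℂ] R) (g : B →ₐ[ℂ] R) [Comm f g] : tp (lmu f) (lmu g) = lmu (tp f g) :=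
  tp_ext fun a b => LinearMap.ext fun y => by simp [mul_assoc]

lemma tp_rop_lop_tmul (f : A →ₐ[ℂ] R) (j : G →ₐ[ℂ] R) (a : A) (g : G) (y : R) :
    act (tp (rop f) (lop H j) (a ⊗ₜ g)) y = j (H.S.symm g) * (y * f a) := by simp

/-- An element commuting with `j` can be pulled out to the left. -/
lemma act_mul_left (f : A →ₐ[ℂ] R) (j : G →ₐ[ℂ] R) {F : R} (hF : ∀ g, Commute F (j g))
    (t : A ⊗[ℂ] G) (y : R) :
    act (tp (rop f) (lop H j) t) (F * y) = F * act (tp (rop f) (lop H j) t) y := by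
  induction t with
  | zero => simp
  | tmul a g => simp only [tp_rop_lop_tmul, ← mul_assoc, (hF _).eq]
  | add t s ht hs => simp only [map_add, act_add, ht, hs, mul_add]

/-- An intertwining element can be pulled out to the right. -/
lemma act_mul_right {f f' : A →ₐ[ℂ] R} (j : G →ₐ[ℂ] R) {c : R} (hc : ∀ a, c * f a = f' a * c)
    (t : A ⊗[ℂ] G) (y : R) :
    act (tp (rop f) (lop H j) t) (y * c) = act (tp (rop f') (lop H j) t) y * c := by
  induction t with
  | zero => simp
  | tmul a g => simp only [tp_rop_lop_tmul, mul_assoc, hc]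
  | add t s ht hs => simp only [map_add, act_add, ht, hs, add_mul]

lemma tp₃_rop_lop_tmul (u : A →ₐ[ℂ] R) (f : B →ₐ[ℂ] R) [Comm u f] (j : G →ₐ[ℂ] R) (a : A)
    (t : B ⊗[ℂ] G) (y : R) :
    act (tp (rop u) (tp (rop f) (lop H j)) (a ⊗ₜ t)) y =
      act (tp (rop f) (lop H j) t) (y * u a) := by simp

lemma act₃_mul_left (u : A →ₐ[ℂ] R) (f : B →ₐ[ℂ] R) [Comm u f] (j : G →ₐ[ℂ] R) {F : R}
    (hF : ∀ g, Commute F (j g)) (t : A ⊗[ℂ] (B ⊗[ℂ] G)) (y : R) :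
    act (tp (rop u) (tp (rop f) (lop H j)) t) (F * y) =
      F * act (tp (rop u) (tp (rop f) (lop H j)) t) y := by
  induction t with
  | zero => simp
  | tmul a g => simp only [tp₃_rop_lop_tmul, mul_assoc, act_mul_left H f j hF]
  | add t s ht hs => simp only [map_add, act_add, ht, hs, mul_add]

lemma act₃_mul_right (u : A →ₐ[ℂ] R) {f f' : B →ₐ[ℂ] R} [Comm u f] [Comm u f'] (j : G →ₐ[ℂ] R)
    {c : R} (hu : ∀ a, Commute c (u a)) (hc : ∀ a, c * f a = f' a * c)
    (t : A ⊗[ℂ] (B ⊗[ℂ] G)) (y : R) :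
    act (tp (rop u) (tp (rop f) (lop H j)) t) (y * c) =
      act (tp (rop u) (tp (rop f') (lop H j)) t) y * c := by
  induction t with
  | zero => simp
  | tmul a g =>
    simp only [tp₃_rop_lop_tmul]
    rw [mul_assoc, (hu a).eq, ← mul_assoc, act_mul_right H j hc]
  | add t s ht hs => simp only [map_add, act_add, ht, hs, add_mul]

end Operators

/-! ### The element `q_ρ` and its identities. -/

section QRho

variable {R : Type*} [Ring R] [Algebra ℂ R] {G M : Type*} [Ring G] [Algebra ℂ G]
  [Ring M] [Algebra ℂ M] {H : QuasiHopfAlgebra G}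
  (P : QuasiCommutingPair H.toQuasiBialgebra M) (u j : G →ₐ[ℂ] R) (h : M →ₐ[ℂ] R)

/-- `q_ρ` with its legs placed in an algebra. -/
def qLeg [Comm h j] : R :=
  act (t3 (rop h) (rop j) (lop H j) P.φr : OpEnd R) (j (H.S.symm H.α))

/-- With its last leg acting on the left through `S⁻¹`, `φ_ρ` sends `S⁻¹(α)` to `q_ρ`. Identities of
`φ_ρ` with operator legs therefore yield identities of `q_ρ`. -/
lemma tp_qRhoOp [FiniteDimensional ℂ G] [Comm h j] : tp j h (qRhoOp H P) = qLeg P j h := by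
  have key : ∀ x : M ⊗[ℂ] (G ⊗[ℂ] G), tp j h (TensorProduct.comm ℂ M G
    (LinearMap.lTensor M
      (LinearMap.mul' ℂ G ∘ₗ
        TensorProduct.map (H.S.symm.toLinearMap ∘ₗ LinearMap.mulLeft ℂ H.α) LinearMap.id ∘ₗ
        (TensorProduct.comm ℂ G G).toLinearMap) x)) =
      act (tp (rop h) (tp (rop j) (lop H j)) x) (j (H.S.symm H.α)) := by
    intro x
    induction x with
    | zero => simp
    | add t s ht hs => simp only [map_add, act_add, ht, hs]
    | tmul a x =>
      induction x with
      | zero => simp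
      | add t s ht hs => simp only [TensorProduct.tmul_add, map_add, act_add, ht, hs]
      | tmul b c =>
        simp [H.symm_mul, mul_assoc, (Comm.commute (f := h) (g := j) a b).eq]
  exact key P.φr.val

/-- This is `S⁻¹` of the axiom for `α`: a coproduct spread over right multiplication and twisted
left multiplication collapses to a counit on `S⁻¹(α)`. -/
lemma act_mu_α (g : G) : act (mu H.toQuasiBialgebra (rop j) (lop H j) g) (j (H.S.symm H.α)) =
    H.counit g • j (H.S.symm H.α) := by
  have key : ∀ t : G ⊗[ℂ] G, act (tp (rop j) (lop H j) t) (j (H.S.symm H.α)) =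
      j (H.S.symm (LinearMap.mul' ℂ G
        (TensorProduct.map H.S.toLinearMap (LinearMap.mulLeft ℂ H.α) t))) := by
    intro t
    induction t with
    | zero => simp
    | tmul a b => simp [H.symm_mul, mul_assoc]
    | add t s ht hs => simp only [map_add, act_add, ht, hs]
  rw [AlgHom.comp_apply, key, H.antipode_left]
  simp

/-- The leg `X` acts on multiples of `v` like right multiplication by the leg `x`. -/
def ActsLike {A : Type*} [Ring A] [Algebra ℂ A] (j : G →ₐ[ℂ] R) (v : R) (X : A →ₐ[ℂ] OpEnd R)
    (x : A →ₐ[ℂ] R) : Prop :=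
  ∀ a y, (∀ g, Commute y (j g)) → act (X a) (v * y) = v * (y * x a)

lemma actsLike_mu : ActsLike j (j (H.S.symm H.α)) (mu H.toQuasiBialgebra (rop j) (lop H j))
    (triv H.counit) := by
  intro g y hy
  have := act_mul_left H j j hy (H.comul g) (j (H.S.symm H.α))
  rw [← (hy _).eq, AlgHom.comp_apply, this, ← AlgHom.comp_apply, act_mu_α]
  simp only [triv, Algebra.ofId_apply, Algebra.smul_def, Algebra.commutes, AlgHom.comp_apply]
  rw [← mul_assoc, (hy _).eq, mul_assoc]

lemma ActsLike.tp {A B : Type*} [Ring A] [Algebra ℂ A] [Ring B] [Algebra ℂ B] {v : R}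
    {X : A →ₐ[ℂ] OpEnd R} {x : A →ₐ[ℂ] R} (hX : ActsLike j v X x) (f : B →ₐ[ℂ] R) [Comm f j]
    [Comm f x] [Comm (rop f) X] : ActsLike j v (tp (rop f) X) (tp f x) := by
  intro t y hy
  induction t with
  | zero => simp
  | tmul a b =>
    rw [tp_tmul, act_mul, act_rop, mul_assoc, hX, tp_tmul, mul_assoc]
    exact fun g => (hy g).mul_left (Comm.commute a g)
  | add t s ht hs => simp only [map_add, act_add, ht, hs, mul_add]

lemma ra_rop [Comm h j] : ra P (rop h) (rop j) = rop (ra P h j) := by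
  rw [ra, rop_tp]; rfl

lemma la_rop [Comm j h] : la P (rop j) (rop h) = rop (la P j h) := by
  rw [la, rop_tp]; rfl

/-- `Σ (1 ⊗ S⁻¹(m₍₁₎)) q_ρ ρ(m₍₀₎) = (m ⊗ 1) q_ρ`. -/
lemma qLeg_rho [Comm h j] (m : M) :
    act (tp (rop (ra P h j)) (lop H j) (P.rho m)) (qLeg P j h) = h m * qLeg P j h := by
  -- Coassociativity of `ρ` with operator legs, applied to `S⁻¹(α)`; the coproduct on the right-hand
  -- side becomes a counit.
  have e := rho_coassoc_legs P (rop j) (lop H j) (rop h) m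
  have e' := congrArg (fun X => act X (j (H.S.symm H.α))) e
  simp only [act_mul, ra_rop] at e'
  have e1 : act (ra P (rop h) (mu H.toQuasiBialgebra (rop j) (lop H j)) m) (j (H.S.symm H.α)) =
      h m * j (H.S.symm H.α) := by
    have := (actsLike_mu (H := H) j).tp j h (P.rho m) 1 (fun g => Commute.one_left _)
    rw [mul_one] at this
    rw [AlgHom.comp_apply, this, one_mul, tp_triv_right, P.rho_counit]
    exact (Comm.commute _ _).symm
  rw [e1, t3_val, act₃_mul_left H h j j (fun g => Comm.commute _ _)] at e'
  exact e'

/-- The compatibility of `q_ρ` with `λ`. -/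
lemma qLeg_la [Comm h j] [Comm u h] [Comm u j] :
    act (t3 (rop u) (rop (ra P h j)) (lop H j) P.φlr : OpEnd R) (qLeg P j h) * t3 u h j P.φlr =
      qLeg P j (la P u h) := by
  -- The mixed pentagon is applied to `S⁻¹(α)`. Its factor containing `Δ` becomes a `φ_λρ` with a
  -- counit leg, which is trivial.
  have e := congrArg Units.val
    (mixed_pentagon_rho_legs P (rop u) (rop j) (lop H j) (rop h))
  have e' := congrArg (fun X => act X (j (H.S.symm H.α))) e
  simp only [Units.val_mul, act_mul, ra_rop, la_rop] at e'
  have e1 : act (t3 (rop u) (rop h) (mu H.toQuasiBialgebra (rop j) (lop H j)) P.φlr : OpEnd R)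
      (j (H.S.symm H.α)) = j (H.S.symm H.α) := by
    have := ((actsLike_mu (H := H) j).tp j h).tp j u P.φlr.val 1 (fun g => Commute.one_left _)
    have h2 := congrArg Units.val (φlr_triv_right P h u)
    rw [t3_val] at h2
    rw [t3_val, ← mul_one (j _), this, h2, Units.val_one, mul_one]
  have e2 : ∀ y, act (t3 (rop u) (rop h) (rop j) P.φlr : OpEnd R) y = y * t3 u h j P.φlr := by
    intro y
    simp only [t3_val, rop_tp, act_rop]
  rw [e1, e2] at e'
  exact e'

end QRho

end QuasiHopf

end

noncomputable section

namespace QuasiHopf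

set_option maxSynthPendingDepth 6

/-! ### The element `p_ρ`, inverse to `q_ρ` in the twisted sense. -/

section PRho

variable {R : Type*} [Ring R] [Algebra ℂ R] {G M : Type*} [Ring G] [Algebra ℂ G]
  [Ring M] [Algebra ℂ M] {H : QuasiHopfAlgebra G}
  (P : QuasiCommutingPair H.toQuasiBialgebra M) (u j : G →ₐ[ℂ] R) (h : M →ₐ[ℂ] R)

/-- `p_ρ` with its legs placed in an algebra. -/
def pLeg [Comm h j] : R :=
  (((t3 (lmu h) (lmu j) (rmS H j) P.φr)⁻¹ : (Module.End ℂ R)ˣ) : Module.End ℂ R) (j H.β)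

/-- `p_ρ = P ⊗ Q β S(R)`, where `φ_ρ⁻¹ = P ⊗ Q ⊗ R`. -/
def pRho (P : QuasiCommutingPair H.toQuasiBialgebra M) : M ⊗[ℂ] G :=
  LinearMap.lTensor M (LinearMap.mul' ℂ G ∘ₗ
    TensorProduct.map (LinearMap.mulRight ℂ H.β) H.S.toLinearMap) P.φr⁻¹.val

lemma tp_pRho [Comm h j] : tp h j (pRho P) = pLeg P j h := by
  have key : ∀ x : M ⊗[ℂ] (G ⊗[ℂ] G), tp h j
    (LinearMap.lTensor M
      (LinearMap.mul' ℂ G ∘ₗ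
        TensorProduct.map (LinearMap.mulRight ℂ H.β) H.S.toLinearMap) x) =
      tp (lmu h) (tp (lmu j) (rmS H j)) x (j H.β) := by
    intro x
    induction x with
    | zero => simp
    | add t s ht hs => simp only [map_add, LinearMap.add_apply, ht, hs]
    | tmul a x =>
      induction x with
      | zero => simp
      | add t s ht hs =>
        simp only [TensorProduct.tmul_add, map_add, LinearMap.add_apply, ht, hs]
      | tmul b c => simp [mul_assoc]
  exact key P.φr⁻¹.val

/-- The axiom for `β` in operator form. Here left multiplication and right multiplication through
`S` are the legs, so ordinary endomorphisms suffice. -/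
lemma mu_β (g : G) (y : R) (hy : ∀ g, Commute y (j g)) :
    mu H.toQuasiBialgebra (lmu j) (rmS H j) g (j H.β * y) = j H.β * (triv H.counit g * y) := by
  have key : ∀ t : G ⊗[ℂ] G, tp (lmu j) (rmS H j) t (j H.β * y) =
      j (LinearMap.mul' ℂ G
        (TensorProduct.map (LinearMap.mulRight ℂ H.β) H.S.toLinearMap t)) * y := by
    intro t
    induction t with
    | zero => simp
    | tmul a b => simp [mul_assoc, (hy _).eq]
    | add t s ht hs => simp only [map_add, LinearMap.add_apply, ht, hs, add_mul]
  rw [AlgHom.comp_apply, key, H.antipode_right]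
  rw [map_smul, smul_mul_assoc, triv, AlgHom.comp_apply, Algebra.ofId_apply, ← Algebra.smul_def,
    mul_smul_comm]

lemma tp_lmu_acts {A B : Type*} [Ring A] [Algebra ℂ A] [Ring B] [Algebra ℂ B] {v : R}
    {X : A →ₐ[ℂ] Module.End ℂ R} {x : A →ₐ[ℂ] R}
    (hX : ∀ a y, (∀ g, Commute y (j g)) → X a (v * y) = v * (x a * y)) (f : B →ₐ[ℂ] R) [Comm f j]
    [Comm f x] [Comm (lmu f) X] (hv : ∀ b, Commute v (f b)) (t : B ⊗[ℂ] A) (y : R)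
    (hy : ∀ g, Commute y (j g)) : tp (lmu f) X t (v * y) = v * (tp f x t * y) := by
  induction t with
  | zero => simp
  | tmul b a =>
    rw [tp_tmul, Module.End.mul_apply, hX a y hy, lmu_apply, ← mul_assoc, ← (hv b).eq, tp_tmul]
    simp only [mul_assoc]
  | add t s ht hs => simp only [map_add, LinearMap.add_apply, ht, hs, mul_add, add_mul]

lemma ra_lmu [Comm h j] : ra P (lmu h) (lmu j) = lmu (ra P h j) := by
  rw [ra, lmu_tp]; rfl

lemma lmu_rmS_mul_right {A : Type*} [Ring A] [Algebra ℂ A] (f : A →ₐ[ℂ] R) {c : R}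
    (hc : ∀ g, Commute c (j g)) (t : A ⊗[ℂ] G) (y : R) :
    tp (lmu f) (rmS H j) t (y * c) = tp (lmu f) (rmS H j) t y * c := by
  induction t with
  | zero => simp
  | tmul a b => simp [mul_assoc, (hc _).eq]
  | add t s ht hs => simp only [map_add, LinearMap.add_apply, ht, hs, add_mul]

lemma lmu_lmu_rmS_mul_right {A B : Type*} [Ring A] [Algebra ℂ A] [Ring B] [Algebra ℂ B]
    (f : A →ₐ[ℂ] R) (k : B →ₐ[ℂ] R) [Comm k f] {c : R}
    (hc : ∀ g, Commute c (j g)) (t : B ⊗[ℂ] (A ⊗[ℂ] G)) (y : R) :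
    tp (lmu k) (tp (lmu f) (rmS H j)) t (y * c) =
      tp (lmu k) (tp (lmu f) (rmS H j)) t y * c := by
  induction t with
  | zero => simp
  | tmul a b =>
    rw [tp_tmul, Module.End.mul_apply, Module.End.mul_apply, lmu_rmS_mul_right j f hc, lmu_apply,
      lmu_apply, mul_assoc]
  | add t s ht hs => simp only [map_add, LinearMap.add_apply, ht, hs, add_mul]

/-- `Σ ρ(m₍₀₎) p_ρ (1 ⊗ S(m₍₁₎)) = p_ρ (m ⊗ 1)`. -/
lemma pLeg_rho [Comm h j] (m : M) :
    tp (lmu (ra P h j)) (rmS H j) (P.rho m) (pLeg P j h) = pLeg P j h * h m := by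
  -- As for `q_ρ`, but with `φ_ρ⁻¹` acting on `β`; the relation must first be solved for the
  -- inverse.
  have e := rho_coassoc_legs P (lmu j) (rmS H j) (lmu h) m
  rw [← Units.eq_inv_mul_iff_mul_eq, ← mul_assoc, ← Units.mul_inv_eq_iff_eq_mul] at e
  have e' := congrArg (fun X : Module.End ℂ R => X (j H.β)) e
  simp only [Module.End.mul_apply, ra_lmu] at e'
  have e1 : ra P (lmu h) (mu H.toQuasiBialgebra (lmu j) (rmS H j)) m (j H.β) =
      j H.β * h m := by
    have := tp_lmu_acts j (mu_β (H := H) j) h (fun b => Comm.commute _ _) (P.rho m) 1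
      (fun g => Commute.one_left _)
    rwa [mul_one, mul_one, tp_triv_right, P.rho_counit] at this
  rw [e1, t3_inv_val, lmu_lmu_rmS_mul_right j j h (fun g => Comm.commute _ _)] at e'
  exact e'

/-- The functional `x ⊗ y ⊗ z ⊗ w ↦ x y β S(z) α w`. -/
def betaForm (H : QuasiHopfAlgebra G) (j : G →ₐ[ℂ] R) (h : M →ₐ[ℂ] R) :
    M ⊗[ℂ] (G ⊗[ℂ] (G ⊗[ℂ] G)) →ₗ[ℂ] R :=
  LinearMap.mul' ℂ R ∘ₗ TensorProduct.map h.toLinearMap (LinearMap.mul' ℂ R ∘ₗ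
    TensorProduct.map (LinearMap.mulRight ℂ (j H.β) ∘ₗ j.toLinearMap) (LinearMap.mul' ℂ R ∘ₗ
      TensorProduct.map (LinearMap.mulRight ℂ (j H.α) ∘ₗ j.toLinearMap ∘ₗ H.S.toLinearMap)
        j.toLinearMap))

lemma betaForm_tmul (x : M) (y z w : G) : betaForm H j h (x ⊗ₜ[ℂ] (y ⊗ₜ[ℂ] (z ⊗ₜ[ℂ] w))) =
    h x * (j y * j H.β * (j (H.S z) * j H.α * j w)) := by simp [betaForm]

/-- A coproduct on the last two legs surrounds `α` as `S(r₁) α r₂` and collapses to a counit;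
`betaForm_peel_right` does the same for `β`. -/
lemma betaForm_peel_left [Comm h j] (t : M ⊗[ℂ] (G ⊗[ℂ] G)) (Y : M ⊗[ℂ] (G ⊗[ℂ] (G ⊗[ℂ] G))) :
    betaForm H j h (onRight (onRight H.comul) t * Y) =
      tp h j (onRight (killRight H.counit) t) * betaForm H j h Y := by
  induction Y using TensorProduct.induction_on with
  | zero => simp
  | add a b ha hb => simp only [mul_add, map_add, ha, hb]
  | tmul x Y =>
  induction Y using TensorProduct.induction_on with
  | zero => simp
  | add a b ha hb => simp only [TensorProduct.tmul_add, mul_add, map_add, ha, hb]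
  | tmul y Y =>
  induction Y using TensorProduct.induction_on with
  | zero => simp
  | add a b ha hb => simp only [TensorProduct.tmul_add, mul_add, map_add, ha, hb]
  | tmul z w =>
  induction t using TensorProduct.induction_on with
  | zero => simp
  | add a b ha hb => simp only [add_mul, map_add, ha, hb]
  | tmul p t =>
  induction t using TensorProduct.induction_on with
  | zero => simp
  | add a b ha hb => simp only [TensorProduct.tmul_add, add_mul, map_add, ha, hb]
  | tmul q r =>
  have key : ∀ s : G ⊗[ℂ] G,
      betaForm H j h ((p ⊗ₜ[ℂ] (q ⊗ₜ[ℂ] s)) * (x ⊗ₜ[ℂ] (y ⊗ₜ[ℂ] (z ⊗ₜ[ℂ] w)))) =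
      h (p * x) * (j (q * y) * j H.β * (j (H.S z) * j (LinearMap.mul' ℂ G
        (TensorProduct.map H.S.toLinearMap (LinearMap.mulLeft ℂ H.α) s)) * j w)) := by
    intro s
    induction s using TensorProduct.induction_on with
    | zero => simp
    | add a b ha hb => simp only [TensorProduct.tmul_add, add_mul, mul_add, map_add, ha, hb]
    | tmul a b => simp [betaForm_tmul, H.S_mul, mul_assoc]
  rw [onRight_tmul, onRight_tmul, key, H.antipode_left, onRight_tmul, killRight_tmul, betaForm_tmul]
  have := (Comm.commute (f := h) (g := j) x q).eq
  simp only [map_smul, map_mul, tp_tmul, mul_smul_comm, smul_mul_assoc, mul_assoc]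
  rw [← mul_assoc (h x) (j q), this, mul_assoc]

lemma betaForm_peel_right [Comm h j] (t : M ⊗[ℂ] (G ⊗[ℂ] G)) (Y : G ⊗[ℂ] (G ⊗[ℂ] G)) :
    betaForm H j h (oneTmul Y * onRight (onLeft H.comul) t) =
      betaForm H j h (oneTmul Y) * tp h j (onRight (killLeft H.counit) t) := by
  induction Y using TensorProduct.induction_on with
  | zero => simp
  | add a b ha hb => simp only [add_mul, map_add, ha, hb]
  | tmul y Y =>
  induction Y using TensorProduct.induction_on with
  | zero => simp
  | add a b ha hb => simp only [TensorProduct.tmul_add, add_mul, map_add, ha, hb]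
  | tmul z w =>
  induction t using TensorProduct.induction_on with
  | zero => simp
  | add a b ha hb => simp only [mul_add, map_add, ha, hb]
  | tmul p t =>
  induction t using TensorProduct.induction_on with
  | zero => simp
  | add a b ha hb => simp only [TensorProduct.tmul_add, mul_add, map_add, ha, hb]
  | tmul q r =>
  have key : ∀ s : G ⊗[ℂ] G,
      betaForm H j h (((1 : M) ⊗ₜ[ℂ] (y ⊗ₜ[ℂ] (z ⊗ₜ[ℂ] w))) *
        (p ⊗ₜ[ℂ] Algebra.TensorProduct.assoc ℂ ℂ ℂ G G G (s ⊗ₜ[ℂ] r))) =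
      h p * (j y * (j (LinearMap.mul' ℂ G
        (TensorProduct.map (LinearMap.mulRight ℂ H.β) H.S.toLinearMap s))) *
          (j (H.S z) * j H.α * j (w * r))) := by
    intro s
    induction s using TensorProduct.induction_on with
    | zero => simp
    | add a b ha hb =>
      simp only [TensorProduct.tmul_add, TensorProduct.add_tmul, add_mul, mul_add, map_add, ha, hb]
    | tmul a b => simp [betaForm_tmul, H.S_mul, mul_assoc]
  rw [onRight_tmul, onLeft_tmul, oneTmul, Algebra.TensorProduct.includeRight_apply, key,
    H.antipode_right, onRight_tmul, killLeft_tmul, betaForm_tmul]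
  have := fun b => (Comm.commute (f := h) (g := j) p b).eq
  simp only [map_smul, map_mul, map_one, one_mul, tp_tmul, mul_smul_comm, smul_mul_assoc, mul_assoc]
  simp only [← mul_assoc, this]
  simp only [mul_assoc, this]

/-- `Σ q_ρ¹₍₀₎ p_ρ (1 ⊗ S(q_ρ²)) = 1`. -/
lemma qRhoOp_pLeg [FiniteDimensional ℂ G] [Comm h j] :
    tp (rmS H j) (lmu (ra P h j)) (qRhoOp H P) (pLeg P j h) = 1 := by
  have key : ∀ x y : M ⊗[ℂ] (G ⊗[ℂ] G), tp (rmS H j) (lmu (ra P h j)) (TensorProduct.comm ℂ M G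
    (LinearMap.lTensor M
      (LinearMap.mul' ℂ G ∘ₗ
        TensorProduct.map (H.S.symm.toLinearMap ∘ₗ LinearMap.mulLeft ℂ H.α) LinearMap.id ∘ₗ
        (TensorProduct.comm ℂ G G).toLinearMap) x)) (tp (lmu h) (tp (lmu j) (rmS H j)) y (j H.β)) =
      betaForm H j h (onLeft P.rho x * tmulOne (E := G) y) := by
    intro x y
    induction y using TensorProduct.induction_on with
    | zero => simp
    | add a b ha hb => simp only [mul_add, map_add, LinearMap.add_apply, ha, hb]
    | tmul p y =>
    induction y using TensorProduct.induction_on with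
    | zero => simp
    | add a b ha hb =>
      simp only [TensorProduct.tmul_add, mul_add, map_add, LinearMap.add_apply, ha, hb]
    | tmul q r =>
    induction x using TensorProduct.induction_on with
    | zero => simp
    | add a b ha hb => simp only [add_mul, map_add, LinearMap.add_apply, ha, hb]
    | tmul a x =>
    induction x using TensorProduct.induction_on with
    | zero => simp
    | add a b ha hb =>
      simp only [TensorProduct.tmul_add, add_mul, map_add, LinearMap.add_apply, ha, hb]
    | tmul b c =>
    simp only [LinearMap.lTensor_tmul, TensorProduct.comm_tmul, tp_tmul, onLeft_tmul,
      lmu_apply, AlgHom.comp_apply, Module.End.mul_apply]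
    generalize P.rho a = s
    induction s using TensorProduct.induction_on with
    | zero => simp
    | add a b ha hb =>
      simp only [TensorProduct.add_tmul, add_mul, map_add, LinearMap.add_apply, ha, hb]
    | tmul s t =>
      have := (Comm.commute (f := h) (g := j) p t).eq
      simp [betaForm_tmul, tmulOne, leg12, onRight_tmul, H.S_mul, mul_assoc]
      rw [← mul_assoc (j t) (h p), ← this, mul_assoc]
  refine (key P.φr.val (P.φr⁻¹).val).trans ?_
  -- The pentagon of `φ_ρ` is solved so that both outer factors contain a coproduct. The form turns
  -- these into counits, and only `1 ⊗ φ` is left in the middle.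
  have e : onLeft P.rho P.φr.val * tmulOne (E := G) (P.φr⁻¹).val =
      onRight (onRight H.comul) (P.φr⁻¹).val * (oneTmul H.reassoc.val *
        onRight (onLeft H.comul) P.φr.val) := by
    have := P.rho_pentagon
    have h1 : tmulOne (E := G) P.φr.val * tmulOne (P.φr⁻¹).val = 1 := by
      rw [← map_mul, Units.mul_inv, map_one]
    have h2 : onRight (A := M) (onRight H.comul) (P.φr⁻¹).val *
      onRight (onRight H.comul) P.φr.val = 1 := by
      rw [← map_mul, Units.inv_mul, map_one]
    calc _ = onRight (A := M) (onRight H.comul) (P.φr⁻¹).val *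
          (onRight (onRight H.comul) P.φr.val * onLeft P.rho P.φr.val) * tmulOne (P.φr⁻¹).val := by
          rw [← mul_assoc, h2, one_mul]
      _ = _ := by rw [← this]; simp only [mul_assoc, h1, mul_one]
  rw [e, betaForm_peel_left, betaForm_peel_right, P.φr_counit_mid]
  have h3 : onRight (A := M) (killRight (A := G) H.counit) (P.φr⁻¹).val = 1 := by
    have := P.φr⁻¹.mul_inv
    have h4 := congrArg (onRight (A := M) (killRight (A := G) H.counit)) this
    rwa [map_mul, inv_inv, P.φr_counit_right, mul_one, map_one] at h4
  -- On `1 ⊗ φ` the form gives `X β S(Y) α Z`, which is `1` by an antipode axiom.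
  have h4 : ∀ y : G ⊗[ℂ] (G ⊗[ℂ] G), betaForm H j h (oneTmul y) =
      j (LinearMap.mul' ℂ G (TensorProduct.map (LinearMap.mulRight ℂ H.β)
      (LinearMap.mul' ℂ G ∘ₗ
        TensorProduct.map (LinearMap.mulRight ℂ H.α ∘ₗ H.S.toLinearMap) LinearMap.id) y)) := by
    intro y
    induction y using TensorProduct.induction_on with
    | zero => simp
    | add a b ha hb => simp only [map_add, ha, hb]
    | tmul p y =>
    induction y using TensorProduct.induction_on with
    | zero => simp
    | add a b ha hb => simp only [TensorProduct.tmul_add, map_add, ha, hb]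
    | tmul q r => simp [oneTmul, betaForm_tmul]
  rw [h3, h4, H.antipode_reassoc]
  simp

/-- The functional `x ⊗ y ⊗ z ⊗ w ↦ w S⁻¹(β) S⁻¹(z) S⁻¹(α) x y`. -/
def alphaForm (H : QuasiHopfAlgebra G) (j : G →ₐ[ℂ] R) (h : M →ₐ[ℂ] R) [Comm h j] :
    M ⊗[ℂ] (G ⊗[ℂ] (G ⊗[ℂ] G)) →ₗ[ℂ] R :=
  LinearMap.mul' ℂ R ∘ₗ (TensorProduct.comm ℂ R R).toLinearMap ∘ₗ
  TensorProduct.map (tp h j).toLinearMap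
    (LinearMap.mul' ℂ R ∘ₗ (TensorProduct.comm ℂ R R).toLinearMap ∘ₗ
      TensorProduct.map (LinearMap.mulRight ℂ (j (H.S.symm H.α)) ∘ₗ j.toLinearMap ∘ₗ
        H.S.symm.toLinearMap) (LinearMap.mulRight ℂ (j (H.S.symm H.β)) ∘ₗ j.toLinearMap)) ∘ₗ
  (TensorProduct.assoc ℂ M G (G ⊗[ℂ] G)).symm.toLinearMap

lemma alphaForm_tmul [Comm h j] (x : M) (y z w : G) :
    alphaForm H j h (x ⊗ₜ[ℂ] (y ⊗ₜ[ℂ] (z ⊗ₜ[ℂ] w))) =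
    j w * j (H.S.symm H.β) * (j (H.S.symm z) * j (H.S.symm H.α)) * (h x * j y) := by
  simp [alphaForm]

/-- Here `S⁻¹(q₂) S⁻¹(α) q₁` appears, which is `S⁻¹` of the axiom for `α`; `alphaForm_peel_right`
uses the axiom for `β`. -/
lemma alphaForm_peel_left [Comm h j] (t : M ⊗[ℂ] (G ⊗[ℂ] G)) (Y : M ⊗[ℂ] (G ⊗[ℂ] (G ⊗[ℂ] G))) :
    alphaForm H j h (onRight (onLeft H.comul) t * Y) =
      tp h j (onRight (killLeft H.counit) t) * alphaForm H j h Y := by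
  induction Y using TensorProduct.induction_on with
  | zero => simp
  | add a b ha hb => simp only [mul_add, map_add, ha, hb]
  | tmul x Y =>
  induction Y using TensorProduct.induction_on with
  | zero => simp
  | add a b ha hb => simp only [TensorProduct.tmul_add, mul_add, map_add, ha, hb]
  | tmul y Y =>
  induction Y using TensorProduct.induction_on with
  | zero => simp
  | add a b ha hb => simp only [TensorProduct.tmul_add, mul_add, map_add, ha, hb]
  | tmul z w =>
  induction t using TensorProduct.induction_on with
  | zero => simp
  | add a b ha hb => simp only [add_mul, map_add, ha, hb]
  | tmul p t =>
  induction t using TensorProduct.induction_on with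
  | zero => simp
  | add a b ha hb => simp only [TensorProduct.tmul_add, add_mul, map_add, ha, hb]
  | tmul q r =>
  have hp := fun b => (Comm.commute (f := h) (g := j) p b).eq
  have hpx := fun b => (Comm.commute (f := h) (g := j) (p * x) b).eq
  have key : ∀ s : G ⊗[ℂ] G,
      alphaForm H j h ((p ⊗ₜ[ℂ] Algebra.TensorProduct.assoc ℂ ℂ ℂ G G G (s ⊗ₜ[ℂ] r)) *
        (x ⊗ₜ[ℂ] (y ⊗ₜ[ℂ] (z ⊗ₜ[ℂ] w)))) =
      j (r * w) * j (H.S.symm H.β) * (j (H.S.symm z) * j (H.S.symm (LinearMap.mul' ℂ G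
        (TensorProduct.map H.S.toLinearMap (LinearMap.mulLeft ℂ H.α) s)))) *
        (h (p * x) * j y) := by
    intro s
    induction s using TensorProduct.induction_on with
    | zero => simp
    | add a b ha hb =>
      simp only [TensorProduct.tmul_add, TensorProduct.add_tmul, add_mul, mul_add, map_add, ha, hb]
    | tmul a b =>
      have : h p * (h x * (j a * j y)) = j a * (h p * (h x * j y)) := by
        simp only [← mul_assoc, ← map_mul, hpx]
      simp [alphaForm_tmul, H.symm_mul, mul_assoc, this]
  rw [onRight_tmul, onLeft_tmul, key, H.antipode_left, onRight_tmul, killLeft_tmul, alphaForm_tmul]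
  simp only [map_smul, map_mul, tp_tmul, mul_smul_comm, smul_mul_assoc, TensorProduct.tmul_smul]
  congr 1
  rw [hp]
  simp only [mul_assoc]
  simp only [← mul_assoc (h p) (j _), hp]
  simp only [mul_assoc]
  simp only [← mul_assoc (h p) (j _), hp]
  simp only [mul_assoc]
  simp only [← mul_assoc (h p) (j _), hp]
  simp only [mul_assoc]
  simp only [← mul_assoc (h p) (j _), hp]
  simp only [mul_assoc]

lemma alphaForm_peel_right [Comm h j] (t : M ⊗[ℂ] (G ⊗[ℂ] G)) (Y : G ⊗[ℂ] (G ⊗[ℂ] G)) :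
    alphaForm H j h (oneTmul Y * onRight (onRight H.comul) t) =
      alphaForm H j h (oneTmul Y) * tp h j (onRight (killRight H.counit) t) := by
  induction Y using TensorProduct.induction_on with
  | zero => simp
  | add a b ha hb => simp only [add_mul, map_add, ha, hb]
  | tmul y Y =>
  induction Y using TensorProduct.induction_on with
  | zero => simp
  | add a b ha hb => simp only [TensorProduct.tmul_add, add_mul, map_add, ha, hb]
  | tmul z w =>
  induction t using TensorProduct.induction_on with
  | zero => simp
  | add a b ha hb => simp only [mul_add, map_add, ha, hb]
  | tmul p t =>
  induction t using TensorProduct.induction_on with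
  | zero => simp
  | add a b ha hb => simp only [TensorProduct.tmul_add, mul_add, map_add, ha, hb]
  | tmul q r =>
  have key : ∀ s : G ⊗[ℂ] G,
      alphaForm H j h (((1 : M) ⊗ₜ[ℂ] (y ⊗ₜ[ℂ] (z ⊗ₜ[ℂ] w))) * (p ⊗ₜ[ℂ] (q ⊗ₜ[ℂ] s))) =
      j w * j (H.S.symm (LinearMap.mul' ℂ G
        (TensorProduct.map (LinearMap.mulRight ℂ H.β) H.S.toLinearMap s))) *
        (j (H.S.symm z) * j (H.S.symm H.α)) * (h p * j (y * q)) := by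
    intro s
    induction s using TensorProduct.induction_on with
    | zero => simp
    | add a b ha hb =>
      simp only [TensorProduct.tmul_add, add_mul, mul_add, map_add, ha, hb]
    | tmul a b => simp [alphaForm_tmul, H.symm_mul, mul_assoc]
  rw [onRight_tmul, onRight_tmul, oneTmul, Algebra.TensorProduct.includeRight_apply, key,
    H.antipode_right, onRight_tmul, killRight_tmul, alphaForm_tmul]
  have hp := (Comm.commute (f := h) (g := j) p y).eq
  simp only [map_smul, map_mul, map_one, one_mul, tp_tmul, mul_smul_comm, smul_mul_assoc,
    TensorProduct.tmul_smul]
  congr 1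
  simp only [mul_assoc]
  rw [← mul_assoc (h p), hp, mul_assoc]

/-- `Σ (1 ⊗ S⁻¹(p_ρ²)) q_ρ p_ρ¹₍₀₎ = 1`. -/
lemma pRho_qLeg [Comm h j] :
    act (tp (rop (ra P h j)) (lop H j) (pRho P)) (qLeg P j h) = 1 := by
  have key : ∀ x y : M ⊗[ℂ] (G ⊗[ℂ] G), act (tp (rop (ra P h j)) (lop H j)
    (LinearMap.lTensor M (LinearMap.mul' ℂ G ∘ₗ
      TensorProduct.map (LinearMap.mulRight ℂ H.β) H.S.toLinearMap) y))
        (act (tp (rop h) (tp (rop j) (lop H j)) x) (j (H.S.symm H.α))) =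
      alphaForm H j h (tmulOne (E := G) x * onLeft P.rho y) := by
    intro x y
    induction x using TensorProduct.induction_on with
    | zero => simp
    | add a b ha hb => simp only [add_mul, map_add, act_add, ha, hb]
    | tmul a x =>
    induction x using TensorProduct.induction_on with
    | zero => simp
    | add a b ha hb =>
      simp only [TensorProduct.tmul_add, add_mul, map_add, act_add, ha, hb]
    | tmul b c =>
    induction y using TensorProduct.induction_on with
    | zero => simp
    | add a b ha hb => simp only [mul_add, map_add, act_add, ha, hb]
    | tmul p y =>
    induction y using TensorProduct.induction_on with
    | zero => simp
    | add a b ha hb =>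
      simp only [TensorProduct.tmul_add, mul_add, map_add, act_add, ha, hb]
    | tmul q r =>
    simp only [LinearMap.lTensor_tmul, tp_tmul, onLeft_tmul, act_rop, act_lop, act_mul,
      AlgHom.comp_apply]
    generalize P.rho p = s
    induction s using TensorProduct.induction_on with
    | zero => simp
    | add a b ha hb =>
      simp only [TensorProduct.add_tmul, mul_add, map_add, ha, hb]
    | tmul s t =>
      have := (Comm.commute (f := h) (g := j) s b).eq
      have h2 := (Comm.commute (f := h) (g := j) a (H.S.symm H.α)).eq
      simp [alphaForm_tmul, tmulOne, leg12, onRight_tmul, H.symm_mul, mul_assoc]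
      rw [← mul_assoc (j b) (h s), ← this, mul_assoc]
  refine (key P.φr.val (P.φr⁻¹).val).trans ?_
  -- The same pentagon in another form, now with `1 ⊗ φ⁻¹` in the middle. There the form gives `S⁻¹`
  -- of `S(P) α Q β S(R) = 1`.
  have e : tmulOne (E := G) P.φr.val * onLeft P.rho (P.φr⁻¹).val =
      onRight (onLeft H.comul) (P.φr⁻¹).val * (oneTmul H.reassoc⁻¹.val *
        onRight (onRight H.comul) P.φr.val) := by
    have := P.rho_pentagon
    have h1 : onLeft (E := G ⊗[ℂ] G) P.rho P.φr.val * onLeft P.rho (P.φr⁻¹).val = 1 := by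
      rw [← map_mul, Units.mul_inv, map_one]
    have h2 : onRight (A := M) (onLeft (E := G) H.comul) (P.φr⁻¹).val *
      onRight (onLeft H.comul) P.φr.val = 1 := by
      rw [← map_mul, Units.inv_mul, map_one]
    have h3 : oneTmul (A := M) H.reassoc⁻¹.val * oneTmul H.reassoc.val = 1 := by
      rw [← map_mul, Units.inv_mul, map_one]
    calc _ = onRight (A := M) (onLeft (E := G) H.comul) (P.φr⁻¹).val *
          (oneTmul H.reassoc⁻¹.val * ((oneTmul H.reassoc.val * onRight (onLeft H.comul) P.φr.val *
            tmulOne (E := G) P.φr.val) * onLeft P.rho (P.φr⁻¹).val)) := by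
          simp only [← mul_assoc]
          rw [mul_assoc (onRight _ _) (oneTmul _) (oneTmul _), h3, mul_one, h2, one_mul]
      _ = _ := by rw [this]; simp only [mul_assoc, h1, mul_one]
  rw [e, alphaForm_peel_left, alphaForm_peel_right, P.φr_counit_right]
  have h3 : onRight (A := M) (killLeft (B := G) H.counit) (P.φr⁻¹).val = 1 := by
    have := P.φr⁻¹.mul_inv
    have h4 := congrArg (onRight (A := M) (killLeft (B := G) H.counit)) this
    rwa [map_mul, inv_inv, P.φr_counit_mid, mul_one, map_one] at h4
  have h4 : ∀ y : G ⊗[ℂ] (G ⊗[ℂ] G), alphaForm H j h (oneTmul y) =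
      j (H.S.symm (LinearMap.mul' ℂ G (TensorProduct.map (LinearMap.mulRight ℂ H.α ∘ₗ
        H.S.toLinearMap) (LinearMap.mul' ℂ G ∘ₗ TensorProduct.map (LinearMap.mulRight ℂ H.β)
          H.S.toLinearMap) y))) := by
    intro y
    induction y using TensorProduct.induction_on with
    | zero => simp
    | add a b ha hb => simp only [map_add, ha, hb]
    | tmul p y =>
    induction y using TensorProduct.induction_on with
    | zero => simp
    | add a b ha hb => simp only [TensorProduct.tmul_add, map_add, ha, hb]
    | tmul q r => simp [oneTmul, alphaForm_tmul, H.symm_mul, mul_assoc]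
  rw [h3, h4, H.antipode_reassoc_inv]
  simp [H.symm_one]

end PRho

end QuasiHopf

end

noncomputable section

namespace QuasiHopf

/-! ### Intertwiners versus solutions of the twisted bimodule equation. -/

section Bimodule

variable {R : Type*} [Ring R] [Algebra ℂ R] {G M : Type*} [Ring G] [Algebra ℂ G]
  [Ring M] [Algebra ℂ M] {H : QuasiHopfAlgebra G}
  (P : QuasiCommutingPair H.toQuasiBialgebra M) (u j : G →ₐ[ℂ] R) (h : M →ₐ[ℂ] R)

-- Multiplication by `q_ρ` turns the intertwining property, in which `ρ` appears on the left, into a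
-- formula for plain left multiplication by `m`.
variable {P j h} in
lemma act_rho_qLeg_mul [Comm h j] {k : M →ₐ[ℂ] R} {c : R}
    (hc : ∀ m, c * k m = ra P h j m * c) (m : M) :
    act (tp (rop k) (lop H j) (P.rho m)) (qLeg P j h * c) = h m * (qLeg P j h * c) := by
  rw [act_mul_right H j hc, qLeg_rho, mul_assoc]

variable {P j h} in
/-- An intertwiner is recovered from its product with `q_ρ`. -/
lemma act_pRho_qLeg_mul [Comm h j] {k : M →ₐ[ℂ] R} {c : R}
    (hc : ∀ m, c * k m = ra P h j m * c) :
    act (tp (rop k) (lop H j) (pRho P)) (qLeg P j h * c) = c := by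
  rw [act_mul_right H j hc, pRho_qLeg, one_mul]

lemma pRho_eq_pLeg : pRho P = pLeg P Algebra.TensorProduct.includeRight
    Algebra.TensorProduct.includeLeft := by
  rw [← tp_pRho, tp_std]

lemma ra_include : ra P Algebra.TensorProduct.includeLeft Algebra.TensorProduct.includeRight =
    P.rho := by
  rw [ra, tp_include]; rfl

-- The equation for `L` lets left multiplications be absorbed into the operator acting on `L`.
-- Identities inside `M ⊗ G` thus transfer to all solutions `L`.
variable {P j h} in
lemma mul_act_of_act_rho [Comm h j] {k : M →ₐ[ℂ] R} {L : R}
    (hL : ∀ m, act (tp (rop k) (lop H j) (P.rho m)) L = h m * L) (t X : M ⊗[ℂ] G) :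
    tp h j t * act (tp (rop k) (lop H j) X) L =
      act (tp (rop k) (lop H j)
        (tp (lmu P.rho) (rmS H Algebra.TensorProduct.includeRight) t X)) L := by
  induction t with
  | zero => simp
  | add t s ht hs => simp only [map_add, add_mul, ht, hs, LinearMap.add_apply, act_add]
  | tmul m g =>
    have e1 := fun y => act_mul_left H k j (F := h m) (fun g => Comm.commute _ _) X y
    have e2 : ∀ (X : M ⊗[ℂ] G) (y : R), j g * act (tp (rop k) (lop H j) X) y =
        act (tp (rop k) (lop H j) (X * (1 ⊗ₜ[ℂ] H.S g))) y := by
      intro X y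
      simp
    rw [tp_tmul, mul_assoc, e2, ← act_mul_left H k j (fun g => Comm.commute _ _), ← hL,
      ← act_mul, ← map_mul, tp_tmul, Module.End.mul_apply, rmS_apply, lmu_apply]
    rfl

-- Transfer of `qRhoOp_pLeg`. Together with `act_pRho_qLeg_mul` it makes `c ↦ q_ρ c` a bijection
-- between intertwiners and solutions `L`.
variable {P j h} in
lemma qLeg_mul_act_pRho [FiniteDimensional ℂ G] [Comm h j] {k : M →ₐ[ℂ] R} {L : R}
    (hL : ∀ m, act (tp (rop k) (lop H j) (P.rho m)) L = h m * L) :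
    qLeg P j h * act (tp (rop k) (lop H j) (pRho P)) L = L := by
  have := qRhoOp_pLeg P Algebra.TensorProduct.includeRight Algebra.TensorProduct.includeLeft
  rw [ra_include, ← pRho_eq_pLeg] at this
  rw [← tp_qRhoOp, ← tp_comm, mul_act_of_act_rho hL, tp_comm, this, map_one, act_one]

-- Transfer of `pLeg_rho`: the element recovered from a solution is an intertwiner.
variable {P j h} in
lemma act_pRho_intertwine [Comm h j] {k : M →ₐ[ℂ] R} {L : R}
    (hL : ∀ m, act (tp (rop k) (lop H j) (P.rho m)) L = h m * L) (m : M) :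
    act (tp (rop k) (lop H j) (pRho P)) L * k m =
      ra P h j m * act (tp (rop k) (lop H j) (pRho P)) L := by
  have := pLeg_rho P Algebra.TensorProduct.includeRight Algebra.TensorProduct.includeLeft m
  rw [ra_include, ← pRho_eq_pLeg] at this
  rw [AlgHom.comp_apply, mul_act_of_act_rho hL, this]
  simp

-- The compatibility `qLeg_la` of `q_ρ` with `λ`, surrounded by intertwiners. It expresses a product
-- `F (q_ρ c)` through the reassociated product `F φ_λρ⁻¹ c`.
variable {P u j h} in
lemma act_φlr_mul_qLeg_mul [FiniteDimensional ℂ G] [Comm h j] [Comm u j] [Comm u h]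
    {h₂ : M →ₐ[ℂ] R} [Comm h₂ j] {F c : R} (hF : ∀ g, Commute F (j g))
    (hF₂ : ∀ m, F * la P u h m = h₂ m * F) (hcu : ∀ g, Commute c (u g))
    (hc : ∀ m, c * la P j h m = ra P h j m * c) :
    act (t3 (rop u) (rop (la P j h)) (lop H j) P.φlr : OpEnd R) (F * (qLeg P j h * c)) =
      qLeg P j h₂ * (F * (((t3 u h j P.φlr)⁻¹ : Rˣ) * c)) := by
  have e : act (t3 (rop u) (rop (ra P h j)) (lop H j) P.φlr : OpEnd R) (qLeg P j h) =
      qLeg P j (la P u h) * ((t3 u h j P.φlr)⁻¹ : Rˣ) := by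
    rw [← qLeg_la, mul_assoc, Units.mul_inv, mul_one]
  have e2 : F * qLeg P j (la P u h) = qLeg P j h₂ * F := by
    rw [← tp_qRhoOp, ← tp_qRhoOp]
    exact slide_right hF hF₂ _
  rw [t3_val] at e
  rw [t3_val, act₃_mul_left H u (la P j h) j hF, act₃_mul_right H u j hcu hc, e, mul_assoc,
    ← mul_assoc F, e2, mul_assoc]

-- An element moves through `c` by its own property, through `φ_λρ⁻¹` by quasi-commutativity, and
-- through `F`; so the product is again an intertwiner.
variable {P u j h} in
lemma φlr_inv_mul_intertwine [Comm h j] [Comm u j] [Comm u h]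
    {h₂ : M →ₐ[ℂ] R} [Comm h₂ j] {F c : R} (hF : ∀ g, Commute F (j g))
    (hF₂ : ∀ m, F * la P u h m = h₂ m * F) (hcu : ∀ g, Commute c (u g))
    (hc : ∀ m, c * la P j h m = ra P h j m * c) (m : M) :
    F * (((t3 u h j P.φlr)⁻¹ : Rˣ) * c) * la P u (la P j h) m =
      ra P h₂ j m * (F * (((t3 u h j P.φlr)⁻¹ : Rˣ) * c)) := by
  have e1 : c * la P u (la P j h) m = la P u (ra P h j) m * c := slide_right hcu hc _
  have e2 := quasi_comm_legs P u j h m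
  rw [← Units.eq_inv_mul_iff_mul_eq, ← mul_assoc, ← Units.mul_inv_eq_iff_eq_mul] at e2
  have e3 : F * ra P (la P u h) j m = ra P h₂ j m * F := slide_left hF₂ hF _
  rw [mul_assoc, mul_assoc, e1, ← mul_assoc (Units.val _), ← e2, mul_assoc, ← mul_assoc F, e3,
    mul_assoc]

variable {P u j h} in
/-- An element `W` is determined by `q_ρ W`. -/
lemma mul_φlr_inv_mul_eq [FiniteDimensional ℂ G] [Comm h j] [Comm u j] [Comm u h]
    {h₂ : M →ₐ[ℂ] R} [Comm h₂ j] {F c W : R} (hF : ∀ g, Commute F (j g))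
    (hF₂ : ∀ m, F * la P u h m = h₂ m * F) (hcu : ∀ g, Commute c (u g))
    (hc : ∀ m, c * la P j h m = ra P h j m * c)
    (hW : ∀ m, W * la P u (la P j h) m = ra P h₂ j m * W)
    (hFL : F * (qLeg P j h * c) =
      act ((t3 (rop u) (rop (la P j h)) (lop H j) P.φlr)⁻¹ : (OpEnd R)ˣ) (qLeg P j h₂ * W)) :
    F * (((t3 u h j P.φlr)⁻¹ : Rˣ) * c) = W := by
  have e := act_φlr_mul_qLeg_mul hF hF₂ hcu hc
  rw [hFL, ← act_mul, Units.inv_mul, act_one] at e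
  rw [← act_pRho_qLeg_mul hW, e, act_pRho_qLeg_mul (φlr_inv_mul_intertwine hF hF₂ hcu hc)]

-- Even before `F` is known to be an intertwiner, it is one on `L` if `F L` has the expected form:
-- `λ(m) L` is written as an operator on `L`, moved past `F`, and evaluated by quasi-commutativity
-- on `q_ρ W`.
variable {P u j h} in
lemma mul_la_mul [Comm h j] [Comm u j] [Comm u h]
    {h₂ : M →ₐ[ℂ] R} [Comm h₂ j] {F L W : R} (hF : ∀ g, Commute F (j g))
    (hLu : ∀ g, Commute L (u g))
    (hL : ∀ m, act (tp (rop (la P j h)) (lop H j) (P.rho m)) L = h m * L)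
    (hW : ∀ m, W * la P u (la P j h) m = ra P h₂ j m * W)
    (hFL : F * L =
      act ((t3 (rop u) (rop (la P j h)) (lop H j) P.φlr)⁻¹ : (OpEnd R)ˣ) (qLeg P j h₂ * W))
    (m : M) : F * la P u h m * L = h₂ m * F * L := by
  have e1 : la P u h m * L = act (la P (rop u) (ra P (rop (la P j h)) (lop H j)) m) L := by
    rw [AlgHom.comp_apply, AlgHom.comp_apply]
    generalize P.lam m = t
    induction t with
    | zero => simp
    | add t s ht hs => simp only [map_add, add_mul, ht, hs, act_add]
    | tmul g m =>
      rw [tp_tmul, tp_tmul, act_mul, act_rop, AlgHom.comp_apply, (hLu g).eq,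
        act_mul_left H _ j (fun g => Comm.commute _ _), hL, mul_assoc]
  have e2 := quasi_comm_legs P (rop u) (lop H j) (rop (la P j h)) m
  rw [← Units.eq_inv_mul_iff_mul_eq, ← mul_assoc, ← Units.mul_inv_eq_iff_eq_mul] at e2
  have e3 : ∀ y, act (la P (rop u) (ra P (rop (la P j h)) (lop H j)) m) (F * y) =
      F * act (la P (rop u) (ra P (rop (la P j h)) (lop H j)) m) y := by
    intro y
    have := act₃_mul_left H u (la P j h) j hF (onRight P.rho (P.lam m)) y
    rwa [tp_onRight] at this
  have e4 : ∀ y, act ((t3 (rop u) (rop (la P j h)) (lop H j) P.φlr)⁻¹ : (OpEnd R)ˣ) (h₂ m * y) =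
      h₂ m * act ((t3 (rop u) (rop (la P j h)) (lop H j) P.φlr)⁻¹ : (OpEnd R)ˣ) y :=
    fun y => act₃_mul_left H u (la P j h) j (fun g => Comm.commute _ _) _ y
  rw [mul_assoc, e1, ← e3, hFL, ← act_mul, ← e2, act_mul]
  simp only [la_rop]
  rw [AlgHom.comp_apply, act_rho_qLeg_mul hW, e4, ← hFL, mul_assoc]

end Bimodule

section MapAct

variable {R R' : Type*} [Ring R] [Algebra ℂ R] [Ring R'] [Algebra ℂ R'] {A B G M : Type*}
  [Ring A] [Algebra ℂ A] [Ring B] [Algebra ℂ B] [Ring G] [Algebra ℂ G] [Ring M] [Algebra ℂ M]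
  {H : QuasiHopfAlgebra G}

lemma map_act (f : R →ₐ[ℂ] R') (k : A →ₐ[ℂ] R) (j : G →ₐ[ℂ] R) (t : A ⊗[ℂ] G) (y : R) :
    f (act (tp (rop k) (lop H j) t) y) = act (tp (rop (f.comp k)) (lop H (f.comp j)) t) (f y) := by
  induction t with
  | zero => simp
  | tmul a g => simp
  | add t s ht hs => simp only [map_add, act_add, ht, hs]

lemma map_act₃ (f : R →ₐ[ℂ] R') (u : B →ₐ[ℂ] R) (k : A →ₐ[ℂ] R) [Comm u k] (j : G →ₐ[ℂ] R)
    (t : B ⊗[ℂ] (A ⊗[ℂ] G)) (y : R) :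
    f (act (tp (rop u) (tp (rop k) (lop H j)) t) y) =
      act (tp (rop (f.comp u)) (tp (rop (f.comp k)) (lop H (f.comp j))) t) (f y) := by
  induction t with
  | zero => simp
  | tmul a g => rw [tp₃_rop_lop_tmul, map_act, map_mul, tp₃_rop_lop_tmul]; rfl
  | add t s ht hs => simp only [map_add, act_add, ht, hs]

lemma map_t3_inv {C : Type*} [Ring C] [Algebra ℂ C] (f : R →ₐ[ℂ] R') (u : A →ₐ[ℂ] R)
    (k : B →ₐ[ℂ] R) (j : C →ₐ[ℂ] R) [Comm k j] [Comm u k] [Comm u j]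
    (x : (A ⊗[ℂ] (B ⊗[ℂ] C))ˣ) :
    f ((t3 u k j x)⁻¹ : Rˣ) = ((t3 (f.comp u) (f.comp k) (f.comp j) x)⁻¹ : R'ˣ) := by
  rw [t3_inv_val, t3_inv_val, map_tp]
  simp only [comp_tp]

lemma map_qLeg [FiniteDimensional ℂ G] (P : QuasiCommutingPair H.toQuasiBialgebra M)
    (f : R →ₐ[ℂ] R') (j : G →ₐ[ℂ] R) (h : M →ₐ[ℂ] R) [Comm h j] :
    f (qLeg P j h) = qLeg P (f.comp j) (f.comp h) := by
  rw [← tp_qRhoOp, ← tp_qRhoOp, map_tp]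

end MapAct

/-- The slices of a twisted bimodule equation determine an intertwiner: the pentagon computation
behind the coherence of `T`. -/
lemma coherence_of_star {R : Type*} [Ring R] {a b d e f₁ f₂ f₃ g g' k l₁ l₂ l₃ r₁ r₂ r₃ r₄ r₅ w : Rˣ}
    {c c₂ c₃ c₄ T₁ T₂ : R} (p₁ : f₁ * f₂ * d = g * e) (n₁ : c * g' = g * c)
    (n₂ : T₂ * f₂ = f₃ * T₂) (s₂ : T₂ * ((f₁⁻¹ : Rˣ) * c) = (r₁⁻¹ : Rˣ) * c₂ * (l₁⁻¹ : Rˣ))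
    (p₂ : r₁ * f₃ * b = k * r₂) (n₃ : T₁ * r₂ = r₃ * T₁)
    (s₁ : T₁ * ((k⁻¹ : Rˣ) * c₂) = (r₄⁻¹ : Rˣ) * c₃ * (l₂⁻¹ : Rˣ))
    (p₃ : w * r₅ * a = r₄ * r₃) (p₄ : l₁ * l₂ * w = g' * l₃) (n₄ : c₃ * w = w * c₄) :
    a * T₁ * (b⁻¹ : Rˣ) * T₂ * d * ((e⁻¹ : Rˣ) * c) = (r₅⁻¹ : Rˣ) * c₄ * (l₃⁻¹ : Rˣ) := by
  -- The word is evaluated from its right end: a pentagon prepares `T₂` for `s₂`, another prepares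
  -- `T₁` for `s₁`, and two more collect what remains.
  have q₁ : ∀ t : R, d * ((e⁻¹ : Rˣ) * t) = (f₂⁻¹ : Rˣ) * ((f₁⁻¹ : Rˣ) * (g * t)) := fun t => by
    simp only [← mul_assoc, ← Units.val_mul]
    congr 2
    rw [← mul_inv_rev, mul_inv_eq_iff_eq_mul, mul_assoc, ← p₁]
    group
  have m₂ : ∀ t : R, T₂ * ((f₂⁻¹ : Rˣ) * t) = (f₃⁻¹ : Rˣ) * (T₂ * t) := fun t => by
    rw [← mul_assoc, ← mul_assoc]
    congr 1
    rw [Units.mul_inv_eq_iff_eq_mul, mul_assoc, n₂, Units.inv_mul_cancel_left]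
  have m₃ : ∀ t : R, T₁ * ((r₂⁻¹ : Rˣ) * t) = (r₃⁻¹ : Rˣ) * (T₁ * t) := fun t => by
    rw [← mul_assoc, ← mul_assoc]
    congr 1
    rw [Units.mul_inv_eq_iff_eq_mul, mul_assoc, n₃, Units.inv_mul_cancel_left]
  have q₂ : ∀ t : R, (b⁻¹ : Rˣ) * ((f₃⁻¹ : Rˣ) * ((r₁⁻¹ : Rˣ) * t)) =
      (r₂⁻¹ : Rˣ) * ((k⁻¹ : Rˣ) * t) := fun t => by
    simp only [← mul_assoc, ← Units.val_mul]
    congr 2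
    rw [← mul_inv_rev, ← mul_inv_rev, ← mul_inv_rev, ← mul_assoc, p₂]
  have q₃ : ∀ t : R, a * ((r₃⁻¹ : Rˣ) * ((r₄⁻¹ : Rˣ) * t)) =
      (r₅⁻¹ : Rˣ) * ((w⁻¹ : Rˣ) * t) := fun t => by
    simp only [← mul_assoc, ← Units.val_mul]
    congr 2
    rw [mul_assoc, ← mul_inv_rev, ← p₃]
    group
  have q₄ : ((l₂⁻¹ : Rˣ) : R) * ((l₁⁻¹ : Rˣ) * g') = w * (l₃⁻¹ : Rˣ) := by
    simp only [← Units.val_mul]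
    congr 1
    rw [eq_mul_inv_iff_mul_eq, ← mul_assoc, mul_assoc, ← p₄]
    group
  have n₅ : c₄ = (w⁻¹ : Rˣ) * (c₃ * w) := by rw [n₄, Units.inv_mul_cancel_left]
  have s₁' : ∀ t : R, T₁ * ((k⁻¹ : Rˣ) * (c₂ * t)) = (r₄⁻¹ : Rˣ) * (c₃ * ((l₂⁻¹ : Rˣ) * t)) := by
    intro t
    have := congrArg (· * t) s₁
    simpa only [mul_assoc] using this
  have s₂' : ∀ t : R, T₂ * ((f₁⁻¹ : Rˣ) * (c * t)) = (r₁⁻¹ : Rˣ) * (c₂ * ((l₁⁻¹ : Rˣ) * t)) := by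
    intro t
    have := congrArg (· * t) s₂
    simpa only [mul_assoc] using this
  simp only [mul_assoc]
  rw [q₁, ← n₁, m₂, s₂', q₂, m₃, s₁', q₃, q₄, n₅]
  simp only [mul_assoc]

/-! ### Abstract construction of the intertwiner of the regular representation. -/

section Model

variable {G M A : Type*} [Ring G] [Algebra ℂ G] [FiniteDimensional ℂ G]
  [Ring M] [Algebra ℂ M] [Ring A] [Algebra ℂ A] {H : QuasiHopfAlgebra G}

open Algebra.TensorProduct (includeLeft includeRight)

/-- An algebra `A` with elements `L(φ)` spanning a twisted `M`-bimodule on which the intertwiner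
to be constructed is determined by its left multiplication. -/
structure IsModel (P : QuasiCommutingPair H.toQuasiBialgebra M) (i : M →ₐ[ℂ] A) (L : G ⊗[ℂ] A)
    (e : A) (D : G ⊗[ℂ] A →ₗ[ℂ] A) : Prop where
  act_rho : ∀ m, act (tp (rop (la P (includeLeft : G →ₐ[ℂ] G ⊗[ℂ] A) (includeRight.comp i))) (lop H includeLeft) (P.rho m)) L
    = (includeRight : A →ₐ[ℂ] G ⊗[ℂ] A) (i m) * L
  e_comm : ∀ m, Commute e (i m)
  e_mul_self : e * e = e
  e_L : ∀ φ, e * slice φ L = slice φ L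
  L_e : ∀ φ, slice φ L * e = 0
  -- In the application `e` projects onto `Ĝ ⊗ M` and `L(φ)` is `m ↦ φ ⊗ m`. These images span, so
  -- an operator is determined by its products with `L`; `D` conversely builds an operator from
  -- prescribed products.
  faithful : ∀ F, F * e = F → (∀ φ, F * slice φ L = 0) → F = 0
  D_L : ∀ t φ, D t * slice φ L = e * slice φ t * (1 - e)
  D_e : ∀ t, D t * e = D t
  e_D : ∀ t, e * D t = D t

omit [FiniteDimensional ℂ G] in
lemma slice_includeRight_mul {B : Type*} [Ring B] [Algebra ℂ B] (φ : Module.Dual ℂ G) (a : B)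
    (t : G ⊗[ℂ] B) : slice φ ((includeRight : B →ₐ[ℂ] G ⊗[ℂ] B) a * t) = a * slice φ t := by
  induction t with
  | zero => simp
  | tmul g x => simp
  | add t s ht hs => simp only [mul_add, map_add, ht, hs]

omit [FiniteDimensional ℂ G] in
lemma slice_mul_includeRight {B : Type*} [Ring B] [Algebra ℂ B] (φ : Module.Dual ℂ G) (a : B)
    (t : G ⊗[ℂ] B) : slice φ (t * (includeRight : B →ₐ[ℂ] G ⊗[ℂ] B) a) = slice φ t * a := by
  induction t with
  | zero => simp
  | tmul g x => simp
  | add t s ht hs => simp only [add_mul, map_add, ht, hs]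

variable (P : QuasiCommutingPair H.toQuasiBialgebra M) (i : M →ₐ[ℂ] A) (L : G ⊗[ℂ] A)

/-- The intertwiner recovered from `L = q_ρ c`. -/
def modelC : G ⊗[ℂ] A :=
  act (tp (rop (la P (includeLeft : G →ₐ[ℂ] G ⊗[ℂ] A) (includeRight.comp i))) (lop H includeLeft) (pRho P)) L

/-- `φ_ρ⁻¹ (Δ ⊗ id)(c) φ_λ⁻¹`. -/
def modelW {R : Type*} [Ring R] [Algebra ℂ R] (u j : G →ₐ[ℂ] R) (x : A →ₐ[ℂ] R) [Comm u j]
    [Comm u x] [Comm j x] : R :=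
  ((t3 (x.comp i) u j P.φr)⁻¹ : Rˣ) * tp (mu H.toQuasiBialgebra u j) x (modelC P i L) *
    ((t3 u j (x.comp i) P.φl)⁻¹ : Rˣ)

/-- The prospective product of the intertwiner with `L`. -/
def modelZ {R : Type*} [Ring R] [Algebra ℂ R] (u j : G →ₐ[ℂ] R) (x : A →ₐ[ℂ] R) [Comm u j]
    [Comm u x] [Comm j x] : R :=
  act ((t3 (rop u) (rop (la P j (x.comp i))) (lop H j) P.φlr)⁻¹ : (OpEnd R)ˣ)
    (qLeg P j (ra P (x.comp i) u) * modelW P i L u j x)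

/-- The intertwiner. -/
def modelT (D : G ⊗[ℂ] A →ₗ[ℂ] A) : G ⊗[ℂ] A := LinearMap.lTensor G D (modelZ P i L leg₁ leg₂ leg₃)

variable {P i L} {e : A} {D : G ⊗[ℂ] A →ₗ[ℂ] A} (hm : IsModel P i L e D)

section Legs

variable {R : Type*} [Ring R] [Algebra ℂ R] (u j : G →ₐ[ℂ] R) (x : A →ₐ[ℂ] R)

lemma tp_modelC [Comm j x] : tp j x (modelC P i L) =
    act (tp (rop (la P j (x.comp i))) (lop H j) (pRho P)) (tp j x L) := by
  rw [modelC, map_act]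
  simp only [la, ← AlgHom.comp_assoc, comp_tp, tp_comp_includeLeft, tp_comp_includeRight]

include hm

lemma IsModel.act_rho_legs [Comm j x] (m : M) :
    act (tp (rop (la P j (x.comp i))) (lop H j) (P.rho m)) (tp j x L) = x (i m) * tp j x L := by
  have := congrArg (tp j x) (hm.act_rho m)
  rw [map_act, map_mul] at this
  simpa only [la, ← AlgHom.comp_assoc, comp_tp, tp_comp_includeLeft, tp_comp_includeRight,
    ← AlgHom.comp_apply] using this

lemma IsModel.qLeg_mul_modelC [Comm j x] :
    qLeg P j (x.comp i) * tp j x (modelC P i L) = tp j x L := by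
  rw [tp_modelC]
  exact qLeg_mul_act_pRho (hm.act_rho_legs j x)

lemma IsModel.modelC_intertwine [Comm j x] (m : M) :
    tp j x (modelC P i L) * la P j (x.comp i) m =
      ra P (x.comp i) j m * tp j x (modelC P i L) := by
  rw [tp_modelC]
  exact act_pRho_intertwine (hm.act_rho_legs j x) m

lemma IsModel.e_mul_L [Comm j x] : x e * tp j x L = tp j x L := by
  have : (includeRight : A →ₐ[ℂ] G ⊗[ℂ] A) e * L = L := slice_ext fun φ => by
    rw [slice_includeRight_mul, hm.e_L]
  have := congrArg (tp j x) this
  rwa [map_mul, ← AlgHom.comp_apply, tp_comp_includeRight] at this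

lemma IsModel.L_mul_e [Comm j x] : tp j x L * x e = 0 := by
  have : L * (includeRight : A →ₐ[ℂ] G ⊗[ℂ] A) e = 0 := slice_ext fun φ => by
    rw [slice_mul_includeRight, hm.L_e, map_zero]
  have := congrArg (tp j x) this
  rwa [map_mul, ← AlgHom.comp_apply, tp_comp_includeRight, map_zero] at this

lemma IsModel.e_mul_modelC [Comm j x] : x e * tp j x (modelC P i L) = tp j x (modelC P i L) := by
  rw [tp_modelC, ← act_mul_left H _ j (fun g => (Comm.commute (f := j) (g := x) g e).symm),
    hm.e_mul_L]

lemma IsModel.commute_e_la [Comm j x] (m : M) : Commute (x e) (la P j (x.comp i) m) :=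
  commute_tp (fun _ => (Comm.commute (f := j) (g := x) _ e).symm)
    (fun _ => (hm.e_comm _).map x) _

lemma IsModel.modelC_mul_e [Comm j x] : tp j x (modelC P i L) * x e = 0 := by
  rw [tp_modelC, ← act_mul_right H j (fun m => hm.commute_e_la j x m), hm.L_mul_e, map_zero]

/-- The coproduct of an intertwiner carries `(Δ ⊗ id)(λ(m))` to its counterpart for `ρ`; the outer
reassociators turn both into iterated coactions. -/
lemma IsModel.modelW_intertwine [Comm u j] [Comm u x] [Comm j x] (m : M) :
    modelW P i L u j x * la P u (la P j (x.comp i)) m =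
      ra P (ra P (x.comp i) u) j m * modelW P i L u j x := by
  have e1 := lam_coassoc_legs P u j (x.comp i) m
  rw [← Units.eq_mul_inv_iff_mul_eq, mul_assoc, ← Units.inv_mul_eq_iff_eq_mul] at e1
  have e2 := rho_coassoc_legs P u j (x.comp i) m
  rw [← Units.eq_inv_mul_iff_mul_eq, ← mul_assoc, ← Units.mul_inv_eq_iff_eq_mul] at e2
  have e3 := hm.modelC_intertwine (mu H.toQuasiBialgebra u j) x m
  rw [modelW, mul_assoc, e1, ← mul_assoc, mul_assoc (Units.val _), e3, ← mul_assoc, ← e2]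
  simp only [mul_assoc]

lemma IsModel.commute_e_t3 {B C : Type*} [Ring B] [Algebra ℂ B] [Ring C] [Algebra ℂ C]
    (f : B →ₐ[ℂ] R) (k : C →ₐ[ℂ] R) [Comm f x] [Comm f k] [Comm k x]
    (y : B ⊗[ℂ] (C ⊗[ℂ] M)) : Commute (x e) (tp f (tp k (x.comp i)) y) :=
  commute_tp (fun _ => (Comm.commute (f := f) (g := x) _ e).symm)
    (commute_tp (fun _ => (Comm.commute (f := k) (g := x) _ e).symm)
      (fun _ => (hm.e_comm _).map x)) _

/-- With `modelZ_mul_e` this locates `Z` in the corner from `1 - e` to `e`, which is the part that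
`D` can reproduce. -/
lemma IsModel.e_mul_modelZ [Comm u j] [Comm u x] [Comm j x] :
    x e * modelZ P i L u j x = modelZ P i L u j x := by
  have hu := fun a => (Comm.commute (f := u) (g := x) a e).symm
  have hj := fun a => (Comm.commute (f := j) (g := x) a e).symm
  have hi : ∀ a, Commute (x e) (x.comp i a) := fun a => (hm.e_comm a).map x
  have e1 : Commute (x e) (qLeg P j (ra P (x.comp i) u)) := by
    rw [← tp_qRhoOp]
    refine commute_tp hj (fun m => ?_) _
    rw [AlgHom.comp_apply]
    exact commute_tp hi hu _
  have e2 : Commute (x e) ((t3 (x.comp i) u j P.φr)⁻¹ : Rˣ) := by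
    rw [t3_inv_val]
    exact commute_tp (f := x.comp i) hi (commute_tp hu hj) _
  have e3 : x e * modelW P i L u j x = modelW P i L u j x := by
    rw [modelW, ← mul_assoc, ← mul_assoc, e2.eq, mul_assoc (Units.val _), hm.e_mul_modelC]
  rw [modelZ, t3_inv_val, ← act₃_mul_left H u _ j hj, ← mul_assoc, e1.eq, mul_assoc, e3]

lemma IsModel.modelZ_mul_e [Comm u j] [Comm u x] [Comm j x] :
    modelZ P i L u j x * x e = 0 := by
  have hu := fun a => (Comm.commute (f := u) (g := x) a e).symm
  have e1 : Commute (x e) ((t3 u j (x.comp i) P.φl)⁻¹ : Rˣ) := by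
    rw [t3_inv_val]
    exact hm.commute_e_t3 x u j _
  have e3 : modelW P i L u j x * x e = 0 := by
    rw [modelW, mul_assoc, ← e1.eq, ← mul_assoc, mul_assoc (Units.val _), hm.modelC_mul_e]
    simp
  rw [modelZ, t3_inv_val, ← act₃_mul_right H u j hu (fun m => hm.commute_e_la j x m), mul_assoc,
    e3, mul_zero, map_zero]

omit hm in
lemma map_modelZ {R' : Type*} [Ring R'] [Algebra ℂ R'] (f : R →ₐ[ℂ] R') [Comm u j] [Comm u x]
    [Comm j x] : f (modelZ P i L u j x) = modelZ P i L (f.comp u) (f.comp j) (f.comp x) := by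
  rw [modelZ, modelZ, t3_inv_val, map_act₃, map_mul f, map_qLeg, modelW, map_mul f, map_mul f,
    map_t3_inv, map_t3_inv, map_tp, modelW, t3_inv_val]
  simp only [t3_inv_val, la, ra, mu, ← AlgHom.comp_assoc, comp_tp]

/-- The defining property of `T`: its product with `L` is the one forced by coherence. It is checked
on pure tensors and then transported to all legs. -/
lemma IsModel.modelT_mul_L_std :
    tp leg₁ leg₃ (modelT P i L D) * tp leg₂ leg₃ L =
      modelZ P i L leg₁ leg₂ (leg₃ : A →ₐ[ℂ] G ⊗[ℂ] (G ⊗[ℂ] A)) := by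
  have key : ∀ Z : G ⊗[ℂ] (G ⊗[ℂ] A), tp leg₁ leg₃ (LinearMap.lTensor G D Z) * tp leg₂ leg₃ L =
      leg₃ e * Z * (1 - leg₃ e) := by
    intro Z
    have e1 : tp leg₂ leg₃ L = (1 : G) ⊗ₜ[ℂ] L := by
      have := map_tp (includeRight : G ⊗[ℂ] A →ₐ[ℂ] G ⊗[ℂ] (G ⊗[ℂ] A)) includeLeft includeRight L
      rw [tp_std] at this
      exact this.symm
    induction Z with
    | zero => simp
    | add s t hs ht => simp only [map_add, add_mul, mul_add, hs, ht]
    | tmul g t =>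
      have e2 : (includeRight : A →ₐ[ℂ] G ⊗[ℂ] A) (D t) * L = includeRight e * t * (1 - includeRight e) := by
        rw [← map_one (includeRight : A →ₐ[ℂ] G ⊗[ℂ] A), ← map_sub]
        refine slice_ext fun φ => ?_
        rw [slice_includeRight_mul, slice_mul_includeRight, slice_includeRight_mul, hm.D_L]
      have e3 : (leg₃ : A →ₐ[ℂ] G ⊗[ℂ] (G ⊗[ℂ] A)) e = (1 : G) ⊗ₜ[ℂ] (includeRight e : G ⊗[ℂ] A) := rfl
      have e4 : (leg₃ : A →ₐ[ℂ] G ⊗[ℂ] (G ⊗[ℂ] A)) (D t) = (1 : G) ⊗ₜ[ℂ] (includeRight (D t) : G ⊗[ℂ] A) := rfl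
      have e5 : (1 : G ⊗[ℂ] (G ⊗[ℂ] A)) = (1 : G) ⊗ₜ[ℂ] (1 : G ⊗[ℂ] A) := rfl
      rw [LinearMap.lTensor_tmul, tp_tmul, e1, e3, e4, e5, ← TensorProduct.tmul_sub, leg₁,
        Algebra.TensorProduct.includeLeft_apply]
      simp only [Algebra.TensorProduct.tmul_mul_tmul, one_mul, mul_one, e2]
  rw [modelT, key, hm.e_mul_modelZ, mul_sub, mul_one, hm.modelZ_mul_e, sub_zero]

lemma IsModel.modelT_mul_L [Comm u j] [Comm u x] [Comm j x] :
    tp u x (modelT P i L D) * tp j x L = modelZ P i L u j x := by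
  have := congrArg (tp u (tp j x)) hm.modelT_mul_L_std
  rw [map_mul, map_tp, map_tp, map_modelZ] at this
  simpa only [leg₁, leg₂, leg₃, ← AlgHom.comp_assoc, tp_comp_includeLeft, tp_comp_includeRight]
    using this

lemma IsModel.modelT_mul_e [Comm u x] :
    tp u x (modelT P i L D) * x e = tp u x (modelT P i L D) := by
  have key : ∀ Z : G ⊗[ℂ] (G ⊗[ℂ] A), tp u x (LinearMap.lTensor G D Z) * x e =
      tp u x (LinearMap.lTensor G D Z) := by
    intro Z
    induction Z with
    | zero => simp
    | add s t hs ht => simp only [map_add, add_mul, hs, ht]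
    | tmul g t => rw [LinearMap.lTensor_tmul, tp_tmul, mul_assoc, ← map_mul, hm.D_e]
  exact key _

lemma IsModel.e_mul_modelT [Comm u x] :
    x e * tp u x (modelT P i L D) = tp u x (modelT P i L D) := by
  have key : ∀ Z : G ⊗[ℂ] (G ⊗[ℂ] A), x e * tp u x (LinearMap.lTensor G D Z) =
      tp u x (LinearMap.lTensor G D Z) := by
    intro Z
    induction Z with
    | zero => simp
    | add s t hs ht => simp only [map_add, mul_add, hs, ht]
    | tmul g t =>
      rw [LinearMap.lTensor_tmul, tp_tmul, ← mul_assoc,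
        (Comm.commute (f := u) (g := x) g e).symm.eq, mul_assoc, ← map_mul, hm.e_D]
  exact key _

/-- The operator `F` is determined by its products with `L`. -/
def Faithful (L : G ⊗[ℂ] A) (e : A) {B : Type*} [Ring B] [Algebra ℂ B] (y : A →ₐ[ℂ] B) : Prop :=
  ∀ F : B, F * y e = F → (∀ φ, F * y (slice φ L) = 0) → F = 0

lemma IsModel.faithful_id : Faithful L e (AlgHom.id ℂ A) := hm.faithful

omit hm in
lemma Faithful.tensor {B : Type*} [Ring B] [Algebra ℂ B] {y : A →ₐ[ℂ] B} (hy : Faithful L e y) :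
    Faithful L e ((includeRight : B →ₐ[ℂ] G ⊗[ℂ] B).comp y) := by
  intro F he hF
  refine slice_ext fun φ => ?_
  rw [map_zero]
  refine hy _ ?_ fun ψ => ?_
  · rw [← slice_mul_includeRight]
    exact congrArg _ he
  · rw [← slice_mul_includeRight]
    exact (congrArg _ (hF ψ)).trans (map_zero _)

lemma IsModel.faithful_tensor : Faithful L e (includeRight : A →ₐ[ℂ] G ⊗[ℂ] A) := by
  have := hm.faithful_id.tensor
  rwa [AlgHom.comp_id] at this

-- Elements are compared after multiplication by `L` placed on a fresh leg. All later identities for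
-- `T` are proved by such a cancellation.
omit hm in
lemma Faithful.cancel {B : Type*} [Ring B] [Algebra ℂ B] {y : A →ₐ[ℂ] B} (hy : Faithful L e y)
    {F F' : B} (hF : F * y e = F) (hF' : F' * y e = F')
    (h : (includeRight : B →ₐ[ℂ] G ⊗[ℂ] B) F * tp includeLeft (includeRight.comp y) L = includeRight F' * tp includeLeft (includeRight.comp y) L) :
    F = F' := by
  rw [← sub_eq_zero]
  refine hy _ (by rw [sub_mul, hF, hF']) fun φ => ?_
  have e1 : tp includeLeft ((includeRight : B →ₐ[ℂ] G ⊗[ℂ] B).comp y) L = onRight y L := by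
    rw [← tp_onRight, tp_std]
  rw [e1] at h
  have := congrArg (slice φ) h
  rw [slice_includeRight_mul, slice_includeRight_mul, ← map_slice_alg] at this
  rw [sub_mul, this, sub_self]

/-- By faithfulness it suffices to compare both sides on `L`, where `T L` is known and `mul_la_mul`
applies. -/
lemma IsModel.modelT_intertwine [Comm u x] (m : M) :
    tp u x (modelT P i L D) * la P u (x.comp i) m =
      ra P (x.comp i) u m * tp u x (modelT P i L D) := by
  have key : tp (includeLeft : G →ₐ[ℂ] G ⊗[ℂ] A) includeRight (modelT P i L D) * la P includeLeft (includeRight.comp i) m =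
      ra P (includeRight.comp i) includeLeft m * tp includeLeft includeRight (modelT P i L D) := by
    refine hm.faithful_tensor.cancel ?_ ?_ ?_
    · have := hm.commute_e_la (includeLeft : G →ₐ[ℂ] G ⊗[ℂ] A) includeRight m
      rw [mul_assoc, ← this.eq, ← mul_assoc, hm.modelT_mul_e]
    · rw [mul_assoc, hm.modelT_mul_e]
    -- The cancellation puts `L` on a new first leg, so the `G`-leg of `T` is now the second one.
    · have := mul_la_mul (P := P) (u := leg₂) (j := leg₁) (h := leg₃.comp i)
        (h₂ := ra P (leg₃.comp i) leg₂) (F := tp leg₂ leg₃ (modelT P i L D))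
        (L := tp leg₁ (leg₃ : A →ₐ[ℂ] G ⊗[ℂ] (G ⊗[ℂ] A)) L) (W := modelW P i L leg₂ leg₁ leg₃)
        (fun g => Comm.commute (f := tp leg₂ leg₃) (g := leg₁) _ _)
        (fun g => Comm.commute (f := tp leg₁ leg₃) (g := leg₂) _ _)
        (hm.act_rho_legs leg₁ leg₃) (hm.modelW_intertwine leg₂ leg₁ leg₃)
        (hm.modelT_mul_L leg₂ leg₁ leg₃) m
      rw [map_mul, map_mul, map_tp]
      simpa only [la, ra, AlgHom.comp_apply, map_tp, AlgHom.comp_assoc] using this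
  have := congrArg (tp u x) key
  rw [map_mul, map_mul, map_tp] at this
  simpa only [la, ra, AlgHom.comp_apply, map_tp, ← AlgHom.comp_assoc, tp_comp_includeLeft,
    tp_comp_includeRight] using this

/-- The prescription for `T L` in terms of `c`: the coherence relation with `c` in place of the
second factor. The relation for two factors `T` is deduced from it. -/
lemma IsModel.star [Comm u j] [Comm u x] [Comm j x] :
    tp u x (modelT P i L D) * (((t3 u (x.comp i) j P.φlr)⁻¹ : Rˣ) * tp j x (modelC P i L)) =
      modelW P i L u j x :=
  mul_φlr_inv_mul_eq (h₂ := ra P (x.comp i) u)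
    (fun g => Comm.commute (f := tp u x) (g := j) _ _)
    (hm.modelT_intertwine u x) (fun g => Comm.commute (f := tp j x) (g := u) _ _)
    (hm.modelC_intertwine j x) (hm.modelW_intertwine u j x)
    (by rw [hm.qLeg_mul_modelC]; exact hm.modelT_mul_L u j x)

section Coherence

variable (u₁ u₂ : G →ₐ[ℂ] R) [Comm u₁ u₂] [Comm u₁ x] [Comm u₂ x]

omit hm in
/-- The right hand side of the coherence condition. -/
def modelF (P : QuasiCommutingPair H.toQuasiBialgebra M) (i : M →ₐ[ℂ] A) (T : G ⊗[ℂ] A) : R :=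
  t3 (x.comp i) u₁ u₂ P.φr * tp u₁ x T * ((t3 u₁ (x.comp i) u₂ P.φlr)⁻¹ : Rˣ) * tp u₂ x T *
    t3 u₁ u₂ (x.comp i) P.φl

/-- Needed so that the passage between products with `c` and products with `L` applies to the whole
coherence expression. -/
lemma IsModel.modelF_intertwine (m : M) :
    modelF x u₁ u₂ P i (modelT P i L D) * la P (mu H.toQuasiBialgebra u₁ u₂) (x.comp i) m =
      ra P (x.comp i) (mu H.toQuasiBialgebra u₁ u₂) m * modelF x u₁ u₂ P i (modelT P i L D) := by
  have e1 := lam_coassoc_legs P u₁ u₂ (x.comp i) m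
  have e2 : tp u₂ x (modelT P i L D) * la P u₁ (la P u₂ (x.comp i)) m =
      la P u₁ (ra P (x.comp i) u₂) m * tp u₂ x (modelT P i L D) :=
    slide_right (fun g => Comm.commute (f := tp u₂ x) (g := u₁) _ _)
      (hm.modelT_intertwine u₂ x) _
  have e3 := quasi_comm_legs P u₁ u₂ (x.comp i) m
  rw [← Units.eq_inv_mul_iff_mul_eq, ← mul_assoc, ← Units.mul_inv_eq_iff_eq_mul] at e3
  have e4 : tp u₁ x (modelT P i L D) * ra P (la P u₁ (x.comp i)) u₂ m =
      ra P (ra P (x.comp i) u₁) u₂ m * tp u₁ x (modelT P i L D) :=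
    slide_left (hm.modelT_intertwine u₁ x)
      (fun g => Comm.commute (f := tp u₁ x) (g := u₂) _ _) _
  have e5 := rho_coassoc_legs P u₁ u₂ (x.comp i) m
  rw [modelF, mul_assoc, ← e1, ← mul_assoc, mul_assoc _ _ (la P u₁ _ m), e2, ← mul_assoc,
    mul_assoc _ _ (la P u₁ _ m), ← e3, ← mul_assoc, mul_assoc _ _ (ra P _ u₂ m), e4, ← mul_assoc,
    e5]
  simp only [mul_assoc]

variable [Comm u₁ j] [Comm u₂ j] [Comm j x]

/-- Two uses of `star`, one for each factor `T`, and four pentagons. The result is what `star` gives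
for the coproduct of `T`. -/
lemma IsModel.modelF_mul_modelC :
    modelF x u₁ u₂ P i (modelT P i L D) *
      (((t3 (mu H.toQuasiBialgebra u₁ u₂) (x.comp i) j P.φlr)⁻¹ : Rˣ) *
        tp j x (modelC P i L)) = modelW P i L (mu H.toQuasiBialgebra u₁ u₂) j x := by
  refine coherence_of_star (mixed_pentagon_lam_legs P u₁ u₂ j (x.comp i)) ?_ ?_
    (hm.star u₂ j x) (mixed_pentagon_rho_legs P u₁ u₂ j (x.comp i)) ?_
    (hm.star u₁ (mu H.toQuasiBialgebra u₂ j) x) (rho_pentagon_legs P u₁ u₂ j (x.comp i))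
    (lam_pentagon_legs P u₁ u₂ j (x.comp i)) ?_
  · exact slide_right (fun g => Comm.commute (f := tp j x) (g := u₁) _ _)
      (slide_right (fun g => Comm.commute (f := tp j x) (g := u₂) _ _)
        (hm.modelC_intertwine j x)) _
  · exact slide_right (fun g => Comm.commute (f := tp u₂ x) (g := u₁) _ _)
      (slide_left (hm.modelT_intertwine u₂ x)
        (fun g => Comm.commute (f := tp u₂ x) (g := j) _ _)) _
  · exact slide_left (hm.modelT_intertwine u₁ x)
      (fun t => Comm.commute (f := tp u₁ x) (g := tp u₂ j) _ t) _
  -- The iterated coproduct in `c` has to be rebracketed, by quasi-coassociativity of `Δ`.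
  · have key : ∀ g, (t3 u₁ u₂ j H.reassoc : R) *
        mu H.toQuasiBialgebra (mu H.toQuasiBialgebra u₁ u₂) j g =
        mu H.toQuasiBialgebra u₁ (mu H.toQuasiBialgebra u₂ j) g * t3 u₁ u₂ j H.reassoc := by
      intro g
      have := congrArg (tp u₁ (tp u₂ j)) (H.quasi_coassoc g)
      simpa [tp_onRight, tp_onLeft, t3_val] using this.symm
    refine (slide_left key (fun a => ?_) _).symm
    have hx : ∀ b : G ⊗[ℂ] (G ⊗[ℂ] G), Commute (tp u₁ (tp u₂ j) b) (x a) :=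
      fun b => Comm.commute (f := tp u₁ (tp u₂ j)) (g := x) b a
    exact hx _

/-- Both expressions have the same product with `φ_λρ⁻¹ c`. Multiplying by `q_ρ` and undoing the
invertible action of `φ_λρ` gives the same product with `L`. -/
lemma IsModel.modelF_mul_L :
    modelF x u₁ u₂ P i (modelT P i L D) * tp j x L =
      tp (mu H.toQuasiBialgebra u₁ u₂) x (modelT P i L D) * tp j x L := by
  have hF : ∀ g, Commute (modelF x u₁ u₂ P i (modelT P i L D)) (j g) := by
    intro g
    have h1 := fun t => Comm.commute (f := tp u₁ x) (g := j) t g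
    have h2 := fun t => Comm.commute (f := tp u₂ x) (g := j) t g
    refine ((((Commute.mul_left ?_ (h1 _)).mul_left ?_).mul_left (h2 _)).mul_left ?_)
    · exact Comm.commute (f := tp (x.comp i) (tp u₁ u₂)) (g := j) _ _
    · exact Comm.commute (f := tp u₁ (tp (x.comp i) u₂)) (g := j) _ _
    · exact Comm.commute (f := tp u₁ (tp u₂ (x.comp i))) (g := j) _ _
  have e1 := act_φlr_mul_qLeg_mul (P := P) (h := x.comp i)
    (h₂ := ra P (x.comp i) (mu H.toQuasiBialgebra u₁ u₂)) hF
    (hm.modelF_intertwine x u₁ u₂)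
    (fun g => Comm.commute (f := tp j x) (g := mu H.toQuasiBialgebra u₁ u₂) _ g)
    (hm.modelC_intertwine j x)
  have e2 := act_φlr_mul_qLeg_mul (P := P) (h := x.comp i)
    (h₂ := ra P (x.comp i) (mu H.toQuasiBialgebra u₁ u₂))
    (fun g => Comm.commute (f := tp (mu H.toQuasiBialgebra u₁ u₂) x) (g := j) (modelT P i L D) g)
    (hm.modelT_intertwine (mu H.toQuasiBialgebra u₁ u₂) x)
    (fun g => Comm.commute (f := tp j x) (g := mu H.toQuasiBialgebra u₁ u₂) _ g)
    (hm.modelC_intertwine j x)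
  rw [hm.modelF_mul_modelC, ← hm.star, ← e2, hm.qLeg_mul_modelC] at e1
  have e3 := congrArg (act ((t3 (rop (mu H.toQuasiBialgebra u₁ u₂)) (rop (la P j (x.comp i)))
    (lop H j) P.φlr)⁻¹ : (OpEnd R)ˣ)) e1
  rwa [← act_mul, ← act_mul, Units.mul_inv, act_one, act_one] at e3

end Coherence

lemma IsModel.modelT_coherent_std :
    tp (mu H.toQuasiBialgebra leg₁ leg₂) leg₃ (modelT P i L D) =
      modelF (leg₃ : A →ₐ[ℂ] G ⊗[ℂ] (G ⊗[ℂ] A)) leg₁ leg₂ P i (modelT P i L D) := by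
  refine hm.faithful_tensor.tensor.cancel ?_ ?_ ?_
  · exact hm.modelT_mul_e _ _
  · have := hm.commute_e_t3 (leg₃ : A →ₐ[ℂ] G ⊗[ℂ] (G ⊗[ℂ] A)) leg₁ leg₂ P.φl.val
    have e2 := hm.modelT_mul_e leg₂ (leg₃ : A →ₐ[ℂ] G ⊗[ℂ] (G ⊗[ℂ] A))
    rw [modelF, t3_val leg₁ leg₂, mul_assoc]
    refine (congrArg _ this.eq.symm).trans ?_
    rw [← mul_assoc, mul_assoc _ _ (leg₃ e), e2]
  · have := hm.modelF_mul_L (includeLeft : G →ₐ[ℂ] G ⊗[ℂ] (G ⊗[ℂ] (G ⊗[ℂ] A)))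
      (includeRight.comp leg₃) (includeRight.comp leg₁) (includeRight.comp leg₂)
    rw [modelF] at this
    rw [modelF, map_mul, map_mul, map_mul, map_mul, map_t3, map_t3, map_t3_inv]
    simpa only [map_tp, comp_tp, mu, ← AlgHom.comp_assoc] using this.symm

/-- The counit component of the intertwiner. -/
lemma IsModel.modelT_triv [Comm j x] :
    tp (triv H.counit) x (modelT P i L D) * tp j x (modelC P i L) = tp j x (modelC P i L) := by
  have := hm.star (triv H.counit) j x
  rw [φlr_triv_left, modelW, φr_triv_mid, φl_triv_left] at this
  simpa only [mu_triv_left, inv_one, Units.val_one, one_mul, mul_one] using this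

/-- A counit in the second `G`-leg of `star`. The counit component of `c` thus acts as the unit
vector, on which `T` gives back `c`. -/
lemma IsModel.modelT_mul_modelC_triv [Comm u x] :
    tp u x (modelT P i L D) * tp (triv H.counit) x (modelC P i L) = tp u x (modelC P i L) := by
  have := hm.star u (triv H.counit) x
  rw [φlr_triv_right, modelW, φr_triv_right, φl_triv_mid] at this
  simpa only [mu_triv_right, inv_one, Units.val_one, one_mul, mul_one] using this

/-- The counit component of `T` fixes `c` and commutes with `q_ρ`, so it fixes `L = q_ρ c`. So does
`e`, and faithfulness applies. -/
lemma IsModel.killLeft_modelT : killLeft H.counit (modelT P i L D) = e := by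
  have e0 : ∀ (j : G →ₐ[ℂ] G ⊗[ℂ] A) (x : A →ₐ[ℂ] G ⊗[ℂ] A) [Comm j x],
      tp (triv H.counit) x (modelT P i L D) * tp j x L = tp j x L := by
    intro j x _
    have h1 : tp (triv H.counit) x (modelT P i L D) * qLeg P j (x.comp i) =
        qLeg P j (x.comp i) * tp (triv H.counit) x (modelT P i L D) := by
      rw [← tp_qRhoOp]
      refine slide_right (fun g => Comm.commute (f := tp (triv H.counit) x) (g := j) _ g)
        (fun m => ?_) _
      have := hm.modelT_intertwine (triv H.counit) x m
      simpa only [la_triv, ra_triv] using this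
    rw [← hm.qLeg_mul_modelC, ← mul_assoc, h1, mul_assoc, hm.modelT_triv]
  have e1 : ∀ x : A →ₐ[ℂ] G ⊗[ℂ] A,
      tp (triv H.counit) x (modelT P i L D) = x (killLeft H.counit (modelT P i L D)) :=
    fun x => tp_triv_left _ _ _
  refine hm.faithful_id.cancel ?_ ?_ ?_
  · have := hm.modelT_mul_e (triv H.counit) (AlgHom.id ℂ A)
    rwa [tp_triv_left] at this
  · exact hm.e_mul_self
  · have := e0 includeLeft includeRight
    rw [e1] at this
    exact this.trans (hm.e_mul_L (x := includeRight) (j := includeLeft)).symm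

end Legs

end Model

open Algebra.TensorProduct (includeLeft includeRight)

/-! ### Compression to the corner of an idempotent. -/

section Corner

variable {A B G : Type*} [Ring A] [Algebra ℂ A] [Ring B] [Algebra ℂ B] [Ring G] [Algebra ℂ G]

/-- A linear map which becomes multiplicative and unital on the corner given by `e`. -/
structure IsCorner (r : A →ₗ[ℂ] B) (e : A) : Prop where
  map_mul_e_mul : ∀ X Y, r (X * e * Y) = r X * r Y
  map_one : r 1 = 1

variable {r : A →ₗ[ℂ] B} {e : A} (hr : IsCorner r e)

include hr

lemma IsCorner.map_mul_e (X : A) : r (X * e) = r X := by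
  rw [← mul_one (X * e), hr.map_mul_e_mul, hr.map_one, mul_one]

lemma IsCorner.map_e : r e = 1 := by rw [← one_mul e, hr.map_mul_e, hr.map_one]

/-- Compression is multiplicative as soon as the right factor commutes with `e`. The factors of the
intertwiner relations do. -/
lemma IsCorner.map_mul {X Y : A} (hY : Commute e Y) : r (X * Y) = r X * r Y := by
  rw [← hr.map_mul_e_mul, mul_assoc, hY.eq, ← mul_assoc, hr.map_mul_e]

lemma IsCorner.tensor : IsCorner (LinearMap.lTensor G r) ((includeRight : A →ₐ[ℂ] G ⊗[ℂ] A) e) where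
  map_mul_e_mul X Y := by
    induction X with
    | zero => simp
    | add s t hs ht => simp only [add_mul, map_add, hs, ht]
    | tmul g a =>
      induction Y with
      | zero => simp
      | add s t hs ht => simp only [mul_add, map_add, hs, ht]
      | tmul h b => simp [hr.map_mul_e_mul]
  map_one := by
    rw [Algebra.TensorProduct.one_def, LinearMap.lTensor_tmul, hr.map_one]; rfl

/-- The restriction of an algebra map commuting with `e` to the corner. -/
def IsCorner.restrict {M : Type*} [Ring M] [Algebra ℂ M] (i : M →ₐ[ℂ] A)
    (hi : ∀ m, Commute e (i m)) : M →ₐ[ℂ] B :=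
  AlgHom.ofLinearMap (r ∘ₗ i.toLinearMap) (by simp [hr.map_one])
    (fun m n => by simp [hr.map_mul (hi n)])

omit hr

lemma lTensor_leg13 {C : Type*} [Ring C] [Algebra ℂ C] (r : A →ₗ[ℂ] B) (t : G ⊗[ℂ] A) :
    LinearMap.lTensor G (LinearMap.lTensor C r) (leg13 t) = leg13 (LinearMap.lTensor G r t) := by
  induction t with
  | zero => simp
  | tmul g a => simp [leg13, onRight_tmul]
  | add t s ht hs => simp only [map_add, ht, hs]

lemma lTensor_onLeft {C E : Type*} [Ring C] [Algebra ℂ C] [Ring E] [Algebra ℂ E]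
    (r : A →ₗ[ℂ] B) (f : G →ₐ[ℂ] C ⊗[ℂ] E) (t : G ⊗[ℂ] A) :
    LinearMap.lTensor C (LinearMap.lTensor E r) (onLeft f t) =
      onLeft f (LinearMap.lTensor G r t) := by
  induction t with
  | zero => simp
  | add t s ht hs => simp only [map_add, ht, hs]
  | tmul g a =>
    simp only [onLeft_tmul, LinearMap.lTensor_tmul]
    generalize f g = s
    induction s with
    | zero => simp
    | tmul a b => simp
    | add t s ht hs => simp only [TensorProduct.add_tmul, map_add, ht, hs]

lemma lTensor_killLeft (r : A →ₗ[ℂ] B) (c : G →ₐ[ℂ] ℂ) (t : G ⊗[ℂ] A) :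
    killLeft c (LinearMap.lTensor G r t) = r (killLeft c t) := by
  induction t with
  | zero => simp
  | tmul g a => simp [killLeft_tmul]
  | add t s ht hs => simp only [map_add, ht, hs]

lemma commute_tmul_right {x y : A} (h : Commute x y) (g : G) :
    Commute ((includeRight : A →ₐ[ℂ] G ⊗[ℂ] A) x) (g ⊗ₜ[ℂ] y) := by
  simp [Commute, SemiconjBy, h.eq]

lemma commute_onRight {M : Type*} [Ring M] [Algebra ℂ M] {i : M →ₐ[ℂ] A}
    (hi : ∀ m, Commute e (i m)) (t : G ⊗[ℂ] M) :
    Commute ((includeRight : A →ₐ[ℂ] G ⊗[ℂ] A) e) (onRight i t) := by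
  induction t with
  | zero => simp
  | tmul g a => rw [onRight_tmul]; exact commute_tmul_right (hi a) g
  | add t s ht hs => rw [_root_.map_add]; exact ht.add_right hs

variable {M : Type*} [Ring M] [Algebra ℂ M] {Q : QuasiBialgebra G}
  {P : QuasiCommutingPair Q M} {i : M →ₐ[ℂ] A} {T : G ⊗[ℂ] A}

include hr

/-- In the ambient algebra the normalization gives only the idempotent `e`; it becomes a genuine
unit after compression. -/
lemma IsCorner.isCoherent (hi : ∀ m, Commute e (i m))
    (hT : Commute ((includeRight : A →ₐ[ℂ] G ⊗[ℂ] A) e) T)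
    (normal : killLeft Q.counit T = e)
    (intertwine : ∀ m, T * onRight i (P.lam m) =
      onRight i (Algebra.TensorProduct.comm ℂ M G (P.rho m)) * T)
    (coherent : map₃ (AlgHom.id ℂ G) (AlgHom.id ℂ G) i (perm312 P.φr.val) * leg13 T *
        map₃ (AlgHom.id ℂ G) (AlgHom.id ℂ G) i (perm132 P.φlr⁻¹.val) * oneTmul T *
        map₃ (AlgHom.id ℂ G) (AlgHom.id ℂ G) i P.φl.val = onLeft Q.comul T) :
    IsCoherent P (hr.restrict i hi) (LinearMap.lTensor G r T) where
  normal := by rw [lTensor_killLeft, normal, hr.map_e]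
  intertwine m := by
    have h := congrArg (LinearMap.lTensor G r) (intertwine m)
    rw [hr.tensor.map_mul (commute_onRight hi _), hr.tensor.map_mul hT] at h
    have h1 : ∀ t : G ⊗[ℂ] M, LinearMap.lTensor G r (onRight i t) =
        onRight (hr.restrict i hi) t := fun t => by
      rw [onRight_eq_lTensor, onRight_eq_lTensor, ← LinearMap.comp_apply, ← LinearMap.lTensor_comp]
      rfl
    rwa [h1, h1] at h
  coherent := by
    have h := congrArg (LinearMap.lTensor G (LinearMap.lTensor G r)) coherent
    have h3 : ∀ t : G ⊗[ℂ] (G ⊗[ℂ] M), map₃ (AlgHom.id ℂ G) (AlgHom.id ℂ G) i t =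
        onRight (onRight i) t := fun t => rfl
    have c1 : ∀ t : G ⊗[ℂ] (G ⊗[ℂ] M),
        Commute ((includeRight : _ →ₐ[ℂ] G ⊗[ℂ] (G ⊗[ℂ] A)) (includeRight e))
          (map₃ (AlgHom.id ℂ G) (AlgHom.id ℂ G) i t) := fun t => by
      rw [h3]; exact commute_onRight (commute_onRight hi) t
    have c2 : Commute ((includeRight : _ →ₐ[ℂ] G ⊗[ℂ] (G ⊗[ℂ] A)) (includeRight e))
        (oneTmul T) := hT.map includeRight
    have h1 : ∀ t : G ⊗[ℂ] (G ⊗[ℂ] M), LinearMap.lTensor G (LinearMap.lTensor G r)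
        (map₃ (AlgHom.id ℂ G) (AlgHom.id ℂ G) i t) =
        map₃ (AlgHom.id ℂ G) (AlgHom.id ℂ G) (hr.restrict i hi) t := fun t => by
      induction t with
      | zero => simp
      | add t s ht hs => simp only [map_add, ht, hs]
      | tmul g t =>
        induction t with
        | zero => simp
        | add t s ht hs => simp only [TensorProduct.tmul_add, map_add, ht, hs]
        | tmul g a => rfl
    have c3 : Commute ((includeRight : _ →ₐ[ℂ] G ⊗[ℂ] (G ⊗[ℂ] A)) (includeRight e))
        (leg13 T) := by
      have e1 : (includeRight : _ →ₐ[ℂ] G ⊗[ℂ] (G ⊗[ℂ] A)) (includeRight e) =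
          leg13 (includeRight e) := by simp [leg13, onRight_tmul]
      rw [e1]
      exact hT.map leg13
    rw [hr.tensor.tensor.map_mul (c1 _), hr.tensor.tensor.map_mul c2,
      hr.tensor.tensor.map_mul (c1 _), hr.tensor.tensor.map_mul c3, h1, h1, h1, lTensor_leg13,
      lTensor_onLeft] at h
    simpa [oneTmul] using h

end Corner

section Model

variable {G M A : Type*} [Ring G] [Algebra ℂ G] [FiniteDimensional ℂ G]
  [Ring M] [Algebra ℂ M] [Ring A] [Algebra ℂ A] {H : QuasiHopfAlgebra G}
  {P : QuasiCommutingPair H.toQuasiBialgebra M} {i : M →ₐ[ℂ] A} {L : G ⊗[ℂ] A} {e : A}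
  {D : G ⊗[ℂ] A →ₗ[ℂ] A} (hm : IsModel P i L e D)

include hm

lemma IsModel.isCoherent {B : Type*} [Ring B] [Algebra ℂ B] {r : A →ₗ[ℂ] B} (hr : IsCorner r e) :
    IsCoherent P (hr.restrict i hm.e_comm) (LinearMap.lTensor G r (modelT P i L D)) := by
  refine hr.isCoherent hm.e_comm ?_ hm.killLeft_modelT (fun m => ?_) ?_
  · have e1 := hm.e_mul_modelT (includeLeft : G →ₐ[ℂ] G ⊗[ℂ] A) includeRight
    have e2 := hm.modelT_mul_e (includeLeft : G →ₐ[ℂ] G ⊗[ℂ] A) includeRight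
    rw [tp_std] at e1 e2
    exact e1.trans e2.symm
  · rw [← tp_std (modelT P i L D * _), ← tp_std (_ * modelT P i L D)]
    simpa [tp_onRight, tp_comm] using hm.modelT_intertwine includeLeft includeRight m
  · rw [← tp_std₃ (onLeft H.comul (modelT P i L D)), ← tp_std₃ (_ * _)]
    have := hm.modelT_coherent_std
    rw [modelF] at this
    simpa [tp_onRight, tp_onLeft, tp_map₃, tp_oneTmul, tp_leg13, t3_val, t3_inv_val,
      tp_perm312, tp_perm132] using this.symm

/-- This is the shadow of `μ_L(φ ⊗ m) · 1`: the counit component of `c` commutes with `M`, `T` turns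
it into `c`, and `q_ρ c = L`. -/
lemma IsModel.slice_qRhoOp_mul_modelT (φ : Module.Dual ℂ G) (m : M) :
    slice φ (onRight i (qRhoOp H P) * modelT P i L D) *
      (i m * killLeft H.counit (modelC P i L)) = slice φ L * i m := by
  have e1 : i m * killLeft H.counit (modelC P i L) = killLeft H.counit (modelC P i L) * i m := by
    have := hm.modelC_intertwine (triv H.counit) (AlgHom.id ℂ A) m
    rw [tp_triv_left, la_triv, ra_triv] at this
    exact this.symm
  have e2 := hm.modelT_mul_modelC_triv (includeLeft : G →ₐ[ℂ] G ⊗[ℂ] A) includeRight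
  have e3 := hm.qLeg_mul_modelC (includeLeft : G →ₐ[ℂ] G ⊗[ℂ] A) includeRight
  rw [tp_triv_left, tp_std, tp_std] at e2
  rw [← tp_qRhoOp, tp_std, tp_std, ← tp_onRight, tp_std] at e3
  rw [e1, ← mul_assoc, ← slice_mul_includeRight, mul_assoc (onRight i _), e2, e3]

end Model

/-! ### The regular representation on `Ĝ ⊗ M` and injectivity. -/

section ConcreteModel

/-- The space `Ĝ ⊗ M`. -/
def RegMod (G M : Type*) [Ring G] [Algebra ℂ G] [Ring M] [Algebra ℂ M] := Module.Dual ℂ G ⊗[ℂ] M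

variable {G M : Type*} [Ring G] [Algebra ℂ G] [Ring M] [Algebra ℂ M] {H : QuasiHopfAlgebra G}

instance : AddCommGroup (RegMod G M) := inferInstanceAs (AddCommGroup (Module.Dual ℂ G ⊗[ℂ] M))

instance : Module ℂ (RegMod G M) := inferInstanceAs (Module ℂ (Module.Dual ℂ G ⊗[ℂ] M))

/-- The identification with the tensor product. -/
def RegMod.equiv : Module.Dual ℂ G ⊗[ℂ] M ≃ₗ[ℂ] RegMod G M := LinearEquiv.refl ℂ _

/-- The element `φ ⊗ m`. -/
def RegMod.mk : Module.Dual ℂ G →ₗ[ℂ] M →ₗ[ℂ] RegMod G M := TensorProduct.mk ℂ _ _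

/-- Linear maps out of `Ĝ ⊗ M`. -/
def RegMod.lift {X : Type*} [AddCommGroup X] [Module ℂ X] :
    (Module.Dual ℂ G →ₗ[ℂ] M →ₗ[ℂ] X) →ₗ[ℂ] RegMod G M →ₗ[ℂ] X :=
  TensorProduct.uncurry (.id ℂ) _ _ _

@[simp] lemma RegMod.lift_mk {X : Type*} [AddCommGroup X] [Module ℂ X]
    (f : Module.Dual ℂ G →ₗ[ℂ] M →ₗ[ℂ] X) (φ : Module.Dual ℂ G) (m : M) :
    RegMod.lift f (RegMod.mk φ m) = f φ m := rfl

@[ext high] lemma RegMod.ext {X : Type*} [AddCommGroup X] [Module ℂ X] {f g : RegMod G M →ₗ[ℂ] X}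
    (h : ∀ φ m, f (RegMod.mk φ m) = g (RegMod.mk φ m)) : f = g :=
  TensorProduct.ext' h

variable (G M) in
/-- `g` acts by `φ ⊗ m ↦ φ(· g) ⊗ m`. -/
def actMulRight : G →ₐ[ℂ] Module.End ℂ (RegMod G M) :=
  AlgHom.ofLinearMap
    { toFun := fun g => RegMod.lift (RegMod.mk ∘ₗ Module.Dual.transpose (LinearMap.mulRight ℂ g))
      map_add' := fun g h => by
        ext φ m
        have : φ ∘ₗ LinearMap.mulRight ℂ (g + h) =
          φ ∘ₗ LinearMap.mulRight ℂ g + φ ∘ₗ LinearMap.mulRight ℂ h := by ext; simp [mul_add]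
        simp [Module.Dual.transpose_apply, this]
      map_smul' := fun c g => by
        ext φ m
        have : φ ∘ₗ LinearMap.mulRight ℂ (c • g) = c • φ ∘ₗ LinearMap.mulRight ℂ g := by
          ext; simp
        simp [Module.Dual.transpose_apply, this] }
    (RegMod.ext fun φ m => by simp [Module.Dual.transpose_apply])
    (fun a b => RegMod.ext fun φ m => by
      simp [Module.Dual.transpose_apply, LinearMap.mulRight_mul, LinearMap.comp_assoc])

@[simp] lemma actMulRight_mk (g : G) (φ : Module.Dual ℂ G) (m : M) :
    actMulRight G M g (RegMod.mk φ m) = RegMod.mk (φ ∘ₗ LinearMap.mulRight ℂ g) m := rfl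

variable (M H) in
/-- `g` acts by `φ ⊗ m ↦ φ(S⁻¹(g) ·) ⊗ m`. -/
def actMulLeft : G →ₐ[ℂ] Module.End ℂ (RegMod G M) :=
  AlgHom.ofLinearMap
    { toFun := fun g => RegMod.lift (RegMod.mk ∘ₗ
        Module.Dual.transpose (LinearMap.mulLeft ℂ (H.S.symm g)))
      map_add' := fun g h => by
        ext φ m
        have : φ ∘ₗ LinearMap.mulLeft ℂ (H.S.symm g + H.S.symm h) =
          φ ∘ₗ LinearMap.mulLeft ℂ (H.S.symm g) + φ ∘ₗ LinearMap.mulLeft ℂ (H.S.symm h) := by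
          ext; simp [add_mul]
        simp [Module.Dual.transpose_apply, this]
      map_smul' := fun c g => by
        ext φ m
        have : φ ∘ₗ LinearMap.mulLeft ℂ (c • H.S.symm g) =
          c • φ ∘ₗ LinearMap.mulLeft ℂ (H.S.symm g) := by
          ext; simp
        simp [Module.Dual.transpose_apply, this] }
    (RegMod.ext fun φ m => by simp [H.symm_one, Module.Dual.transpose_apply])
    (fun a b => RegMod.ext fun φ m => by
      simp [Module.Dual.transpose_apply, H.symm_mul, LinearMap.mulLeft_mul, LinearMap.comp_assoc])

@[simp] lemma actMulLeft_mk (g : G) (φ : Module.Dual ℂ G) (m : M) :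
    actMulLeft M H g (RegMod.mk φ m) = RegMod.mk (φ ∘ₗ LinearMap.mulLeft ℂ (H.S.symm g)) m := rfl

variable (G M) in
/-- `n` acts by `φ ⊗ m ↦ φ ⊗ n m`. -/
def actMod : M →ₐ[ℂ] Module.End ℂ (RegMod G M) :=
  AlgHom.ofLinearMap
    { toFun := fun n => RegMod.lift (LinearMap.lcomp ℂ _ (LinearMap.mulLeft ℂ n) ∘ₗ RegMod.mk)
      map_add' := fun a b => by ext φ m; simp [add_mul]
      map_smul' := fun a b => by ext φ m; simp }
    (RegMod.ext fun φ m => by simp)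
    (fun a b => RegMod.ext fun φ m => by simp)

@[simp] lemma actMod_mk (n : M) (φ : Module.Dual ℂ G) (m : M) :
    actMod G M n (RegMod.mk φ m) = RegMod.mk φ (n * m) := rfl

instance : Comm (actMulRight G M) (actMod G M) := ⟨fun _ _ => RegMod.ext fun _ _ => rfl⟩

instance : Comm (actMod G M) (actMulLeft M H) := ⟨fun _ _ => RegMod.ext fun _ _ => rfl⟩

instance : Comm (actMulRight G M) (actMulLeft M H) :=
  ⟨fun a b => RegMod.ext fun φ m => by
    simp only [Module.End.mul_apply, actMulRight_mk, actMulLeft_mk]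
    congr 2
    ext x
    simp [mul_assoc]⟩

variable [FiniteDimensional ℂ G] (P : QuasiCommutingPair H.toQuasiBialgebra M)

/-- The left multiplication of `M` on `Ĝ ⊗ M`. -/
def modIncl : M →ₐ[ℂ] Module.End ℂ (RegMod G M) :=
  ra P (la P (actMulRight G M) (actMod G M)) (actMulLeft M H)

/-- Operators on `Ĝ ⊗ M` together with the auxiliary summand `M`. -/
abbrev BigEnd (G M : Type*) [Ring G] [Algebra ℂ G] [Ring M] [Algebra ℂ M] :=
  Module.End ℂ (RegMod G M × M)

/-- The left multiplication of `M` on `(Ĝ ⊗ M) ⊕ M`. -/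
def bigIncl : M →ₐ[ℂ] BigEnd G M where
  toFun m := (modIncl P m).prodMap (LinearMap.mulLeft ℂ m)
  map_one' := by ext <;> simp
  map_zero' := by ext <;> simp
  map_mul' a b := by ext <;> simp
  map_add' a b := by ext <;> simp [add_mul]
  commutes' c := by ext <;> simp [Algebra.algebraMap_eq_smul_one]

variable (G M) in
/-- The projection onto `Ĝ ⊗ M`. -/
def bigProj : BigEnd G M := LinearMap.inl ℂ _ _ ∘ₗ LinearMap.fst ℂ _ _

variable (G M) in
/-- The operators `(v, m) ↦ (φ ⊗ m, 0)`. -/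
def bigLMap : Module.Dual ℂ G →ₗ[ℂ] BigEnd G M where
  toFun φ := LinearMap.inl ℂ _ _ ∘ₗ RegMod.mk φ ∘ₗ LinearMap.snd ℂ _ _
  map_add' φ ψ := by ext <;> simp
  map_smul' c φ := by ext <;> simp

variable (G M) in
/-- The generating element of the operators `(v, m) ↦ (φ ⊗ m, 0)`. -/
def bigL : G ⊗[ℂ] BigEnd G M := genElt (bigLMap G M)

variable (G M) in
/-- The operators `(φ ⊗ m, n) ↦ (0, φ(g) m)`. -/
def bigEval : G →ₗ[ℂ] BigEnd G M where
  toFun g := LinearMap.inr ℂ _ _ ∘ₗ RegMod.lift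
    (LinearMap.lsmul ℂ M ∘ₗ Module.Dual.eval ℂ G g) ∘ₗ LinearMap.fst ℂ _ _
  map_add' φ ψ := by ext <;> simp
  map_smul' c φ := by ext <;> simp [mul_smul]

variable (G M) in
/-- `g ⊗ x ↦ e x π_g`. -/
def bigD : G ⊗[ℂ] BigEnd G M →ₗ[ℂ] BigEnd G M :=
  TensorProduct.lift (LinearMap.mk₂ ℂ (fun g x => bigProj G M * x * bigEval G M g)
    (fun _ _ _ => by simp [mul_add]) (fun _ _ _ => by simp)
    (fun _ _ _ => by simp [mul_add, add_mul]) (fun _ _ _ => by simp))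

@[simp] lemma bigD_tmul (g : G) (x : BigEnd G M) :
    bigD G M (g ⊗ₜ x) = bigProj G M * x * bigEval G M g := rfl

@[simp] lemma slice_bigL (φ : Module.Dual ℂ G) : slice φ (bigL G M) = bigLMap G M φ :=
  slice_genElt _ _

lemma slice_lop_rop {B : Type*} [Ring B] [Algebra ℂ B] (i : M →ₐ[ℂ] B)
    (φ : Module.Dual ℂ G) (g h : G) (n : M) (t : G ⊗[ℂ] B) :
    slice φ ((includeLeft : G →ₐ[ℂ] G ⊗[ℂ] B) g * (t * tp includeLeft (includeRight.comp i) (h ⊗ₜ n))) =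
      slice (φ ∘ₗ LinearMap.mulLeft ℂ g ∘ₗ LinearMap.mulRight ℂ h) t * i n := by
  induction t with
  | zero => simp
  | tmul a b => simp
  | add t s ht hs => simp only [mul_add, add_mul, map_add, ht, hs]

/-- Multiplying the `G`-leg of `L` on either side amounts to translating the functional `φ`; this
matches the abstract action with the operators on `Ĝ ⊗ M`. -/
lemma slice_act_bigL (φ : Module.Dual ℂ G) (t : M ⊗[ℂ] G) :
    slice φ (act (tp (rop (la P (includeLeft : G →ₐ[ℂ] G ⊗[ℂ] BigEnd G M)
      (includeRight.comp (bigIncl P)))) (lop H includeLeft) t) (bigL G M)) =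
    LinearMap.inl ℂ (RegMod G M) M ∘ₗ
      tp (la P (actMulRight G M) (actMod G M)) (actMulLeft M H) t ∘ₗ
      RegMod.mk φ ∘ₗ LinearMap.snd ℂ _ _ := by
  induction t with
  | zero => ext <;> simp
  | add t s ht hs =>
    simp only [map_add, act_add, ht, hs]
    ext <;> simp
  | tmul m g =>
    rw [tp_rop_lop_tmul, tp_tmul, AlgHom.comp_apply, AlgHom.comp_apply]
    generalize P.lam m = t
    induction t with
    | zero => ext <;> simp
    | add t s ht hs =>
      simp only [map_add, mul_add, add_mul, ht, hs]
      ext <;> simp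
    | tmul h n =>
      rw [slice_lop_rop, slice_bigL, tp_tmul]
      ext <;> simp [bigLMap, bigIncl]
      rfl

/-- The extra summand `M` makes `m ↦ φ ⊗ m` an operator in the same algebra. The bimodule equation
holds because the action of `M` on `Ĝ ⊗ M` was defined by it. -/
lemma bigIsModel : IsModel P (bigIncl P) (bigL G M) (bigProj G M) (bigD G M) where
  act_rho m := slice_ext fun φ => by
    rw [slice_act_bigL, slice_includeRight_mul, slice_bigL]
    refine LinearMap.ext fun v => ?_
    simp [bigIncl, bigLMap, modIncl]
  e_comm m := by
    refine LinearMap.ext fun v => ?_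
    simp [bigProj, bigIncl]
  e_mul_self := rfl
  e_L φ := by rw [slice_bigL]; rfl
  L_e φ := by
    rw [slice_bigL]
    ext <;> simp [bigLMap, bigProj]
  faithful F he hF := by
    rw [← he]
    ext φ m
    · have := congrArg (fun X : BigEnd G M => X (0, m)) (hF φ)
      simp [bigLMap] at this
      simp [bigProj, this]
    · have := congrArg (fun X : BigEnd G M => X (0, m)) (hF φ)
      simp [bigLMap] at this
      simp [bigProj, this]
    · have h0 : F (0, 0) = 0 := map_zero F
      simp [bigProj, h0]
    · have h0 : F (0, 0) = 0 := map_zero F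
      simp [bigProj, h0]
  D_L t φ := by
    induction t with
    | zero => simp
    | add t s ht hs => simp only [map_add, mul_add, add_mul, ht, hs]
    | tmul g x =>
      rw [slice_bigL, bigD_tmul, slice_tmul, mul_assoc]
      -- Evaluation at `g` after insertion of `φ` is the scalar `φ(g)` on the summand `M`, so `D`
      -- inverts multiplication by `L`.
      have : bigEval G M g * bigLMap G M φ = φ g • (1 - bigProj G M) := by
        ext <;> simp [bigEval, bigLMap, bigProj]
      rw [this]
      simp
  D_e t := by
    induction t with
    | zero => simp
    | add t s ht hs => simp only [map_add, add_mul, ht, hs]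
    | tmul g x => rfl
  e_D t := by
    induction t with
    | zero => simp
    | add t s ht hs => simp only [map_add, mul_add, ht, hs]
    | tmul g x => rfl

variable (G M) in
/-- The compression to `Ĝ ⊗ M`. -/
def bigCorner : BigEnd G M →ₗ[ℂ] Module.End ℂ (RegMod G M) :=
  LinearMap.lcomp ℂ _ (LinearMap.inl ℂ _ _) ∘ₗ LinearMap.llcomp ℂ _ _ _ (LinearMap.fst ℂ _ _)

lemma bigCorner_isCorner : IsCorner (bigCorner G M) (bigProj G M) where
  map_mul_e_mul _ _ := rfl
  map_one := rfl

/-- The regular representation of the diagonal crossed product on `Ĝ ⊗ M`. -/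
def regRep : DiagonalCrossedProduct P →ₐ[ℂ] Module.End ℂ (RegMod G M) :=
  ((bigIsModel P).isCoherent bigCorner_isCorner).lift

/-- The vector of the regular representation corresponding to the unit. -/
def regUnit : RegMod G M :=
  (killLeft H.counit (modelC P (bigIncl P) (bigL G M)) (0, 1)).1

/-- Evaluation on the unit vector is a left inverse of `μ_L`; hence injectivity. -/
lemma regRep_muL (t : Module.Dual ℂ G ⊗[ℂ] M) :
    regRep P (muL H P t) (regUnit P) = RegMod.equiv t := by
  induction t with
  | zero => simp
  | add t s ht hs => simp only [map_add, LinearMap.add_apply, ht, hs]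
  | tmul φ m =>
    have hm := bigIsModel P
    have hc := hm.isCoherent bigCorner_isCorner
    have e1 : muL H P (φ ⊗ₜ m) =
      slice φ (onRight P.incl (qRhoOp H P) * P.univ) * P.incl m := rfl
    have e2 : onRight (regRep P) (onRight P.incl (qRhoOp H P) * P.univ) =
        LinearMap.lTensor G (bigCorner G M) (onRight (bigIncl P) (qRhoOp H P) *
          modelT P (bigIncl P) (bigL G M) (bigD G M)) := by
      have hT : Commute ((includeRight : _ →ₐ[ℂ] G ⊗[ℂ] BigEnd G M) (bigProj G M))
          (modelT P (bigIncl P) (bigL G M) (bigD G M)) := by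
        have e1 := hm.e_mul_modelT (includeLeft : G →ₐ[ℂ] G ⊗[ℂ] BigEnd G M) includeRight
        have e2 := hm.modelT_mul_e (includeLeft : G →ₐ[ℂ] G ⊗[ℂ] BigEnd G M) includeRight
        rw [tp_std] at e1 e2
        exact e1.trans e2.symm
      rw [(bigCorner_isCorner (G := G) (M := M)).tensor.map_mul hT, map_mul, regRep, hc.lift_univ]
      congr 1
      generalize qRhoOp H P = t
      induction t with
      | zero => simp
      | add t s ht hs => simp only [map_add, ht, hs]
      | tmul g m => simp only [onRight_tmul, hc.lift_incl]; rfl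
    rw [e1, map_mul, map_slice_alg, e2, ← map_slice, regRep, hc.lift_incl]
    have e3 := congrArg (fun X : BigEnd G M => (X (0, 1)).1) (hm.slice_qRhoOp_mul_modelT φ m)
    have e4 : killLeft H.counit (modelC P (bigIncl P) (bigL G M)) (0, 1) = (regUnit P, 0) := by
      have := hm.e_mul_modelC (triv H.counit) (AlgHom.id ℂ (BigEnd G M))
      rw [tp_triv_left] at this
      exact (congrArg (fun X : BigEnd G M => X (0, 1)) this).symm
    simp only [Module.End.mul_apply, e4, slice_bigL] at e3
    rw [Module.End.mul_apply]
    refine (congrArg (fun w => (slice φ (onRight (bigIncl P) (qRhoOp H P) *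
      modelT P (bigIncl P) (bigL G M) (bigD G M)) w).1) ?_).trans (e3.trans ?_)
    · exact Prod.ext rfl (by simp [bigIncl])
    · simp [bigLMap, bigIncl]
      rfl

theorem muL_injective : Function.Injective (muL H P) :=
  Function.LeftInverse.injective (g := fun x => RegMod.equiv.symm (regRep P x (regUnit P)))
    fun t => by simp [regRep_muL]

lemma muL_mul_incl (φ : Module.Dual ℂ G) (m : M) :
    muL H P (φ ⊗ₜ 1) * P.incl m = muL H P (φ ⊗ₜ m) := by
  have e1 : ∀ m, muL H P (φ ⊗ₜ m) =
    slice φ (onRight P.incl (qRhoOp H P) * P.univ) * P.incl m := fun _ => rfl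
  rw [e1, e1, map_one, mul_one]

theorem incl_injective : Function.Injective P.incl := by
  rw [injective_iff_map_eq_zero]
  intro m hm
  -- If `m` dies in `M₁` then `μ_L(ε ⊗ m) = 0`, so `ε ⊗ m = 0`; evaluating the functional at `1`
  -- gives `m = 0`.
  have e := muL_mul_incl P H.counit.toLinearMap m
  rw [hm, mul_zero, eq_comm, map_eq_zero_iff _ (muL_injective P)] at e
  have := congrArg ((TensorProduct.lid ℂ M).toLinearMap ∘ₗ LinearMap.rTensor M (Module.Dual.eval ℂ G 1)) e
  simpa using this

end ConcreteModel

/-! ### Subspaces stable under multiplication by legs. -/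

section Closed

variable {R A B G X : Type*} [Ring R] [Algebra ℂ R] [Ring A] [Algebra ℂ A] [Ring B] [Algebra ℂ B]
  [Ring G] [Algebra ℂ G] [AddCommGroup X] [Module ℂ X]

/-- A subspace is closed under left multiplication by the image of `f`. -/
def LeftClosed (f : A →ₐ[ℂ] R) (N : Submodule ℂ R) : Prop := ∀ a, ∀ y ∈ N, f a * y ∈ N

/-- A subspace is closed under right multiplication by the image of `f`. -/
def RightClosed (f : A →ₐ[ℂ] R) (N : Submodule ℂ R) : Prop := ∀ a, ∀ y ∈ N, y * f a ∈ N

variable {N : Submodule ℂ R} {f : A →ₐ[ℂ] R} {g : B →ₐ[ℂ] R}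

lemma LeftClosed.tp [Comm f g] (hf : LeftClosed f N) (hg : LeftClosed g N) :
    LeftClosed (tp f g) N := by
  intro t y hy
  induction t with
  | zero => simp
  | add t s ht hs => rw [map_add, add_mul]; exact N.add_mem ht hs
  | tmul a b => rw [tp_tmul, mul_assoc]; exact hf _ _ (hg _ _ hy)

lemma RightClosed.tp [Comm f g] (hf : RightClosed f N) (hg : RightClosed g N) :
    RightClosed (tp f g) N := by
  intro t y hy
  induction t with
  | zero => simp
  | add t s ht hs => rw [map_add, mul_add]; exact N.add_mem ht hs
  | tmul a b => rw [tp_tmul, ← mul_assoc]; exact hg _ _ (hf _ _ hy)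

lemma LeftClosed.comp {C : Type*} [Ring C] [Algebra ℂ C] (hf : LeftClosed f N) (u : C →ₐ[ℂ] A) :
    LeftClosed (f.comp u) N := fun a => hf (u a)

lemma RightClosed.comp {C : Type*} [Ring C] [Algebra ℂ C] (hf : RightClosed f N) (u : C →ₐ[ℂ] A) :
    RightClosed (f.comp u) N := fun a => hf (u a)

lemma act_mem {H : QuasiHopfAlgebra G} {j : G →ₐ[ℂ] R} (hf : RightClosed f N)
    (hj : LeftClosed j N) (t : A ⊗[ℂ] G) {y : R} (hy : y ∈ N) :
    act (tp (rop f) (lop H j) t) y ∈ N := by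
  induction t with
  | zero => simp
  | add t s ht hs => rw [map_add, act_add]; exact N.add_mem ht hs
  | tmul a b => rw [tp_rop_lop_tmul]; exact hj _ _ (hf _ _ hy)

lemma act₃_mem {H : QuasiHopfAlgebra G} {j : G →ₐ[ℂ] R} [Comm f g] (hf : RightClosed f N)
    (hg : RightClosed g N) (hj : LeftClosed j N) (t : A ⊗[ℂ] (B ⊗[ℂ] G)) {y : R} (hy : y ∈ N) :
    act (tp (rop f) (tp (rop g) (lop H j)) t) y ∈ N := by
  induction t with
  | zero => simp
  | add t s ht hs => rw [map_add, act_add]; exact N.add_mem ht hs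
  | tmul a b => rw [tp_tmul, act_mul]; exact act_mem hg hj _ (hf _ _ hy)

variable (G) in
/-- The subspace `G ⊗ N` of `G ⊗ X`. -/
def tensorSub (N : Submodule ℂ X) : Submodule ℂ (G ⊗[ℂ] X) where
  carrier := {t | ∀ φ : Module.Dual ℂ G, slice φ t ∈ N}
  add_mem' ht hs φ := by rw [map_add]; exact N.add_mem (ht φ) (hs φ)
  zero_mem' φ := by rw [map_zero]; exact N.zero_mem
  smul_mem' c t ht φ := by rw [map_smul]; exact N.smul_mem c (ht φ)

lemma slice_includeLeft_mul (φ : Module.Dual ℂ G) (a : G) (t : G ⊗[ℂ] R) :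
    slice φ ((includeLeft : G →ₐ[ℂ] G ⊗[ℂ] R) a * t) = slice (φ ∘ₗ LinearMap.mulLeft ℂ a) t := by
  induction t with
  | zero => simp
  | tmul g x => simp
  | add t s ht hs => simp only [mul_add, map_add, ht, hs]

lemma slice_mul_includeLeft (φ : Module.Dual ℂ G) (a : G) (t : G ⊗[ℂ] R) :
    slice φ (t * (includeLeft : G →ₐ[ℂ] G ⊗[ℂ] R) a) = slice (φ ∘ₗ LinearMap.mulRight ℂ a) t := by
  induction t with
  | zero => simp
  | tmul g x => simp
  | add t s ht hs => simp only [add_mul, map_add, ht, hs]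

lemma leftClosed_includeLeft :
    LeftClosed (includeLeft : G →ₐ[ℂ] G ⊗[ℂ] R) (tensorSub G N) := fun a t ht φ => by
  rw [slice_includeLeft_mul]; exact ht _

lemma rightClosed_includeLeft :
    RightClosed (includeLeft : G →ₐ[ℂ] G ⊗[ℂ] R) (tensorSub G N) := fun a t ht φ => by
  rw [slice_mul_includeLeft]; exact ht _

lemma LeftClosed.tensor (hf : LeftClosed f N) :
    LeftClosed ((includeRight : R →ₐ[ℂ] G ⊗[ℂ] R).comp f) (tensorSub G N) := fun a t ht φ => by
  rw [AlgHom.comp_apply, slice_includeRight_mul]; exact hf _ _ (ht _)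

lemma RightClosed.tensor (hf : RightClosed f N) :
    RightClosed ((includeRight : R →ₐ[ℂ] G ⊗[ℂ] R).comp f) (tensorSub G N) := fun a t ht φ => by
  rw [AlgHom.comp_apply, slice_mul_includeRight]; exact hf _ _ (ht _)

/-- Two slices of a coproduct form a single slice by the product of the two functionals. -/
lemma tp_mu_mem (Q : QuasiBialgebra G) {y : G ⊗[ℂ] R} (hy : y ∈ tensorSub G N) :
    tp (mu Q leg₁ leg₂) leg₃ y ∈ tensorSub G (tensorSub G N) := by
  intro φ ψ
  have : slice ψ (slice φ (tp (mu Q leg₁ leg₂) (leg₃ : R →ₐ[ℂ] G ⊗[ℂ] (G ⊗[ℂ] R)) y)) =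
      slice (ψ ∘ₗ slice φ ∘ₗ Q.comul.toLinearMap) y := by
    clear hy
    induction y with
    | zero => simp
    | add t s ht hs => simp only [map_add, ht, hs]
    | tmul g a =>
      rw [tp_tmul, slice_tmul, AlgHom.comp_apply]
      simp only [LinearMap.comp_apply, AlgHom.toLinearMap_apply]
      generalize Q.comul g = t
      induction t with
      | zero => simp
      | add t s ht hs => simp only [map_add, add_mul, add_smul, ht, hs]
      | tmul b c => simp [mul_smul]
  rw [this]
  exact hy _

/-- Slicing distinct `G`-legs separates the factors, so all products `Γ(φ) · (q_ρ Γ)(ψ)` are handled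
by one tensor. -/
lemma slice_slice_mul (φ ψ : Module.Dual ℂ G) (s t : G ⊗[ℂ] R) :
    slice ψ (slice φ (tp leg₁ leg₃ s * tp leg₂ leg₃ t : G ⊗[ℂ] (G ⊗[ℂ] R))) =
      slice φ s * slice ψ t := by
  have e1 : (tp leg₂ leg₃ t : G ⊗[ℂ] (G ⊗[ℂ] R)) = (1 : G) ⊗ₜ[ℂ] t := by
    have := map_tp (includeRight : G ⊗[ℂ] R →ₐ[ℂ] G ⊗[ℂ] (G ⊗[ℂ] R)) includeLeft includeRight t
    rw [tp_std] at this
    exact this.symm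
  rw [e1]
  induction s with
  | zero => simp
  | add t s ht hs => simp only [map_add, add_mul, ht, hs]
  | tmul g a =>
    have e2 : (tp leg₁ leg₃ (g ⊗ₜ[ℂ] a) : G ⊗[ℂ] (G ⊗[ℂ] R)) = g ⊗ₜ[ℂ] (includeRight a) := by
      simp
    rw [e2, Algebra.TensorProduct.tmul_mul_tmul, mul_one, slice_tmul, map_smul,
      slice_includeRight_mul, slice_tmul, smul_mul_assoc]

end Closed

/-! ### The range of `μ_L` is a left ideal containing the unit. -/

section Surjective

-- The identity `act_φlr_mul_qLeg_mul` solved for the product `F (q_ρ c)` by inverting the action of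
-- `φ_λρ`.
variable {R : Type*} [Ring R] [Algebra ℂ R] {G M : Type*} [Ring G] [Algebra ℂ G]
  [Ring M] [Algebra ℂ M] {H : QuasiHopfAlgebra G}
  {P : QuasiCommutingPair H.toQuasiBialgebra M} {u j : G →ₐ[ℂ] R} {h : M →ₐ[ℂ] R} in
lemma mul_qLeg_mul_eq [FiniteDimensional ℂ G] [Comm h j] [Comm u j] [Comm u h]
    {h₂ : M →ₐ[ℂ] R} [Comm h₂ j] {F c : R} (hF : ∀ g, Commute F (j g))
    (hF₂ : ∀ m, F * la P u h m = h₂ m * F) (hcu : ∀ g, Commute c (u g))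
    (hc : ∀ m, c * la P j h m = ra P h j m * c) :
    F * (qLeg P j h * c) = act (tp (rop u) (tp (rop (la P j h)) (lop H j)) P.φlr⁻¹.val)
      (qLeg P j h₂ * (F * (((t3 u h j P.φlr)⁻¹ : Rˣ) * c))) := by
  have e := congrArg (act ((t3 (rop u) (rop (la P j h)) (lop H j) P.φlr)⁻¹ : (OpEnd R)ˣ))
    (act_φlr_mul_qLeg_mul hF hF₂ hcu hc)
  rwa [← act_mul, Units.mul_inv, act_one, t3_inv_val] at e

variable {G M : Type*} [Ring G] [Algebra ℂ G] [FiniteDimensional ℂ G]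
  [Ring M] [Algebra ℂ M] {H : QuasiHopfAlgebra G} (P : QuasiCommutingPair H.toQuasiBialgebra M)

/-- The element `q_ρ Γ`. -/
def qUniv : G ⊗[ℂ] DiagonalCrossedProduct P := onRight P.incl (qRhoOp H P) * P.univ

lemma muL_tmul (φ : Module.Dual ℂ G) (m : M) :
    muL H P (φ ⊗ₜ m) = slice φ (qUniv P) * P.incl m := rfl

lemma tp_qUniv {R : Type*} [Ring R] [Algebra ℂ R] (j : G →ₐ[ℂ] R)
    (x : DiagonalCrossedProduct P →ₐ[ℂ] R) [Comm j x] :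
    tp j x (qUniv P) = qLeg P j (x.comp P.incl) * tp j x P.univ := by
  rw [qUniv, map_mul, tp_onRight, tp_qRhoOp]

lemma rightClosed_range_muL : RightClosed P.incl (LinearMap.range (muL H P)) := by
  rintro n _ ⟨t, rfl⟩
  induction t with
  | zero => simp
  | add t s ht hs => rw [map_add, add_mul]; exact Submodule.add_mem _ ht hs
  | tmul φ m => exact ⟨φ ⊗ₜ (m * n), by rw [muL_tmul, muL_tmul, map_mul, mul_assoc]⟩

lemma qUniv_mem : qUniv P ∈ tensorSub G (LinearMap.range (muL H P)) :=
  fun φ => ⟨φ ⊗ₜ 1, by rw [muL_tmul, map_one, mul_one]⟩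

lemma act_mem_tensorSub (t : M ⊗[ℂ] G) {y : G ⊗[ℂ] DiagonalCrossedProduct P}
    (hy : y ∈ tensorSub G (LinearMap.range (muL H P))) :
    act (tp (rop (la P includeLeft (includeRight.comp P.incl))) (lop H includeLeft) t) y ∈
      tensorSub G (LinearMap.range (muL H P)) :=
  act_mem ((rightClosed_includeLeft.tp (rightClosed_range_muL P).tensor).comp _)
    leftClosed_includeLeft t hy

/-- Left multiplications preserving the range of `μ_L` can be tested on the generators. -/
lemma mul_mem_range_muL {x : DiagonalCrossedProduct P}
    (hx : ∀ φ, x * slice φ (qUniv P) ∈ LinearMap.range (muL H P)) {y : DiagonalCrossedProduct P}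
    (hy : y ∈ LinearMap.range (muL H P)) : x * y ∈ LinearMap.range (muL H P) := by
  obtain ⟨t, rfl⟩ := hy
  induction t with
  | zero => simp
  | add t s ht hs => rw [map_add, mul_add]; exact Submodule.add_mem _ ht hs
  | tmul φ m => rw [muL_tmul, ← mul_assoc]; exact rightClosed_range_muL P _ _ (hx φ)

/-- The twisted bimodule equation rewrites `m · (q_ρ Γ)` with `G` acting on the `G`-leg and `M`
multiplying on the right. -/
lemma leftClosed_range_muL : LeftClosed P.incl (LinearMap.range (muL H P)) := by
  intro m y hy
  refine mul_mem_range_muL P (fun φ => ?_) hy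
  have e1 := tp_qUniv P (includeLeft : G →ₐ[ℂ] G ⊗[ℂ] DiagonalCrossedProduct P) includeRight
  have e2 := act_rho_qLeg_mul (P := P)
    (fun m => (univ_coherent P).intertwine_legs includeLeft includeRight m) m
  rw [← e1, tp_std] at e2
  rw [← slice_includeRight_mul]
  exact (congrArg (slice φ) e2) ▸ act_mem_tensorSub P (P.rho m) (qUniv_mem P) φ

/-- `Γ` is recovered from `q_ρ Γ` by means of `p_ρ`, using only multiplications that preserve the
range. -/
lemma univ_mem : P.univ ∈ tensorSub G (LinearMap.range (muL H P)) := by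
  have e1 := tp_qUniv P (includeLeft : G →ₐ[ℂ] G ⊗[ℂ] DiagonalCrossedProduct P) includeRight
  have e2 := act_pRho_qLeg_mul (P := P)
    (fun m => (univ_coherent P).intertwine_legs includeLeft includeRight m)
  rw [← e1, tp_std, tp_std] at e2
  exact e2 ▸ act_mem_tensorSub P (pRho P) (qUniv_mem P)

/-- By coherence the product of two universal intertwiners is expressed through the single
intertwiner `(Δ ⊗ id)(Γ)`; the other operations are multiplications by `G` and `M`. -/
lemma univ_mul_qUniv_mem :
    (tp leg₁ leg₃ P.univ * tp leg₂ leg₃ (qUniv P) :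
        G ⊗[ℂ] (G ⊗[ℂ] DiagonalCrossedProduct P)) ∈
      tensorSub G (tensorSub G (LinearMap.range (muL H P))) := by
  set V := LinearMap.range (muL H P)
  have l₁ : LeftClosed leg₁ (tensorSub G (tensorSub G V)) := leftClosed_includeLeft
  have l₂ : LeftClosed leg₂ (tensorSub G (tensorSub G V)) := leftClosed_includeLeft.tensor
  have l₃ : LeftClosed (leg₃.comp P.incl) (tensorSub G (tensorSub G V)) :=
    (leftClosed_range_muL P).tensor.tensor
  have r₁ : RightClosed leg₁ (tensorSub G (tensorSub G V)) := rightClosed_includeLeft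
  have r₂ : RightClosed leg₂ (tensorSub G (tensorSub G V)) := rightClosed_includeLeft.tensor
  have r₃ : RightClosed (leg₃.comp P.incl) (tensorSub G (tensorSub G V)) :=
    (rightClosed_range_muL P).tensor.tensor
  have e1 := mul_qLeg_mul_eq (P := P) (u := leg₁) (j := leg₂) (h := leg₃.comp P.incl)
    (h₂ := ra P (leg₃.comp P.incl) leg₁)
    (fun g => Comm.commute (f := tp leg₁ leg₃) (g := leg₂) P.univ g)
    ((univ_coherent P).intertwine_legs leg₁ leg₃)
    (fun g => Comm.commute (f := tp leg₂ leg₃) (g := leg₁) P.univ g)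
    ((univ_coherent P).intertwine_legs leg₂ leg₃)
  have e2 := (univ_coherent P).coherent_legs leg₁ leg₂
    (leg₃ : DiagonalCrossedProduct P →ₐ[ℂ] G ⊗[ℂ] (G ⊗[ℂ] DiagonalCrossedProduct P))
  -- The coherence relation with the outer factors `φ_ρ` and `φ_λ` moved to the other side.
  have e3 : (tp leg₁ leg₃ P.univ : G ⊗[ℂ] (G ⊗[ℂ] DiagonalCrossedProduct P)) *
      ((t3 leg₁ (leg₃.comp P.incl) leg₂ P.φlr)⁻¹.val *
        (tp leg₂ leg₃ P.univ : G ⊗[ℂ] (G ⊗[ℂ] DiagonalCrossedProduct P))) =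
      (t3 (leg₃.comp P.incl) leg₁ leg₂ P.φr)⁻¹.val *
        ((tp (mu H.toQuasiBialgebra leg₁ leg₂) leg₃ P.univ :
          G ⊗[ℂ] (G ⊗[ℂ] DiagonalCrossedProduct P)) *
          (t3 leg₁ leg₂ (leg₃.comp P.incl) P.φl)⁻¹.val) := by
    rw [e2]
    simp only [mul_assoc, Units.mul_inv, mul_one, Units.inv_mul_cancel_left]
  rw [e3, ← tp_qUniv] at e1
  rw [e1, t3_inv_val, t3_inv_val]
  refine act₃_mem r₁ ((r₂.tp r₃).comp _) l₂ _ ?_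
  rw [← tp_qRhoOp]
  refine (l₂.tp ((l₃.tp l₁).comp _)) _ _ ?_
  refine (l₃.tp (l₁.tp l₂)) _ _ ?_
  exact (r₁.tp (r₂.tp r₃)) _ _ (tp_mu_mem _ (univ_mem P))

lemma Γ_mul_mem (φ : Module.Dual ℂ G) {y : DiagonalCrossedProduct P}
    (hy : y ∈ LinearMap.range (muL H P)) : P.Γ φ * y ∈ LinearMap.range (muL H P) := by
  refine mul_mem_range_muL P (fun ψ => ?_) hy
  rw [← slice_univ, ← slice_slice_mul]
  exact univ_mul_qUniv_mem P φ ψ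

lemma one_mem_range_muL : 1 ∈ LinearMap.range (muL H P) := by
  have := univ_mem P H.counit.toLinearMap
  rwa [slice_eq_killLeft, (univ_coherent P).normal] at this

/-- Stability under the generators gives stability under the whole algebra; applied to `1` this
yields surjectivity. -/
lemma proj_mul_mem (x : PreAlg G M) : ∀ y ∈ LinearMap.range (muL H P),
    P.proj x * y ∈ LinearMap.range (muL H P) := by
  induction x using TensorAlgebra.induction with
  | algebraMap r =>
    intro y hy
    rw [AlgHom.commutes, ← Algebra.smul_def]
    exact Submodule.smul_mem _ r hy
  | ι x =>
    intro y hy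
    have : P.proj (TensorAlgebra.ι ℂ x) = P.incl x.1 + P.Γ x.2 := by
      rw [← proj_preIncl]
      simp only [QuasiCommutingPair.Γ, preΓ, preIncl, LinearMap.comp_apply,
        AlgHom.toLinearMap_apply]
      rw [← map_add, ← map_add]
      simp
    rw [this, add_mul]
    exact Submodule.add_mem _ (leftClosed_range_muL P _ _ hy) (Γ_mul_mem P _ hy)
  | mul a b ha hb =>
    intro y hy
    rw [map_mul, mul_assoc]
    exact ha _ (hb _ hy)
  | add a b ha hb =>
    intro y hy
    rw [map_add, add_mul]
    exact Submodule.add_mem _ (ha _ hy) (hb _ hy)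

theorem muL_surjective : Function.Surjective (muL H P) := by
  intro x
  obtain ⟨y, rfl⟩ := RingQuot.mkAlgHom_surjective ℂ (Rel P) x
  have := proj_mul_mem P y 1 (one_mem_range_muL P)
  rwa [mul_one] at this

end Surjective

/-! ### Uniqueness of the structure maps and the formula in `D(G)^{⊗3}`. -/

section Uniqueness

universe u v

variable {G : Type u} [Ring G] [Algebra ℂ G] [FiniteDimensional ℂ G] (H : QuasiHopfAlgebra G)
  {M : Type v} [Ring M] [Algebra ℂ M] (P : QuasiCommutingPair H.toQuasiBialgebra M)

/-- The two conditions prescribe the values on `G` and on the universal element, hence on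
generators. -/
lemma isCounitD_iff (eps : QuantumDouble H →ₐ[ℂ] ℂ) :
    IsCounitD H eps ↔ eps = (doubleQuasiBialgebra H.toQuasiBialgebra).counit := by
  have key : ∀ f : QuantumDouble H →ₐ[ℂ] ℂ,
      killRight f (flipD H) = Algebra.TensorProduct.rid ℂ ℂ G (onRight f (flipD H)) :=
    fun f => rfl
  have h : IsCounitD H (doubleQuasiBialgebra H.toQuasiBialgebra).counit := by
    refine ⟨DFunLike.congr_fun (counitD_incl (Q := H.toQuasiBialgebra)), ?_⟩
    rw [key, double_counit, flipD, counitD, IsCoherent.lift_univ, map_one]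
  refine ⟨fun h' => dcp_hom_ext (fun a => (h'.1 a).trans (h.1 a).symm) ?_, fun e => e ▸ h⟩
  have e := h'.2.trans h.2.symm
  rw [key, key] at e
  exact (Algebra.TensorProduct.rid ℂ ℂ G).injective e

lemma isLamD_iff (l : DiagonalCrossedProduct P →ₐ[ℂ] QuantumDouble H ⊗[ℂ] DiagonalCrossedProduct P) :
    IsLamD H P l ↔ l = (doublePair P).lam := by
  have h : IsLamD H P (doublePair P).lam :=
    ⟨(lamT_coherent (univ_coherent _) (univ_coherent P)).lift_incl,
      (lamT_coherent (univ_coherent _) (univ_coherent P)).lift_univ⟩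
  exact ⟨fun h' => dcp_hom_ext (fun a => (h'.1 a).trans (h.1 a).symm) (h'.2.trans h.2.symm),
    fun e => e ▸ h⟩

lemma isRhoD_iff (r : DiagonalCrossedProduct P →ₐ[ℂ] DiagonalCrossedProduct P ⊗[ℂ] QuantumDouble H) :
    IsRhoD H P r ↔ r = (doublePair P).rho := by
  have h : IsRhoD H P (doublePair P).rho :=
    ⟨(rhoT_coherent (univ_coherent _) (univ_coherent P)).lift_incl,
      (rhoT_coherent (univ_coherent _) (univ_coherent P)).lift_univ⟩
  exact ⟨fun h' => dcp_hom_ext (fun a => (h'.1 a).trans (h.1 a).symm) (h'.2.trans h.2.symm),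
    fun e => e ▸ h⟩

lemma isComulD_iff (Δ : QuantumDouble H →ₐ[ℂ] QuantumDouble H ⊗[ℂ] QuantumDouble H) :
    IsComulD H Δ ↔ Δ = (doubleQuasiBialgebra H.toQuasiBialgebra).comul :=
  isLamD_iff H H.toQuasiBialgebra.selfPair Δ

/-- The image under `i_D` on the first leg of the formula that characterizes `Δ_D` in `G ⊗ D(G) ⊗
D(G)`. -/
lemma map_iD_comul_flipD :
    Algebra.TensorProduct.map (iD H) (doubleQuasiBialgebra H.toQuasiBialgebra).comul (flipD H) =
      perm231 (φD H)⁻¹.val * leg13 (flipDD H) * perm213 (φD H).val * leg12 (flipDD H) *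
        (φD H)⁻¹.val := by
  have e := ((isComulD_iff H _).2 rfl).2
  have e1 : ∀ x, Algebra.TensorProduct.map (iD H)
      (doubleQuasiBialgebra H.toQuasiBialgebra).comul x =
      Algebra.TensorProduct.map (iD H) (AlgHom.id ℂ _)
        (onRight (doubleQuasiBialgebra H.toQuasiBialgebra).comul x) := by
    intro x
    rw [onRight, ← AlgHom.comp_apply, ← Algebra.TensorProduct.map_comp]
    rfl
  have e2 : (φD H)⁻¹.val = map₃ (iD H) (iD H) (iD H) H.reassoc⁻¹.val := rfl
  have e3 : (φD H).val = map₃ (iD H) (iD H) (iD H) H.reassoc.val := rfl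
  have e4 : ∀ x : G ⊗[ℂ] (QuantumDouble H ⊗[ℂ] QuantumDouble H),
      tp leg₁ (tp leg₂ leg₃) (Algebra.TensorProduct.map (iD H) (AlgHom.id ℂ _) x) =
      (tp (leg₁.comp (iD H)) (tp leg₂ leg₃) x :
        QuantumDouble H ⊗[ℂ] (QuantumDouble H ⊗[ℂ] QuantumDouble H)) :=
    fun x => DFunLike.congr_fun (tp_map _ _ _ _) x
  have e5 : ∀ {S : Type u} [Ring S] [Algebra ℂ S] (f g : QuantumDouble H →ₐ[ℂ] S) [Comm f g],
      tp f g (flipDD H) = tp (f.comp (iD H)) g (flipD H) :=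
    fun f g _ => DFunLike.congr_fun (tp_map _ _ _ _) _
  rw [e1, e, ← tp_std₃ (Algebra.TensorProduct.map _ _ _),
    ← tp_std₃ (perm231 (φD H)⁻¹.val * _ * _ * _ * _), e4, e2, e3]
  simp [tp_map₃, tp_leg13, tp_leg12, tp_perm231, tp_perm213, e5]

end Uniqueness

end QuasiHopf

end

open QuasiHopf in
open scoped TensorProduct in
theorem theorem11p3 {G : Type*} [Ring G] [Algebra ℂ G] [FiniteDimensional ℂ G]
    (H : QuasiHopfAlgebra G) :
    -- `i_D` is an embedding and `D(G)` is modelled on the vector space `Ĝ ⊗ G`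
    Function.Injective (iD H) ∧
    Function.Bijective (muL H H.toQuasiBialgebra.selfPair) ∧
    -- (i) the quasi-bialgebra `(D(G), Δ_D, ε_D, φ_D)`
    ∃ QD : QuasiBialgebra (QuantumDouble H),
      QD.reassoc = φD H ∧
      (IsCounitD H QD.counit ∧ ∀ eps, IsCounitD H eps → eps = QD.counit) ∧
      (IsComulD H QD.comul ∧ ∀ Δ, IsComulD H Δ → Δ = QD.comul) ∧
      Algebra.TensorProduct.map (iD H) QD.comul (flipD H) =
        perm231 (φD H)⁻¹.val * leg13 (flipDD H) * perm213 (φD H).val * leg12 (flipDD H) *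
          (φD H)⁻¹.val ∧
      -- (ii) the quasi-commuting pair of `D(G)`-coactions on every diagonal crossed product
      ∀ {M : Type*} [Ring M] [Algebra ℂ M] (P : QuasiCommutingPair H.toQuasiBialgebra M),
        Function.Injective P.incl ∧
        Function.Bijective (muL H P) ∧
        ∃ PD : QuasiCommutingPair QD (DiagonalCrossedProduct P),
          (IsLamD H P PD.lam ∧ ∀ l, IsLamD H P l → l = PD.lam) ∧
          (IsRhoD H P PD.rho ∧ ∀ r, IsRhoD H P r → r = PD.rho) ∧
          PD.φl = Units.map (map₃ (iD H) (iD H) P.incl) P.φl ∧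
          PD.φr = Units.map (map₃ P.incl (iD H) (iD H)) P.φr ∧
          PD.φlr = Units.map (map₃ (iD H) P.incl (iD H)) P.φlr := by
  refine ⟨incl_injective _, ⟨muL_injective _, muL_surjective _⟩,
    doubleQuasiBialgebra H.toQuasiBialgebra, rfl,
    ⟨(isCounitD_iff H _).2 rfl, fun _ => (isCounitD_iff H _).1⟩,
    ⟨(isComulD_iff H _).2 rfl, fun _ => (isComulD_iff H _).1⟩, map_iD_comul_flipD H, ?_⟩
  intro M _ _ P
  exact ⟨incl_injective P, ⟨muL_injective P, muL_surjective P⟩, doublePair P,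
    ⟨(isLamD_iff H P _).2 rfl, fun _ => (isLamD_iff H P _).1⟩,
    ⟨(isRhoD_iff H P _).2 rfl, fun _ => (isRhoD_iff H P _).1⟩, rfl, rfl, rfl⟩
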